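/- **Setting.** A *bidirected tree* is a finite undirected tree $G$ on a node set $V$, $n=|V|\ge 1$, in which every edge $\{u,v\}$ stands for the two directed edges $(u,v)$, $(v,u)$; each directed edge carries probabilities $0\le p_{uv}\le p'_{uv}\le 1$. Given seeds $S\subseteq V$ and boosted nodes $B\subseteq V$, influence spreads in discrete time: initially the nodes of $S$ are active; each newly activated node $u$ tries once, independently, to activate each inactive neighbour $v$, with success probability $p^B_{uv}$, which is $p'_{uv}$ if $v\in B$ and $p_{uv}$ otherwise. Let $\sigma_S(B)$ be the expected number of nodes active at the end, and $\Delta_S(B)=\sigma_S(B)-\sigma_S(\emptyset)$. For $k\in\mathbb N$ let $B^*$ maximize $\Delta_S(B)$ over all $B\subseteq V$ with $|B|\le k$. Let $ap_\emptyset(v)$ be the probability that $v$ becomes active if no node is boosted. Write $p^{1}_{uv}=p'_{uv}$, $p^0_{uv}=p_{uv}$. **General DP-Boost**$(G,S,k,\epsilon)$, $\epsilon>0$. Root the tree at any node $r$; give $r$ a virtual parent joined to it by an edge of probability $0$. Let $B_{greedy}$ be obtained from $\emptyset$ by $k$ times adding a not yet boosted node (if any) that maximizes $\sigma_S$, and put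 $$\delta=\frac{\epsilon\,\max(\Delta_S(B_{greedy}),1)}{2\sum_{v\in V}\sum_{x\in V}p^{(k)}(x\rightsquigarrow v)},$$ where $p^{(k)}(x\rightsquigarrow v)$ is the maximum, over sets of at most $k$ boosted nodes, of the product of the edge probabilities along the path from $x$ to $v$ ($1$ if $x=v$). For $\eta>0$ and $x\in[0,1]$ let $\lfloor x\rfloor_\eta=\eta\lfloor x/\eta\rfloor$ if $x<1$ and $\lfloor 1\rfloor_\eta=1$; let $\lfloor x\rfloor_0=x$. The *$\eta$-rounded* values are the multiples of $\eta$ in $[0,1)$ together with $1$. For every node $v$ (with parent $u$), $0\le\kappa\le k$ and $\delta$-rounded $c,f$, a value $g'(v,\kappa,c,f)\in\mathbb R\cup\{-\infty\}$ is computed from the leaves to the root, where maxima over the empty set are $-\infty$: * *$v$ has no children:* $g'=-\infty$ if $c\ne\mathbf 1(v\in S)$; otherwise $g'=\max\{1-(1-c)(1-f\,p_{uv}^{\mathbf 1(\kappa>0)})-ap_\emptyset(v),0\}$, and $v$ is boosted iff $\kappa>0$. * *$v\in S$ has children $v_1,\dots,v_d$, $d\ge1$:* $g'=-\infty$ if $c\ne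 1$, and $g'(v,\kappa,1,f)=\max\sum_i g'(v_i,\kappa_i,c_i,1)$ over all $\kappa_i$ with $\sum_i\kappa_i\le\kappa$ and all $\delta$-rounded $c_i$. * *$v\notin S$ has children $v_1,\dots,v_d$, $d\ge 1$:* $g'(v,\kappa,c,f)$ is the maximum of $$\sum_i g'(v_i,\kappa_i,c_i,f_i)+\max\{1-(1-c)(1-f\,p^b_{uv})-ap_\emptyset(v),0\}$$ over $b\in\{0,1\}$, $\kappa_i$ and $\delta$-rounded $c_i,f_i$ such that $\kappa=b+\sum_i\kappa_i$, $c=\lfloor x_d\rfloor_\delta$ and $f_i=\lfloor 1-(1-x_{i-1})(1-y_i)\rfloor_\delta$ for $1\le i\le d$, where $x_0=0$, $x_i=\lfloor 1-(1-x_{i-1})(1-c_i\,p^b_{v_iv})\rfloor_{\delta_v(i)}$ for $1\le i\le d$, $y_d=f\,p^b_{uv}$, $y_i=\lfloor 1-(1-y_{i+1})(1-c_{i+1}\,p^b_{v_{i+1}v})\rfloor_{\delta_v(i)}$ for $1\le i<d$, and $\delta_v(i)=\delta/(d-2)$ if $1<i<d$, $\delta_v(i)=0$ otherwise; $v$ is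 boosted iff $b=1$. These maxima are computed by adding one child at a time, with helper tables: for internal seeds $h(j,\kappa)$ is the best value of $\sum_{i\le j}g'(v_i,\kappa_i,c_i,1)$ with $\sum_{i\le j}\kappa_i\le\kappa$ ($h(0,\kappa)=0$ for all $\kappa$); for non-seed nodes with $d\ge2$ children, $h(b,j,\kappa,x_j,z_j)$, $2\le j\le d$, is the best value of $\sum_{i\le j}g'(v_i,\kappa_i,c_i,f_i)$ subject to the constraints above on the first $j$ children, with $b+\sum_{i\le j}\kappa_i=\kappa$, given $x_j$ and $y_j=z_j$ (rounded for mesh $\delta/(d-2)$) if $j<d$, and given $c=\lfloor x_d\rfloor_\delta$ and $z_d=f$ if $j=d$. It is computed for $j=2$ by enumerating $b,\kappa_1,\kappa_2,c_1,c_2,z_2$, and for $j>2$ from $h(b,j-1,\cdot)$ by enumerating $b,\kappa,\kappa_j,x_{j-1},c_j,z_j$. A node with one child is handled by enumerating $b,\kappa,c_1,f$. The algorithm returns the set $\tilde B$ of the nodes boosted in an assignment attaining $\max_c g'(r,k,c,0)$. Running time is the number of steps on a random access machine with unit-cost arithmetic, comparison and rounding of reals. **Theorem.** For every bidirected tree,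 root $r$, seed set $S$, $k\in\mathbb N$ and $\epsilon>0$: 1. If $\Delta_S(B^*)\ge1$, then general DP-Boost returns a set $\tilde B$ with $|\tilde B|\le k$ and $\Delta_S(\tilde B)\ge(1-\epsilon)\,\Delta_S(B^*)$. 2. There is an absolute constant $C$ such that for all $k\ge1$ and $0<\epsilon\le1$ its running time is at most $C\,k^2n^9/\epsilon^3$. 3. For every $D\in\mathbb N$ there is a constant $C_D$ such that, if every node of the rooted tree has at most $D$ children, $k\ge1$ and $0<\epsilon\le1$, its running time is at most $C_D\,k^2n^7/\epsilon^3$. 4. There are absolute constants $C,a$ such that for all $k\le n$ and all $\epsilon>0$ its running time is at most $C\,(n+1/\epsilon)^a$. Hence, for instances whose optimal boost is at least one, general DP-Boost is a fully polynomial-time approximation scheme. -/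

import Mathlib

namespace Boosting

/-! ### The influence boosting model on a bidirected tree -/

/-- A bidirected tree on the node set `V`: an undirected tree `G`, each of whose edges `{u, v}`
stands for the two directed edges `(u, v)` and `(v, u)`.  The directed edge `(u, v)` carries the
influence probability `p u v`, and the influence probability `p' u v` that is used when its head
`v` is boosted.  (Values of `p` and `p'` off the edges of the tree are never used.)
The list of nodes and the adjacency lists are the form in which an algorithm gets the tree. -/
structure BidirectedTree (V : Type) where
  G : SimpleGraph V
  isTree : G.IsTree
  p : V → V → ℝ
  p' : V → V → ℝ
  p_nonneg : ∀ u v, G.Adj u v → 0 ≤ p u v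
  p_le_p' : ∀ u v, G.Adj u v → p u v ≤ p' u v
  p'_le_one : ∀ u v, G.Adj u v → p' u v ≤ 1
  nodes : List V
  nodes_nodup : nodes.Nodup
  mem_nodes : ∀ v, v ∈ nodes
  adj : V → List V
  adj_nodup : ∀ v, (adj v).Nodup
  mem_adj : ∀ v w, w ∈ adj v ↔ G.Adj v w

section Model

variable {V : Type} (T : BidirectedTree V)

/-- The probability of the directed edge `(u, v)` when `v` is boosted (`b = true`) or not. -/
noncomputable def BidirectedTree.prob (b : Bool) (u v : V) : ℝ :=
  if b then T.p' u v else T.p u v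

/-- The number of children of `v` when the tree is rooted at `r`. -/
noncomputable def BidirectedTree.childCount (r v : V) : ℕ :=
  {w : V | T.G.Adj v w ∧ T.G.dist r w = T.G.dist r v + 1}.ncard

variable [Fintype V] [DecidableEq V]

open Classical in
/-- The directed edges. -/
noncomputable def BidirectedTree.edges : Finset (V × V) :=
  Finset.univ.filter fun e => T.G.Adj e.1 e.2

/-- A node `u` that gets activated tries exactly once to influence each neighbour `v`.  Let `ω` be
the set of directed edges whose attempt is successful.  The attempts are independent, and the one
along `(u, v)` succeeds with probability `p' u v` if `v` is boosted and `p u v` otherwise: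
this is the probability of the outcome `ω` when the set of boosted nodes is `B`. -/
noncomputable def BidirectedTree.outcomeProb (B : Finset V) (ω : Finset (V × V)) : ℝ :=
  ∏ e ∈ T.edges,
    if e ∈ ω then T.prob (decide (e.2 ∈ B)) e.1 e.2
    else 1 - T.prob (decide (e.2 ∈ B)) e.1 e.2

open Classical in
/-- The diffusion in discrete time, for a given outcome `ω` of the attempts: the pair of the set of
nodes active at time `t` and of its subset of nodes newly activated at time `t`. -/
noncomputable def diffusion (ω : Finset (V × V)) (S : Finset V) : ℕ → Finset V × Finset V
  | 0 => (S, S)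
  | t + 1 =>
    let A := (diffusion ω S t).1
    let N := (diffusion ω S t).2
    let X := Finset.univ.filter fun v => v ∉ A ∧ ∃ u ∈ N, (u, v) ∈ ω
    (A ∪ X, X)

/-- The nodes active at the end of the diffusion (which stops after at most `|V|` steps). -/
noncomputable def finalActive (ω : Finset (V × V)) (S : Finset V) : Finset V :=
  (diffusion ω S (Fintype.card V)).1

/-- The boosted influence spread `σ_S(B)`: the expected number of nodes that are active at the end
of the diffusion from the seeds `S` when the nodes in `B` are boosted. -/
noncomputable def BidirectedTree.spread (S B : Finset V) : ℝ :=
  ∑ ω ∈ T.edges.powerset, T.outcomeProb B ω * ((finalActive ω S).card : ℝ)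

/-- The boost of influence spread `Δ_S(B) = σ_S(B) - σ_S(∅)`. -/
noncomputable def BidirectedTree.boost (S B : Finset V) : ℝ :=
  T.spread S B - T.spread S ∅

/-- `B` is an optimal solution of the `k`-boosting problem. -/
def BidirectedTree.IsOptimalBoost (S : Finset V) (k : ℕ) (B : Finset V) : Prop :=
  B.card ≤ k ∧ ∀ B' : Finset V, B'.card ≤ k → T.boost S B' ≤ T.boost S B

end Model

/-! ### Programs with a step count

The cost model is a random access machine with real numbers.  Steps are charged only by `op` (one
step: every primitive operation, every iteration of a loop and every invocation of a recursive
procedure goes through it) and by `newTable` (allocating a table: one step per cell); all other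
programs are composed of these two.  Integer arithmetic
on indices, a constant amount each time, is part of the table access or loop iteration that needs
it.  Tables are used linearly: the version before a write is never accessed again, so that a write
is an in-place modification. -/

/-- The result of a computation together with the number of steps that it took. -/
structure Timed (α : Type) where
  val : α
  steps : ℕ

instance : Monad Timed where
  pure a := ⟨a, 0⟩
  bind x f := ⟨(f x.val).val, x.steps + (f x.val).steps⟩

/-- Take `a` as the result of one step. -/
def op {α : Type} (a : α) : Timed α := ⟨a, 1⟩

/-- The step charged for an invocation of a recursive procedure. -/
def call : Timed Unit := op ()

noncomputable def radd (x y : ℝ) : Timed ℝ := op (x + y)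
noncomputable def rsub (x y : ℝ) : Timed ℝ := op (x - y)
noncomputable def rmul (x y : ℝ) : Timed ℝ := op (x * y)
noncomputable def rdiv (x y : ℝ) : Timed ℝ := op (x / y)
noncomputable def rmax (x y : ℝ) : Timed ℝ := op (max x y)
noncomputable def rmin (x y : ℝ) : Timed ℝ := op (min x y)
noncomputable def rle (x y : ℝ) : Timed Bool := op (decide (x ≤ y))
noncomputable def rfloor (x : ℝ) : Timed ℕ := op ⌊x⌋₊
noncomputable def rceil (x : ℝ) : Timed ℕ := op ⌈x⌉₊
noncomputable def rcast (m : ℕ) : Timed ℝ := op (m : ℝ)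

/-- Allocate a table with `size` cells, all holding `a`. -/
def newTable {ι α : Type} (size : ℕ) (a : α) : Timed (ι → α) := ⟨fun _ => a, size⟩

def readAt {ι α : Type} (t : ι → α) (i : ι) : Timed α := op (t i)

def writeAt {ι α : Type} [DecidableEq ι] (t : ι → α) (i : ι) (a : α) : Timed (ι → α) :=
  op (Function.update t i a)

/-- Run `body i` for `i = 0, …, m - 1`, in this order, on the state `s`. -/
def forRange {σ : Type} : ℕ → σ → (ℕ → σ → Timed σ) → Timed σ
  | 0, s, _ => pure s
  | m + 1, s, body => do
    let s' ← forRange m s body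
    let s'' ← op s'
    body m s''

/-- Run `body a` for the elements `a` of a list, in their order, on the state `s`. -/
def forList {α σ : Type} : List α → σ → (α → σ → Timed σ) → Timed σ
  | [], s, _ => pure s
  | a :: l, s, body => do
    let s' ← op s
    let s'' ← body a s'
    forList l s'' body

/-- A set of nodes, written as a formal union.  A union is formed in one step, by pointers. -/
inductive NodeSet (V : Type) where
  | empty : NodeSet V
  | single (v : V) : NodeSet V
  | union (A B : NodeSet V) : NodeSet V

/-- The list of the members of `A`, followed by `acc`. -/
def NodeSet.collect {V : Type} : NodeSet V → List V → Timed (List V)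
  | .empty, acc => do
    call
    pure acc
  | .single v, acc => do
    call
    op (v :: acc)
  | .union A B, acc => do
    call
    let acc' ← B.collect acc
    A.collect acc'

/-- A table entry: `none` stands for `-∞`; `some (x, A)` is the value `x`, which is obtained by
boosting the nodes in `A`. -/
abbrev Entry (V : Type) := Option (ℝ × NodeSet V)

noncomputable def addEntry {V : Type} : Entry V → Entry V → Timed (Entry V)
  | some (x, A), some (y, B) => op (some (x + y, .union A B))
  | _, _ => op none

noncomputable def maxEntry {V : Type} : Entry V → Entry V → Timed (Entry V)
  | some (x, A), some (y, B) => op (if x < y then some (y, B) else some (x, A))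
  | some a, none => op (some a)
  | none, e => op e

/-- `t i := max (t i) e`. -/
noncomputable def improve {V ι : Type} [DecidableEq ι] (t : ι → Entry V) (i : ι) (e : Entry V) :
    Timed (ι → Entry V) := do
  let old ← readAt t i
  let new ← maxEntry old e
  writeAt t i new

/-- `1 - (1 - x) (1 - y)`. -/
noncomputable def orProb (x y : ℝ) : Timed ℝ := do
  let a ← rsub 1 x
  let b ← rsub 1 y
  let c ← rmul a b
  rsub 1 c

def lengthOf {α : Type} (l : List α) : Timed ℕ :=
  forList l 0 fun _ m => pure (m + 1)

section Input

variable {V : Type} [DecidableEq V] (T : BidirectedTree V)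

/-- Read off the input the probability of the edge `(u, v)` if `v` is boosted (`b = true`) or not. -/
noncomputable def readProb (b : Bool) (u v : V) : Timed ℝ := op (T.prob b u v)

/-- The same for the edge from the parent of `v`; the root has a virtual parent with an edge of
probability zero. -/
noncomputable def readParentProb (b : Bool) : Option V → V → Timed ℝ
  | none, _ => op 0
  | some u, v => readProb T b u v

/-- Read off the input whether `v` is a seed. -/
def isSeed (S : Finset V) (v : V) : Timed Bool := op (decide (v ∈ S))

def isParent (u : Option V) (w : V) : Timed Bool := op (decide (u = some w))

end Input

/-! ### Greedy-Boost and the rounding parameter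

All recursive procedures below get a first argument `fuel`, a bound on the depth of the recursion;
they are called with the number of nodes of the tree, so that it is never exhausted. -/

section Greedy

variable {V : Type} [DecidableEq V] (T : BidirectedTree V) (S : Finset V)

/-- The probability that `v` is activated in the component of `v` after its neighbour `u` is removed
(in the whole tree if `u = none`), when the nodes marked in `B` are boosted. -/
noncomputable def activation (B : V → Bool) : ℕ → Option V → V → Timed ℝ
  | 0, _, _ => pure 0
  | fuel + 1, u, v => do
    call
    if ← isSeed S v then
      pure 1
    else
      let b ← readAt B v
      let q ← forList (T.adj v) 1 fun w q => do
        if ← isParent u w then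
          pure q
        else
          let a ← activation B fuel (some v) w
          let e ← readProb T b w v
          let t ← rmul a e
          let s ← rsub 1 t
          rmul q s
      rsub 1 q

/-- The spread of `S` when the nodes marked in `B` are boosted, as the sum over all nodes of their
activation probabilities. -/
noncomputable def computeSpread (n : ℕ) (B : V → Bool) : Timed ℝ :=
  forList T.nodes 0 fun v s => do
    let a ← activation T S B n none v
    radd s a

/-- A round of the greedy algorithm: among the nodes that are not yet boosted, boost one that
maximizes the resulting spread. -/
noncomputable def greedyRound (n : ℕ) (B : V → Bool) : Timed (V → Bool) := do
  let st ← forList T.nodes ((B, none) : (V → Bool) × Option (V × ℝ)) fun v st => do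
    if ← readAt st.1 v then
      pure st
    else
      let B₁ ← writeAt st.1 v true
      let s ← computeSpread T S n B₁
      let B₂ ← writeAt B₁ v false
      match st.2 with
      | none => pure (B₂, some (v, s))
      | some (w, t) =>
        if ← rle s t then pure (B₂, some (w, t)) else pure (B₂, some (v, s))
  match st.2 with
  | none => pure st.1
  | some (v, _) => writeAt st.1 v true

/-- The boost of the set of (at most) `k` nodes selected by the greedy algorithm. -/
noncomputable def greedyBoost (n k : ℕ) : Timed ℝ := do
  let B₀ ← newTable n false
  let s₀ ← computeSpread T S n B₀
  let B ← forRange k B₀ fun _ B => greedyRound T S n B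
  let s ← computeSpread T S n B
  rsub s s₀

/-- The sum, over all nodes `y` that can be reached from `v` without passing `u`, of the maximum
probability that a node `x` influences `y` if at most `k` nodes are boosted.  Here `q j` is the
maximum probability that `x` influences `v` if at most `j` nodes are boosted. -/
noncomputable def sumReach (k : ℕ) : ℕ → Option V → V → (ℕ → ℝ) → Timed ℝ
  | 0, _, _, _ => pure 0
  | fuel + 1, u, v, q => do
    call
    let s ← readAt q k
    forList (T.adj v) s fun w s => do
      if ← isParent u w then
        pure s
      else
        let e₀ ← readProb T false v w
        let e₁ ← readProb T true v w
        let t₀ ← newTable (k + 1) 0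
        let t ← forRange (k + 1) t₀ fun j t => do
          let a ← readAt q j
          let x ← rmul a e₀
          if j = 0 then
            writeAt t j x
          else
            let a' ← readAt q (j - 1)
            let y ← rmul a' e₁
            let m ← rmax x y
            writeAt t j m
        let s' ← sumReach k fuel (some v) w t
        radd s s'

/-- The rounding parameter `δ = ε max(LB, 1) / (2 ∑_v ∑_x p⁽ᵏ⁾(x ⇝ v))`, where `LB` is the boost of
the greedy solution and `p⁽ᵏ⁾(x ⇝ v)` is the maximum probability that `x` influences `v` if at most
`k` nodes are boosted. -/
noncomputable def roundingParameter (n k : ℕ) (ε : ℝ) : Timed ℝ := do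
  let lb ← greedyBoost T S n k
  let m ← rmax lb 1
  let num ← rmul ε m
  let s ← forList T.nodes 0 fun x s => do
    let q ← newTable (k + 1) 1
    let t ← sumReach T k n none x q
    radd s t
  let den ← rmul 2 s
  rdiv num den

end Greedy

/-! ### The rounded dynamic programming -/

/-- The rounded values in `[0, 1]` for a mesh `η`: the multiples of `η` below `1`, and `1`.
They are represented by their indices `0, …, top`, where `top = ⌈1 / η⌉`. -/
structure Grid where
  mesh : ℝ
  top : ℕ

noncomputable def mkGrid (η : ℝ) : Timed Grid := do
  let q ← rdiv 1 η
  let m ← rceil q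
  pure ⟨η, m⟩

/-- The value with index `i`. -/
noncomputable def Grid.value (γ : Grid) (i : ℕ) : Timed ℝ := do
  let m ← rcast i
  let x ← rmul m γ.mesh
  rmin x 1

/-- The index of the largest rounded value that is at most `x`. -/
noncomputable def Grid.round (γ : Grid) (x : ℝ) : Timed ℕ := do
  if ← rle 1 x then
    pure γ.top
  else
    let q ← rdiv x γ.mesh
    rfloor q

/-- The table of `g'(v, κ, c, f)` for a node `v`; `c` and `f` are indices of rounded values. -/
abbrev Table (V : Type) := ℕ × ℕ × ℕ → Entry V

section DP

variable {V : Type} [DecidableEq V] (T : BidirectedTree V) (S : Finset V) (k : ℕ) (γ : Grid)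

/-- `max {1 - (1 - c) (1 - f e) - ap, 0}`. -/
noncomputable def nodeBoost (c f e ap : ℝ) : Timed ℝ := do
  let t ← rmul f e
  let o ← orProb c t
  let d ← rsub o ap
  rmax d 0

/-- The set `{v}` if `b`, and `∅` otherwise. -/
def singleIf (b : Bool) (v : V) : NodeSet V := if b then .single v else .empty

/-- A leaf `v` with parent `u`. -/
noncomputable def leaf (ap : ℝ) (u : Option V) (v : V) : Timed (Table V) := do
  let g₀ ← newTable ((k + 1) * (γ.top + 1) * (γ.top + 1)) none
  let s ← isSeed S v
  let c := if s then γ.top else 0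
  let cv ← γ.value c
  forRange (k + 1) g₀ fun κ g =>
    forRange (γ.top + 1) g fun f g => do
      let b := decide (0 < κ)
      let fv ← γ.value f
      let e ← readParentProb T b u v
      let x ← nodeBoost cv fv e ap
      writeAt g (κ, c, f) (some (x, singleIf b v))

/-- An internal seed node, given the tables of its children.  The helper table `h κ` is the best
total value for the children treated so far, with `κ` nodes to boost in their subtrees. -/
noncomputable def internalSeed (kids : List (V × Table V)) : Timed (Table V) := do
  let g₀ ← newTable ((k + 1) * (γ.top + 1) * (γ.top + 1)) none
  let h₀ ← newTable (k + 1) (some (0, .empty))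
  let h ← forList kids h₀ fun kid h => do
    let h' ← newTable (k + 1) none
    forRange (k + 1) h' fun κi h' => do
      let best ← forRange (γ.top + 1) none fun c m => do
        let e ← readAt kid.2 (κi, c, γ.top)
        maxEntry m e
      forRange (k + 1 - κi) h' fun j h' => do
        let a ← readAt h j
        let e ← addEntry a best
        improve h' (κi + j) e
  forRange (k + 1) g₀ fun κ g =>
    forRange (γ.top + 1) g fun f g => do
      let e ← readAt h κ
      writeAt g (κ, γ.top, f) e

/-- A non-seed node `v` with parent `u` and exactly one child `w`, whose table is `g₁`. -/
noncomputable def nonseedWithChild (ap : ℝ) (u : Option V) (v w : V) (g₁ : Table V) :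
    Timed (Table V) := do
  let g₀ ← newTable ((k + 1) * (γ.top + 1) * (γ.top + 1)) none
  forList [false, true] g₀ fun b g => do
    let e ← readParentProb T b u v
    let e₁ ← readProb T b w v
    forRange (γ.top + 1) g fun c₁ g =>
      forRange (γ.top + 1) g fun f g => do
        let c₁v ← γ.value c₁
        let fv ← γ.value f
        let x ← rmul c₁v e₁
        let c ← γ.round x
        let y ← rmul fv e
        let f₁ ← γ.round y
        let cv ← γ.value c
        let z ← nodeBoost cv fv e ap
        forRange (k + 1 - b.toNat) g fun κ₁ g => do
          let a ← readAt g₁ (κ₁, c₁, f₁)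
          let a' ← addEntry a (some (z, singleIf b v))
          improve g (κ₁ + b.toNat, c, f) a'

/-- The boundary case `i = 2` of the helper table `h(b, i, κ, x, z)` of a non-seed node `v` with
parent `u` and at least two children; `x` and `z` are indices of values rounded by the grid `γ₂`,
which is `γ` if there are exactly two children (`last = true`). -/
noncomputable def helperStart (b last : Bool) (γ₂ : Grid) (u : Option V) (v w₁ w₂ : V)
    (g₁ g₂ : Table V) : Timed (Table V) := do
  let h₀ ← newTable ((k + 1) * (γ₂.top + 1) * (γ₂.top + 1)) none
  let e ← readParentProb T b u v
  let e₁ ← readProb T b w₁ v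
  let e₂ ← readProb T b w₂ v
  forRange (γ.top + 1) h₀ fun c₁ h =>
    forRange (γ.top + 1) h fun c₂ h =>
      forRange (γ₂.top + 1) h fun z h => do
        let c₁v ← γ.value c₁
        let c₂v ← γ.value c₂
        let zv ← γ₂.value z
        let a₁ ← rmul c₁v e₁
        let a₂ ← rmul c₂v e₂
        let xv ← orProb a₁ a₂
        let x ← γ₂.round xv
        let y ← if last then rmul zv e else pure zv
        let f₁v ← orProb a₂ y
        let f₁ ← γ.round f₁v
        let f₂v ← orProb a₁ y
        let f₂ ← γ.round f₂v
        forRange (k + 1) h fun κ₁ h =>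
          forRange (k + 1 - κ₁ - b.toNat) h fun κ₂ h => do
            let r₁ ← readAt g₁ (κ₁, c₁, f₁)
            let r₂ ← readAt g₂ (κ₂, c₂, f₂)
            let r ← addEntry r₁ r₂
            improve h (κ₁ + κ₂ + b.toNat, x, z) r

/-- The helper table for the first `i` children, computed from the one `h` for the first `i - 1`
children (on the grid `γf`) and the table `gi` of the `i`-th child `w`, where `2 < i`.  The indices
`x` and `z` of the new table refer to the grid `γi`, which is `γ` if `w` is the last child
(`last = true`). -/
noncomputable def helperStep (b last : Bool) (γf γi : Grid) (u : Option V) (v w : V)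
    (h gi : Table V) : Timed (Table V) := do
  let h₀ ← newTable ((k + 1) * (γi.top + 1) * (γi.top + 1)) none
  let e ← readParentProb T b u v
  let ei ← readProb T b w v
  forRange (γf.top + 1) h₀ fun x h' =>
    forRange (γ.top + 1) h' fun c h' =>
      forRange (γi.top + 1) h' fun z h' => do
        let xv ← γf.value x
        let cv ← γ.value c
        let zv ← γi.value z
        let a ← rmul cv ei
        let xiv ← orProb xv a
        let xi ← γi.round xiv
        let y ← if last then rmul zv e else pure zv
        let zpv ← orProb a y
        let zp ← γf.round zpv
        let fv ← orProb xv y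
        let f ← γ.round fv
        forRange (k + 1) h' fun κ h' =>
          forRange (κ + 1) h' fun κi h' => do
            let r₁ ← readAt h (κ - κi, x, zp)
            let r₂ ← readAt gi (κi, c, f)
            let r ← addEntry r₁ r₂
            improve h' (κ, xi, z) r

/-- Treat the children from the third one on. -/
noncomputable def helperSteps (b : Bool) (γf : Grid) (u : Option V) (v : V) :
    List (V × Table V) → Table V → Timed (Table V)
  | [], h => pure h
  | kid :: rest, h => do
    call
    let last := rest.isEmpty
    let h' ← helperStep T k γ b last γf (if last then γ else γf) u v kid.1 h kid.2
    helperSteps b γf u v rest h'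

/-- A non-seed node `v` with parent `u` and `d ≥ 2` children: `kid₁`, `kid₂` and the `d - 2` members
of the list `rest`.  The intermediate values `x_i` and `y_i`, `1 < i < d`, are rounded to multiples
of `δ / (d - 2)`. -/
noncomputable def nonseedWithChildren (ap : ℝ) (u : Option V) (v : V) (kid₁ kid₂ : V × Table V)
    (rest : List (V × Table V)) : Timed (Table V) := do
  let g₀ ← newTable ((k + 1) * (γ.top + 1) * (γ.top + 1)) none
  let m ← lengthOf rest
  let mv ← rcast m
  let η ← rdiv γ.mesh mv
  let last := rest.isEmpty
  let γf ← mkGrid η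
  let γ₂ := if last then γ else γf
  forList [false, true] g₀ fun b g => do
    let h₂ ← helperStart T k γ b last γ₂ u v kid₁.1 kid₂.1 kid₁.2 kid₂.2
    let h ← helperSteps T k γ b γf u v rest h₂
    let e ← readParentProb T b u v
    forRange (k + 1) g fun κ g =>
      forRange (γ.top + 1) g fun c g =>
        forRange (γ.top + 1) g fun f g => do
          let cv ← γ.value c
          let fv ← γ.value f
          let z ← nodeBoost cv fv e ap
          let a ← readAt h (κ, c, f)
          let a' ← addEntry a (some (z, singleIf b v))
          improve g (κ, c, f) a'

/-- The table of `v`, whose parent is `u`, from the tables of its children; `B₀` marks no node. -/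
noncomputable def solve (n : ℕ) (B₀ : V → Bool) : ℕ → Option V → V → Timed (Table V)
  | 0, _, _ => pure fun _ => none
  | fuel + 1, u, v => do
    call
    let kids ← forList (T.adj v) [] fun w l => do
      if ← isParent u w then
        pure l
      else
        let g ← solve n B₀ fuel (some v) w
        pure ((w, g) :: l)
    let ap ← activation T S B₀ n none v
    let s ← isSeed S v
    match kids with
    | [] => leaf T S k γ ap u v
    | [kid] =>
      if s then internalSeed k γ [kid] else nonseedWithChild T k γ ap u v kid.1 kid.2
    | kid₁ :: kid₂ :: rest =>
      if s then internalSeed k γ (kid₁ :: kid₂ :: rest)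
      else nonseedWithChildren T k γ ap u v kid₁ kid₂ rest

end DP

/-- General DP-Boost, on the bidirected tree `T` rooted at `r`, with seeds `S`, at most `k` nodes to
boost, and accuracy `ε`. It returns the node set that attains `max_c g'(r, k, c, 0)`. -/
noncomputable def dpBoost {V : Type} [DecidableEq V] (T : BidirectedTree V) (r : V) (S : Finset V)
    (k : ℕ) (ε : ℝ) : Timed (List V) := do
  let n ← lengthOf T.nodes
  let δ ← roundingParameter T S n k ε
  let γ ← mkGrid δ
  let B₀ ← newTable n false
  let g ← solve T S k γ n B₀ n none r
  let best ← forRange (γ.top + 1) none fun c m => do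
    let e ← readAt g (k, c, 0)
    maxEntry m e
  match best with
  | none => pure []
  | some (_, A) => A.collect []

end Boosting

/-! On a tree the influence factorizes. Once `u` is removed, `v` can only be activated through its
remaining neighbours, each in a component of its own, and the failures of these neighbours depend on
disjoint sets of directed edges. So the probability `infl` that `v` becomes active inside its
component obeys a product recursion. Two facts tie this recursion to the diffusion: for a fixed
outcome, the recursion with edge probabilities 0 and 1 is the indicator of `finalActive`
(`infl_edgeInd_eq`), and by independence the expectation commutes with the recursion
(`expect_inflAux`). Hence the spread is the sum of the values `infl` (`spread_eq`).

The approximation guarantee is a sandwich. From above (`solve_entrySound`): every rounding goes down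
and every formula is monotone, so a finite entry `(x, A)` never exceeds the total gain that boosting
`A` produces in the component, provided `f` does not exceed the true activation probability of the
parent. At the root, where there is no parent, `f = 0` satisfies this, so `x` is at most the boost
of `A`, and `A` has at most `k` members.

From below (`solve_tableComplete`): for an admissible assignment one follows the rounded values. On
the unit interval `1 - (1 - x) (1 - y)` is 1-Lipschitz in each argument (`orR_sub_le`), so errors
add up, and passing an edge multiplies an error by the edge probability. The roundings at one node
add at most `2δ` to each transmitted value: `δ` for `c` or `f` itself, and `d - 2` intermediate
roundings of mesh `δ / (d - 2)`. An error made at `x` reaches `v` multiplied by the path product, so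
the total loss is at most `2δ` times the sum of all path products, which is at most `ε max(LB, 1)`
by the choice of `δ`. This is at most `ε` times the optimum, because the greedy set is admissible
(its quality plays no role) and the optimum is at least 1.

Not every set of at most `k` nodes is an admissible assignment, because budgets must be used up
exactly at non-seeds and a leaf is boosted whenever its budget is positive. But every set can be
made admissible, without loss, by dropping seeds and spending the surplus at one leaf or letting an
internal seed absorb it (`exists_feasible`).

For the running time, `δ ≥ ε / (2n²)`, so there are `M = O(n²/ε)` rounded values, and a node with at
most `d` children uses intermediate grids with `O(d M)` values. Adding one child costs `O(k² M (d
M)²)`, and each node is added to its parent once. This gives `O(k² d² n⁷ / ε³)`; the bounds of the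
theorem are the cases `d = n` and `d = D`. Greedy and the computation of `δ` cost only `O(k n³)`. -/

set_option linter.unusedSectionVars false

namespace Boosting

/-! ### Values and step counts of the loops -/

section Timed

variable {α β σ : Type}

@[simp] theorem pure_val (a : α) : (pure a : Timed α).val = a := rfl
@[simp] theorem pure_steps (a : α) : (pure a : Timed α).steps = 0 := rfl
@[simp] theorem bind_val (x : Timed α) (f : α → Timed β) : (x >>= f).val = (f x.val).val := rfl
@[simp] theorem bind_steps (x : Timed α) (f : α → Timed β) :
    (x >>= f).steps = x.steps + (f x.val).steps := rfl
@[simp] theorem op_val (a : α) : (op a).val = a := rfl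
@[simp] theorem op_steps (a : α) : (op a).steps = 1 := rfl
@[simp] theorem call_steps : call.steps = 1 := rfl
@[simp] theorem newTable_val {ι : Type} (m : ℕ) (a : α) :
    (newTable m a : Timed (ι → α)).val = fun _ => a := rfl
@[simp] theorem newTable_steps {ι : Type} (m : ℕ) (a : α) :
    (newTable m a : Timed (ι → α)).steps = m := rfl

theorem ite_val (c : Prop) [Decidable c] (x y : Timed α) :
    (if c then x else y).val = if c then x.val else y.val := by split <;> rfl

theorem forRange_succ_val (m : ℕ) (s : σ) (body : ℕ → σ → Timed σ) :
    (forRange (m + 1) s body).val = (body m (forRange m s body).val).val := rfl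

theorem forRange_succ_steps (m : ℕ) (s : σ) (body : ℕ → σ → Timed σ) :
    (forRange (m + 1) s body).steps =
      (forRange m s body).steps + (1 + (body m (forRange m s body).val).steps) := rfl

theorem forRange_ind {body : ℕ → σ → Timed σ} (I : σ → Prop) {m : ℕ} {s : σ} (h₀ : I s)
    (h : ∀ i < m, ∀ s, I s → I (body i s).val) : I (forRange m s body).val := by
  induction m with
  | zero => exact h₀
  | succ m ih =>
    exact h m (Nat.lt_succ_self m) _ (ih fun i hi => h i (Nat.lt_succ_of_lt hi))

/-- One iteration establishes `I` from any state and all iterations preserve it. This is the tool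
for completeness: a candidate offered to a table in one iteration is not lost later. Soundness uses
`forRange_ind`. -/
theorem forRange_reach {body : ℕ → σ → Timed σ} (I : σ → Prop) {m i₀ : ℕ} {s : σ} (hi₀ : i₀ < m)
    (h₀ : ∀ s, I (body i₀ s).val) (h : ∀ i < m, ∀ s, I s → I (body i s).val) :
    I (forRange m s body).val := by
  induction m with
  | zero => omega
  | succ m ih =>
    rcases Nat.lt_succ_iff_lt_or_eq.1 hi₀ with hlt | rfl
    · exact h m (Nat.lt_succ_self m) _ (ih hlt fun i hi => h i (Nat.lt_succ_of_lt hi))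
    · exact h₀ _

theorem forRange_steps_le {body : ℕ → σ → Timed σ} {m c : ℕ} {s : σ}
    (h : ∀ i < m, ∀ s, (body i s).steps ≤ c) : (forRange m s body).steps ≤ m * (c + 1) := by
  induction m with
  | zero => exact Nat.zero_le _
  | succ m ih =>
    have h₁ := ih fun i hi => h i (Nat.lt_succ_of_lt hi)
    have h₂ := h m (Nat.lt_succ_self m) (forRange m s body).val
    rw [forRange_succ_steps, Nat.succ_mul]
    omega

@[simp] theorem forList_nil (s : σ) (body : α → σ → Timed σ) : forList [] s body = pure s := rfl

theorem forList_cons_val (a : α) (l : List α) (s : σ) (body : α → σ → Timed σ) :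
    (forList (a :: l) s body).val = (forList l (body a s).val body).val := rfl

theorem forList_cons_steps (a : α) (l : List α) (s : σ) (body : α → σ → Timed σ) :
    (forList (a :: l) s body).steps =
      1 + ((body a s).steps + (forList l (body a s).val body).steps) := rfl

theorem forList_val (l : List α) (s : σ) (body : α → σ → Timed σ) :
    (forList l s body).val = l.foldl (fun s a => (body a s).val) s := by
  induction l generalizing s with
  | nil => rfl
  | cons a l ih => rw [forList_cons_val, ih]; rfl

theorem forList_ind {body : α → σ → Timed σ} (I : σ → Prop) {l : List α} {s : σ} (h₀ : I s)
    (h : ∀ a ∈ l, ∀ s, I s → I (body a s).val) : I (forList l s body).val := by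
  induction l generalizing s with
  | nil => exact h₀
  | cons a l ih =>
    rw [forList_cons_val]
    exact ih (h a (by simp) _ h₀) fun b hb => h b (by simp [hb])

theorem forList_reach {body : α → σ → Timed σ} (I : σ → Prop) {l : List α} {a₀ : α} {s : σ}
    (ha₀ : a₀ ∈ l) (h₀ : ∀ s, I (body a₀ s).val) (h : ∀ a ∈ l, ∀ s, I s → I (body a s).val) :
    I (forList l s body).val := by
  induction l generalizing s with
  | nil => simp at ha₀
  | cons a l ih =>
    rw [forList_cons_val]
    rcases List.mem_cons.1 ha₀ with rfl | hmem
    · exact forList_ind I (h₀ _) fun b hb => h b (by simp [hb])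
    · exact ih hmem fun b hb => h b (by simp [hb])

theorem forList_steps_le {body : α → σ → Timed σ} {l : List α} {c : α → ℕ} {s : σ}
    (h : ∀ a ∈ l, ∀ s, (body a s).steps ≤ c a) :
    (forList l s body).steps ≤ (l.map c).sum + l.length := by
  induction l generalizing s with
  | nil => simp
  | cons a l ih =>
    have h₁ := ih (s := (body a s).val) fun b hb => h b (by simp [hb])
    have h₂ := h a (by simp) s
    rw [forList_cons_steps, List.map_cons, List.sum_cons, List.length_cons]
    omega

theorem forList_steps_le_mul {body : α → σ → Timed σ} {l : List α} {c : ℕ} {s : σ}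
    (h : ∀ a ∈ l, ∀ s, (body a s).steps ≤ c) :
    (forList l s body).steps ≤ l.length * (c + 1) := by
  refine (forList_steps_le h).trans ?_
  simp [Nat.mul_succ]

@[simp] theorem lengthOf_val (l : List α) : (lengthOf l).val = l.length := by
  have key : ∀ m : ℕ, (forList l m fun _ m => pure (m + 1)).val = m + l.length := by
    induction l with
    | nil => simp
    | cons a l ih =>
      intro m
      rw [forList_cons_val, pure_val, ih, List.length_cons]
      omega
  exact (key 0).trans (Nat.zero_add _)

theorem lengthOf_steps (l : List α) : (lengthOf l).steps ≤ l.length := by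
  simpa [lengthOf] using forList_steps_le_mul (l := l) (s := 0) (c := 0)
    (body := fun _ m => (pure (m + 1) : Timed ℕ)) (by simp)

end Timed

namespace BidirectedTree

variable {V : Type} (T : BidirectedTree V)

/-! ### The components of the tree after the removal of a node -/

/-- `u` is a neighbour of `v`, if there is one. -/
def IsDir (u : Option V) (v : V) : Prop := ∀ u', u = some u' → T.G.Adj u' v

theorem isDir_none (v : V) : T.IsDir none v := by simp [IsDir]

theorem isDir_some {u v : V} (h : T.G.Adj u v) : T.IsDir (some u) v := by simpa [IsDir] using h

/-- `x` is in the component of `v` after `u` is removed. -/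
def Below (u : Option V) (v x : V) : Prop :=
  ∃ p : T.G.Walk v x, ∀ u', u = some u' → u' ∉ p.support

variable {T}

/-- If `w ≠ w'`, the edge to `w'` and the detour through `w` would be two paths from `v` to `w'`.
The disjointness and nesting of components are consequences. -/
theorem eq_of_walk_avoiding {v w w' : V} (h : T.G.Adj v w) (h' : T.G.Adj v w')
    (p : T.G.Walk w w') (hp : v ∉ p.support) : w = w' := by
  classical
  have h₁ : (SimpleGraph.Walk.cons h p.bypass).IsPath :=
    (SimpleGraph.Walk.cons_isPath_iff h _).2
      ⟨p.bypass_isPath, fun hv => hp (p.support_bypass_subset_support hv)⟩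
  have h₂ : (SimpleGraph.Walk.cons h' SimpleGraph.Walk.nil).IsPath := by
    simp [h'.ne]
  have h₃ := T.isTree.existsUnique_path v w' |>.unique h₁ h₂
  rw [SimpleGraph.Walk.cons.injEq] at h₃
  exact h₃.1

theorem Below.self {u : Option V} {v : V} (h : T.IsDir u v) : T.Below u v v :=
  ⟨.nil, fun u' hu' => by simpa using (h u' hu').ne⟩

theorem below_none (v x : V) : T.Below none v x := by
  obtain ⟨p⟩ := T.isTree.connected.preconnected v x
  exact ⟨p, by simp⟩

theorem not_below_self (v w : V) : ¬ T.Below (some v) w v :=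
  fun ⟨p, hp⟩ => hp v rfl p.end_mem_support

/-- A common node `x` joins `w` to `w'` by a walk that avoids `v`. -/
theorem Below.trans_avoiding {v w w' x : V} (h : T.G.Adj v w) (h' : T.G.Adj v w')
    (hx : T.Below (some v) w x) (hx' : T.Below (some v) w' x) : w = w' := by
  obtain ⟨p, hp⟩ := hx
  obtain ⟨q, hq⟩ := hx'
  refine eq_of_walk_avoiding h h' (p.append q.reverse) ?_
  rw [SimpleGraph.Walk.mem_support_append_iff, SimpleGraph.Walk.support_reverse, List.mem_reverse]
  exact fun h => h.elim (hp v rfl) (hq v rfl)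

theorem Below.of_child {u : Option V} {v w x : V} (hu : T.IsDir u v) (h : T.G.Adj v w)
    (hw : u ≠ some w) (hx : T.Below (some v) w x) : T.Below u v x := by
  classical
  obtain ⟨p, hp⟩ := hx
  refine ⟨.cons h p, fun u' hu' => ?_⟩
  rw [SimpleGraph.Walk.support_cons, List.mem_cons]
  rintro (rfl | hmem)
  · exact (hu _ hu').ne rfl
  · refine hw ?_
    rw [hu', eq_of_walk_avoiding h (hu _ hu').symm (p.takeUntil u' hmem)
      fun hv => hp v rfl (p.support_takeUntil_subset_support _ hv)]

theorem Below.eq_or_child {u : Option V} {v x : V} (hx : T.Below u v x) :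
    x = v ∨ ∃ w, T.G.Adj v w ∧ u ≠ some w ∧ T.Below (some v) w x := by
  classical
  obtain ⟨p, hp⟩ := hx
  have hp' : ∀ u', u = some u' → u' ∉ p.bypass.support :=
    fun u' hu' hmem => hp u' hu' (p.support_bypass_subset_support hmem)
  have hpath := p.bypass_isPath
  generalize p.bypass = q at hp' hpath
  cases q with
  | nil => exact Or.inl rfl
  | cons h q =>
    rw [SimpleGraph.Walk.cons_isPath_iff] at hpath
    refine Or.inr ⟨_, h, fun hu => hp' _ hu ?_, q, ?_⟩
    · simp
    · rintro _ ⟨⟩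
      exact hpath.2

section Comp

variable [Fintype V]

open Classical in
variable (T) in
/-- The component of `v` after `u` is removed. -/
noncomputable def comp (u : Option V) (v : V) : Finset V := Finset.univ.filter (T.Below u v)

theorem mem_comp {u : Option V} {v x : V} : x ∈ T.comp u v ↔ T.Below u v x := by simp [comp]

theorem comp_none (v : V) : T.comp none v = Finset.univ := by
  ext x; simp [mem_comp, below_none]

theorem self_mem_comp {u : Option V} {v : V} (h : T.IsDir u v) : v ∈ T.comp u v :=
  mem_comp.2 (Below.self h)

theorem not_mem_comp_kid (v w : V) : v ∉ T.comp (some v) w :=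
  fun h => not_below_self _ _ (mem_comp.1 h)

theorem disjoint_comp {v w w' : V} (h : T.G.Adj v w) (h' : T.G.Adj v w') (hne : w ≠ w') :
    Disjoint (T.comp (some v) w) (T.comp (some v) w') :=
  Finset.disjoint_left.2 fun _ hx hx' =>
    hne ((mem_comp.1 hx).trans_avoiding h h' (mem_comp.1 hx'))

end Comp

/-! ### Rooted traversal -/

section Traversal

variable [DecidableEq V]

variable (T) in
/-- The neighbours of `v` other than `u`. -/
def kids (u : Option V) (v : V) : List V := (T.adj v).filter fun w => !decide (u = some w)

theorem mem_kids {u : Option V} {v w : V} : w ∈ T.kids u v ↔ T.G.Adj v w ∧ u ≠ some w := by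
  simp [kids, T.mem_adj]

theorem kids_nodup (u : Option V) (v : V) : (T.kids u v).Nodup := (T.adj_nodup v).filter _

theorem kids_none (v : V) : T.kids none v = T.adj v := by simp [kids]

theorem isDir_kid {u : Option V} {v w : V} (h : w ∈ T.kids u v) : T.IsDir (some v) w :=
  T.isDir_some (mem_kids.1 h).1

theorem adj_perm {u : Option V} {v : V} (hu : T.IsDir u v) :
    (T.adj v).Perm (T.kids u v ++ u.toList) := by
  refine (List.perm_ext_iff_of_nodup (T.adj_nodup v) ?_).2 fun w => ?_
  · refine (kids_nodup u v).append ?_ ?_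
    · cases u <;> simp
    · intro w hw hw'
      rw [Option.mem_toList] at hw'
      exact (mem_kids.1 hw).2 hw'
  · rw [T.mem_adj, List.mem_append, mem_kids, Option.mem_toList]
    refine ⟨fun h => ?_, ?_⟩
    · by_cases hw : u = some w
      · exact Or.inr hw
      · exact Or.inl ⟨h, hw⟩
    · rintro (h | h)
      · exact h.1
      · exact (hu w h).symm

/-- The change of viewpoint behind the values `f_i`: seen from its child `w`, the node `v` is
influenced by the children before `w`, the children after `w`, and its parent. -/
theorem kids_some_perm {u : Option V} {v w : V} {K R : List V} (hu : T.IsDir u v)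
    (h : (T.kids u v).Perm (K ++ w :: R)) : (T.kids (some w) v).Perm (K ++ (R ++ u.toList)) := by
  have hw : w ∈ T.kids u v := h.mem_iff.2 (by simp)
  have h₁ := adj_perm (T.isDir_some (mem_kids.1 hw).1.symm)
  have h₂ : (T.adj v).Perm (w :: (K ++ (R ++ u.toList))) := by
    refine (adj_perm hu).trans ?_
    refine (h.append_right _).trans ?_
    simp only [List.append_assoc, List.cons_append]
    exact List.perm_middle
  have h₃ : (T.kids (some w) v ++ (some w).toList).Perm (w :: T.kids (some w) v) := by
    exact List.perm_append_comm
  exact List.Perm.cons_inv ((h₃.symm.trans h₁.symm).trans h₂)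

variable [Fintype V]

theorem comp_kid_subset {u : Option V} {v w : V} (hu : T.IsDir u v) (hw : w ∈ T.kids u v) :
    T.comp (some v) w ⊆ T.comp u v := fun _ hx =>
  mem_comp.2 ((mem_comp.1 hx).of_child hu (mem_kids.1 hw).1 (mem_kids.1 hw).2)

theorem comp_eq {u : Option V} {v : V} (hu : T.IsDir u v) :
    T.comp u v = insert v ((T.kids u v).toFinset.biUnion (T.comp (some v))) := by
  ext x
  rw [Finset.mem_insert, Finset.mem_biUnion]
  constructor
  · intro hx
    refine (mem_comp.1 hx).eq_or_child.imp_right ?_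
    rintro ⟨w, hw, hne, hb⟩
    exact ⟨w, by simpa using mem_kids.2 ⟨hw, hne⟩, mem_comp.2 hb⟩
  · rintro (rfl | ⟨w, hw, hx⟩)
    · exact self_mem_comp hu
    · exact comp_kid_subset hu (by simpa using hw) hx

theorem mem_comp_iff {u : Option V} {v x : V} (hu : T.IsDir u v) :
    x ∈ T.comp u v ↔ x = v ∨ ∃ w ∈ T.kids u v, x ∈ T.comp (some v) w := by
  rw [comp_eq hu]; simp

theorem sum_comp {M : Type} [AddCommMonoid M] (f : V → M) {u : Option V} {v : V}
    (hu : T.IsDir u v) : ∑ x ∈ T.comp u v, f x =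
      f v + ((T.kids u v).map fun w => ∑ x ∈ T.comp (some v) w, f x).sum := by
  rw [comp_eq hu, Finset.sum_insert, Finset.sum_biUnion, ← List.sum_toFinset _ (kids_nodup u v)]
  · intro w hw w' hw' hne
    have hw := mem_kids.1 (List.mem_toFinset.1 hw)
    have hw' := mem_kids.1 (List.mem_toFinset.1 hw')
    exact disjoint_comp hw.1 hw'.1 hne
  · simp [not_mem_comp_kid]

theorem card_comp {u : Option V} {v : V} (hu : T.IsDir u v) :
    (T.comp u v).card = 1 + ((T.kids u v).map fun w => (T.comp (some v) w).card).sum := by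
  simpa only [Finset.card_eq_sum_ones] using sum_comp (T := T) (fun _ => 1) hu

theorem card_comp_kid_lt {u : Option V} {v w : V} (hu : T.IsDir u v) (hw : w ∈ T.kids u v) :
    (T.comp (some v) w).card < (T.comp u v).card := by
  refine Finset.card_lt_card ((Finset.ssubset_iff_of_subset (comp_kid_subset hu hw)).2 ?_)
  exact ⟨v, self_mem_comp hu, not_mem_comp_kid v w⟩

theorem length_kids_lt {u : Option V} {v : V} (hu : T.IsDir u v) :
    (T.kids u v).length < (T.comp u v).card := by
  rw [card_comp hu]
  have h := List.length_le_sum_of_one_le ((T.kids u v).map fun w => (T.comp (some v) w).card) ?_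
  · rw [List.length_map] at h
    omega
  · intro i hi
    obtain ⟨w, hw, rfl⟩ := List.mem_map.1 hi
    exact Finset.card_pos.2 ⟨w, self_mem_comp (isDir_kid hw)⟩

theorem tree_induction {P : Option V → V → Prop}
    (h : ∀ u v, T.IsDir u v → (∀ w ∈ T.kids u v, P (some v) w) → P u v) :
    ∀ u v, T.IsDir u v → P u v := by
  suffices H : ∀ n u v, T.IsDir u v → (T.comp u v).card ≤ n → P u v from
    fun u v hu => H _ u v hu le_rfl
  intro n
  induction n with
  | zero =>
    intro u v hu hn
    have := Finset.card_pos.2 ⟨v, self_mem_comp hu⟩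
    omega
  | succ n ih =>
    intro u v hu hn
    refine h u v hu fun w hw => ih _ _ (isDir_kid hw) ?_
    have := card_comp_kid_lt hu hw
    omega

end Traversal

end BidirectedTree



/-! ### Products of numbers in the unit interval -/

theorem prod_map_mem_Icc {α : Type} {l : List α} {f : α → ℝ} (h : ∀ a ∈ l, 0 ≤ f a ∧ f a ≤ 1) :
    0 ≤ (l.map f).prod ∧ (l.map f).prod ≤ 1 := by
  induction l with
  | nil => simp
  | cons a l ih =>
    have h₁ := h a (by simp)
    have h₂ := ih fun b hb => h b (by simp [hb])
    rw [List.map_cons, List.prod_cons]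
    exact ⟨mul_nonneg h₁.1 h₂.1, mul_le_one₀ h₁.2 h₂.1 h₂.2⟩

theorem prod_map_le_prod_map {α : Type} {l : List α} {f g : α → ℝ}
    (h : ∀ a ∈ l, 0 ≤ f a ∧ f a ≤ g a) : (l.map f).prod ≤ (l.map g).prod := by
  induction l with
  | nil => simp
  | cons a l ih =>
    have h₁ := h a (by simp)
    have h₂ := ih fun b hb => h b (by simp [hb])
    have h₃ : 0 ≤ (l.map f).prod := List.prod_nonneg fun x hx => by
      obtain ⟨b, hb, rfl⟩ := List.mem_map.1 hx
      exact (h b (by simp [hb])).1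
    rw [List.map_cons, List.prod_cons, List.map_cons, List.prod_cons]
    exact mul_le_mul h₁.2 h₂ h₃ (h₁.1.trans h₁.2)

namespace BidirectedTree

variable {V : Type} [DecidableEq V] {T : BidirectedTree V} {S : Finset V}

/-! ### Activation probabilities in the components -/

section Infl

variable (T S) in
/-- The probability that `v` is activated in its component after the removal of `u`, computed by
recursion of depth `n`, if the edges have the probabilities `q`. -/
noncomputable def inflAux (q : V → V → ℝ) : ℕ → Option V → V → ℝ
  | 0, _, _ => 0
  | n + 1, u, v =>
    if v ∈ S then 1
    else 1 - ((T.kids u v).map fun w => 1 - inflAux q n (some v) w * q w v).prod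

variable [Fintype V]

/-- The two recursion depths are independent of each other, so the case `q = q'` also shows that the
depth is irrelevant once it reaches the size of the component. Only edges into non-seeds are
compared, since the recursion stops at a seed; hence boosting seeds has no effect. -/
theorem inflAux_le {q q' : V → V → ℝ} {n m : ℕ} {u : Option V} {v : V} (hu : T.IsDir u v)
    (hn : (T.comp u v).card ≤ n) (hm : (T.comp u v).card ≤ m)
    (hq : ∀ y ∈ T.comp u v, y ∉ S → ∀ x, T.G.Adj x y → 0 ≤ q x y ∧ q x y ≤ q' x y ∧ q' x y ≤ 1) :
    0 ≤ T.inflAux S q n u v ∧ T.inflAux S q n u v ≤ T.inflAux S q' m u v ∧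
      T.inflAux S q' m u v ≤ 1 := by
  have hpos := Finset.card_pos.2 ⟨v, self_mem_comp hu⟩
  induction n generalizing m u v with
  | zero => omega
  | succ n ih =>
    cases m with
    | zero => omega
    | succ m =>
      rw [inflAux, inflAux]
      split_ifs with hv
      · norm_num
      · have hk : ∀ w ∈ T.kids u v, (0 ≤ T.inflAux S q n (some v) w * q w v ∧
            T.inflAux S q n (some v) w * q w v ≤ T.inflAux S q' m (some v) w * q' w v ∧
              T.inflAux S q' m (some v) w * q' w v ≤ 1) := by
          intro w hw
          have hlt := card_comp_kid_lt hu hw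
          obtain ⟨h₁, h₂, h₃⟩ := ih (m := m) (isDir_kid hw) (by omega) (by omega)
            (fun y hy => hq y (comp_kid_subset hu hw hy))
            (Finset.card_pos.2 ⟨w, self_mem_comp (isDir_kid hw)⟩)
          obtain ⟨h₄, h₅, h₆⟩ := hq v (self_mem_comp hu) hv w (mem_kids.1 hw).1.symm
          exact ⟨mul_nonneg h₁ h₄, mul_le_mul h₂ h₅ h₄ (h₁.trans h₂),
            mul_le_one₀ h₃ (h₄.trans h₅) h₆⟩
        refine ⟨?_, ?_, ?_⟩
        · rw [sub_nonneg]
          refine (prod_map_mem_Icc fun w hw => ?_).2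
          obtain ⟨h₁, h₂, h₃⟩ := hk w hw
          constructor <;> linarith
        · refine sub_le_sub_left (prod_map_le_prod_map fun w hw => ?_) _
          obtain ⟨h₁, h₂, h₃⟩ := hk w hw
          constructor <;> linarith
        · rw [sub_le_self_iff]
          refine (prod_map_mem_Icc fun w hw => ?_).1
          obtain ⟨h₁, h₂, h₃⟩ := hk w hw
          constructor <;> linarith

variable (T) in
/-- The edges have probabilities. -/
def IsProb (q : V → V → ℝ) : Prop := ∀ x y, T.G.Adj x y → 0 ≤ q x y ∧ q x y ≤ 1

variable (T S) in
/-- The probability that `v` is activated in its component after the removal of `u`. -/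
noncomputable def infl (q : V → V → ℝ) (u : Option V) (v : V) : ℝ :=
  T.inflAux S q (Fintype.card V) u v

variable (T S) in
/-- The probability that `v` is activated by the neighbours in the list `L`. -/
noncomputable def orL (q : V → V → ℝ) (v : V) (L : List V) : ℝ :=
  1 - (L.map fun w => 1 - T.infl S q (some v) w * q w v).prod

theorem inflAux_eq_infl {q : V → V → ℝ} (hq : T.IsProb q) {n : ℕ} {u : Option V} {v : V}
    (hu : T.IsDir u v) (hn : (T.comp u v).card ≤ n) : T.inflAux S q n u v = T.infl S q u v := by
  have h := fun y (_ : y ∈ T.comp u v) (_ : y ∉ S) x (hx : T.G.Adj x y) =>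
    (⟨(hq x y hx).1, le_rfl, (hq x y hx).2⟩ : 0 ≤ q x y ∧ q x y ≤ q x y ∧ q x y ≤ 1)
  exact le_antisymm (inflAux_le hu hn (Finset.card_le_univ _) h).2.1
    (inflAux_le hu (Finset.card_le_univ _) hn h).2.1

theorem infl_mono {q q' : V → V → ℝ} {u : Option V} {v : V} (hu : T.IsDir u v)
    (hq : ∀ y ∈ T.comp u v, y ∉ S → ∀ x, T.G.Adj x y →
      0 ≤ q x y ∧ q x y ≤ q' x y ∧ q' x y ≤ 1) : T.infl S q u v ≤ T.infl S q' u v :=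
  (inflAux_le hu (Finset.card_le_univ _) (Finset.card_le_univ _) hq).2.1

theorem infl_mem {q : V → V → ℝ} (hq : T.IsProb q) {u : Option V} {v : V} (hu : T.IsDir u v) :
    0 ≤ T.infl S q u v ∧ T.infl S q u v ≤ 1 := by
  have h := inflAux_le (S := S) hu (Finset.card_le_univ _) (Finset.card_le_univ _)
    fun y (_ : y ∈ T.comp u v) (_ : y ∉ S) x (hx : T.G.Adj x y) =>
    (⟨(hq x y hx).1, le_rfl, (hq x y hx).2⟩ : 0 ≤ q x y ∧ q x y ≤ q x y ∧ q x y ≤ 1)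
  exact ⟨h.1, h.2.2⟩

theorem infl_eq {q : V → V → ℝ} (hq : T.IsProb q) {u : Option V} {v : V} (hu : T.IsDir u v) :
    T.infl S q u v = if v ∈ S then 1 else T.orL S q v (T.kids u v) := by
  rw [← inflAux_eq_infl hq hu (Nat.le_succ_of_le (Finset.card_le_univ _)), inflAux]
  rfl

theorem infl_seed {q : V → V → ℝ} (hq : T.IsProb q) {u : Option V} {v : V} (hu : T.IsDir u v)
    (hv : v ∈ S) : T.infl S q u v = 1 := by
  rw [infl_eq hq hu, if_pos hv]

theorem infl_of_notMem {q : V → V → ℝ} (hq : T.IsProb q) {u : Option V} {v : V}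
    (hu : T.IsDir u v) (hv : v ∉ S) : T.infl S q u v = T.orL S q v (T.kids u v) := by
  rw [infl_eq hq hu, if_neg hv]

theorem orL_perm {q : V → V → ℝ} {v : V} {L L' : List V} (h : L.Perm L') :
    T.orL S q v L = T.orL S q v L' := by
  rw [orL, orL, (h.map _).prod_eq]

@[simp] theorem orL_nil (q : V → V → ℝ) (v : V) : T.orL S q v [] = 0 := by simp [orL]

theorem orL_append (q : V → V → ℝ) (v : V) (L L' : List V) :
    T.orL S q v (L ++ L') = 1 - (1 - T.orL S q v L) * (1 - T.orL S q v L') := by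
  simp [orL]

theorem orL_singleton (q : V → V → ℝ) (v w : V) :
    T.orL S q v [w] = T.infl S q (some v) w * q w v := by simp [orL]

theorem orL_cons (q : V → V → ℝ) (v w : V) (L : List V) :
    T.orL S q v (w :: L) =
      1 - (1 - T.infl S q (some v) w * q w v) * (1 - T.orL S q v L) := by
  rw [← orL_singleton, ← orL_append, List.singleton_append]

theorem infl_mul_mem {q : V → V → ℝ} (hq : T.IsProb q) {v w : V} (hw : T.G.Adj v w) :
    0 ≤ T.infl S q (some v) w * q w v ∧ T.infl S q (some v) w * q w v ≤ 1 := by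
  have h₁ := infl_mem (S := S) hq (T.isDir_some hw)
  have h₂ := hq w v hw.symm
  exact ⟨mul_nonneg h₁.1 h₂.1, mul_le_one₀ h₁.2 h₂.1 h₂.2⟩

theorem orL_mem {q : V → V → ℝ} (hq : T.IsProb q) {v : V} {L : List V}
    (hL : ∀ w ∈ L, T.G.Adj v w) : 0 ≤ T.orL S q v L ∧ T.orL S q v L ≤ 1 := by
  have h := prod_map_mem_Icc (l := L) (f := fun w => 1 - T.infl S q (some v) w * q w v) ?_
  · rw [orL]
    constructor <;> linarith
  · intro w hw
    have := infl_mul_mem (S := S) hq (hL w hw)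
    constructor <;> linarith

theorem infl_none_of_notMem {q : V → V → ℝ} (hq : T.IsProb q) {u : Option V} {v : V}
    (hu : T.IsDir u v) (hv : v ∉ S) :
    T.infl S q none v = T.orL S q v (T.kids u v ++ u.toList) := by
  rw [infl_of_notMem hq (T.isDir_none v) hv, kids_none, orL_perm (adj_perm hu)]

/-- The neighbours of `v` are `u` and those in its component, and their failure probabilities
multiply. For a seed both sides are one. -/
theorem infl_none_eq {q : V → V → ℝ} (hq : T.IsProb q) {u : Option V} {v : V}
    (hu : T.IsDir u v) :
    T.infl S q none v = 1 - (1 - T.infl S q u v) * (1 - T.orL S q v u.toList) := by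
  by_cases hv : v ∈ S
  · rw [infl_seed hq hu hv, infl_seed hq (T.isDir_none v) hv]; ring
  · rw [infl_none_of_notMem hq hu hv, infl_of_notMem hq hu hv, orL_append]

end Infl

/-! ### Independence of the attempts -/

section Expect

variable {ι : Type} [DecidableEq ι]

/-- The expectation of `F ω`, where the random set `ω` contains each `e ∈ E` independently with
probability `q e`. -/
noncomputable def expect (E : Finset ι) (q : ι → ℝ) (F : Finset ι → ℝ) : ℝ :=
  ∑ ω ∈ E.powerset, (∏ e ∈ E, if e ∈ ω then q e else 1 - q e) * F ω

theorem expect_empty (q : ι → ℝ) (F : Finset ι → ℝ) : expect ∅ q F = F ∅ := by simp [expect]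

/-- Conditioning on whether `e` belongs to the outcome; this drives the inductions on `E` below. -/
theorem expect_insert {E : Finset ι} {e : ι} (he : e ∉ E) (q : ι → ℝ) (F : Finset ι → ℝ) :
    expect (insert e E) q F =
      (1 - q e) * expect E q F + q e * expect E q (fun ω => F (insert e ω)) := by
  rw [expect, Finset.sum_powerset_insert he, expect, expect, Finset.mul_sum, Finset.mul_sum]
  congr 1
  · refine Finset.sum_congr rfl fun ω hω => ?_
    rw [Finset.prod_insert he, if_neg fun h => he (Finset.mem_powerset.1 hω h), mul_assoc]
  · refine Finset.sum_congr rfl fun ω hω => ?_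
    rw [Finset.prod_insert he, if_pos (Finset.mem_insert_self _ _), mul_assoc]
    congr 2
    refine Finset.prod_congr rfl fun e' he' => ?_
    have : e' ≠ e := fun h => he (h ▸ he')
    simp [this]

theorem expect_const (E : Finset ι) (q : ι → ℝ) (a : ℝ) : expect E q (fun _ => a) = a := by
  induction E using Finset.induction_on with
  | empty => exact expect_empty _ _
  | insert e E he ih => rw [expect_insert he, ih]; ring

theorem expect_sub (E : Finset ι) (q : ι → ℝ) (F G : Finset ι → ℝ) :
    expect E q (fun ω => F ω - G ω) = expect E q F - expect E q G := by
  simp only [expect, mul_sub, Finset.sum_sub_distrib]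

/-- `F ω` is determined by the members of `ω` that are in `A`. -/
def DependsOnly (F : Finset ι → ℝ) (A : Set ι) : Prop :=
  ∀ ω ω' : Finset ι, (∀ e ∈ A, e ∈ ω ↔ e ∈ ω') → F ω = F ω'

theorem DependsOnly.insert {F : Finset ι → ℝ} {A : Set ι} (h : DependsOnly F A) (e : ι) :
    DependsOnly (fun ω => F (insert e ω)) A := fun ω ω' hω => h _ _ fun e' he' => by
  simp [hω e' he']

theorem DependsOnly.insert_eq {F : Finset ι → ℝ} {A : Set ι} (h : DependsOnly F A) {e : ι}
    (he : e ∉ A) (ω : Finset ι) : F (Insert.insert e ω) = F ω := h _ _ fun e' he' => by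
  have : e' ≠ e := fun h => he (h ▸ he')
  simp [this]

/-- Each `e` affects at most one of the two factors, so conditioning on `e` leaves the other
unchanged. The functions vary in the induction, because conditioning replaces `F` by `fun ω => F
(insert e ω)`. -/
theorem expect_mul {q : ι → ℝ} {A A' : Set ι} (hA : Disjoint A A') (E : Finset ι)
    {F G : Finset ι → ℝ} (hF : DependsOnly F A) (hG : DependsOnly G A') :
    expect E q (fun ω => F ω * G ω) = expect E q F * expect E q G := by
  induction E using Finset.induction_on generalizing F G with
  | empty => simp only [expect_empty]
  | insert e E he ih =>
    rw [expect_insert he, expect_insert he, expect_insert he, ih hF hG,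
      ih (hF.insert e) (hG.insert e)]
    by_cases heA : e ∈ A
    · simp only [hG.insert_eq (Set.disjoint_left.1 hA heA)]
      ring
    · simp only [hF.insert_eq heA]
      ring

theorem expect_indicator {q : ι → ℝ} {E : Finset ι} {e : ι} (he : e ∈ E) :
    expect E q (fun ω => if e ∈ ω then 1 else 0) = q e := by
  induction E using Finset.induction_on with
  | empty => simp at he
  | insert e' E he' ih =>
    rw [expect_insert he']
    by_cases h : e = e'
    · subst h
      have h₀ : expect E q (fun ω => if e ∈ ω then 1 else 0) = expect E q (fun _ => 0) := by
        refine Finset.sum_congr rfl fun ω hω => ?_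
        simp only [if_neg fun h => he' (Finset.mem_powerset.1 hω h)]
      simp only [Finset.mem_insert_self, if_true]
      rw [h₀, expect_const, expect_const]
      ring
    · have h₁ : ∀ ω : Finset ι, (e ∈ insert e' ω) = (e ∈ ω) := by simp [h]
      simp only [h₁]
      rw [ih (Finset.mem_of_mem_insert_of_ne he h)]
      ring

end Expect

section ExpectInfl

variable [Fintype V]

/-- The edges in `ω` have probability one, and the others have probability zero. -/
def edgeInd (ω : Finset (V × V)) (x y : V) : ℝ := if (x, y) ∈ ω then 1 else 0

theorem isProb_edgeInd (ω : Finset (V × V)) : T.IsProb (edgeInd ω) := fun x y _ => by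
  rw [edgeInd]; split_ifs <;> norm_num

/-- The recursion uses only edges directed towards `v`, so none that leave `v`. This makes the
attempt along the edge from a child to its parent independent of the activation of the child. -/
theorem dependsOnly_inflAux (n : ℕ) {u : Option V} {v : V} (hu : T.IsDir u v) :
    DependsOnly (fun ω => T.inflAux S (edgeInd ω) n u v) {e | e.1 ∈ T.comp u v ∧ e.1 ≠ v} := by
  induction n generalizing u v with
  | zero => exact fun _ _ _ => rfl
  | succ n ih =>
    intro ω ω' h
    simp only [inflAux]
    congr 3
    refine List.map_congr_left fun w hw => ?_
    have hsub := comp_kid_subset hu hw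
    have hne : ∀ x ∈ T.comp (some v) w, x ≠ v := by
      rintro x hx rfl
      exact not_mem_comp_kid _ _ hx
    have h₁ := ih (isDir_kid hw) ω ω' fun e he => h e ⟨hsub he.1, hne _ he.1⟩
    have h₂ := self_mem_comp (isDir_kid hw)
    have h₃ := h (w, v) ⟨hsub h₂, hne _ h₂⟩
    simp only at h₁
    rw [h₁, edgeInd, edgeInd]
    simp only [h₃]

/-- The factor of a child `w` depends only on edges whose tail lies in the component of `w`. These
components are disjoint, so the expectation of the product is the product of the expectations. -/
theorem expect_inflAux (q : V → V → ℝ) (n : ℕ) {u : Option V} {v : V} (hu : T.IsDir u v) :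
    expect T.edges (fun e => q e.1 e.2) (fun ω => T.inflAux S (edgeInd ω) n u v) =
      T.inflAux S q n u v := by
  induction n generalizing u v with
  | zero => exact expect_const _ _ _
  | succ n ih =>
    simp only [inflAux]
    split_ifs with hv
    · exact expect_const _ _ _
    rw [expect_sub, expect_const]
    congr 1
    have hdep : ∀ w ∈ T.kids u v, DependsOnly
        (fun ω => 1 - T.inflAux S (edgeInd ω) n (some v) w * edgeInd ω w v)
        {e | e.1 ∈ T.comp (some v) w} := by
      intro w hw ω ω' h
      have h₁ := dependsOnly_inflAux (S := S) n (isDir_kid hw) ω ω' fun e he => h e he.1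
      have h₂ := h (w, v) (self_mem_comp (isDir_kid hw))
      simp only at h₁
      simp only [h₁, edgeInd, h₂]
    have hexp : ∀ w ∈ T.kids u v, expect T.edges (fun e => q e.1 e.2)
        (fun ω => 1 - T.inflAux S (edgeInd ω) n (some v) w * edgeInd ω w v) =
          1 - T.inflAux S q n (some v) w * q w v := by
      intro w hw
      have hmem : (w, v) ∈ T.edges := by
        simp [edges, (mem_kids.1 hw).1.symm]
      have hdep' : DependsOnly (fun ω => edgeInd ω w v) {(w, v)} := by
        intro ω ω' h
        simp only [edgeInd, h (w, v) rfl]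
      rw [expect_sub, expect_const, expect_mul (Set.disjoint_singleton_right.2 fun h => h.2 rfl) _
        (dependsOnly_inflAux n (isDir_kid hw)) hdep', ih (isDir_kid hw)]
      simp only [edgeInd]
      rw [expect_indicator hmem]
    have hnd := kids_nodup (T := T) u v
    have hsub : ∀ w ∈ T.kids u v, w ∈ T.kids u v := fun _ h => h
    -- The induction over the children also carries the set of edges on which the partial product
    -- depends, as independence is needed to split off the next factor.
    suffices H : ∀ L : List V, L.Nodup → (∀ w ∈ L, w ∈ T.kids u v) →
        (DependsOnly (fun ω => (L.map fun w => 1 - T.inflAux S (edgeInd ω) n (some v) w *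
          edgeInd ω w v).prod) {e | ∃ w ∈ L, e.1 ∈ T.comp (some v) w} ∧
        expect T.edges (fun e => q e.1 e.2) (fun ω => (L.map fun w =>
          1 - T.inflAux S (edgeInd ω) n (some v) w * edgeInd ω w v).prod) =
          (L.map fun w => 1 - T.inflAux S q n (some v) w * q w v).prod) from (H _ hnd hsub).2
    intro L hL hLs
    induction L with
    | nil => exact ⟨fun _ _ _ => rfl, expect_const _ _ _⟩
    | cons w L ihL =>
      obtain ⟨h₁, h₂⟩ := ihL (List.nodup_cons.1 hL).2 fun w' hw' => hLs w' (by simp [hw'])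
      have hw := hLs w (by simp)
      simp only [List.map_cons, List.prod_cons]
      constructor
      · intro ω ω' h
        have h₃ := hdep w hw ω ω' fun e he => h e ⟨w, by simp, he⟩
        have h₄ := h₁ ω ω' fun e ⟨w', hw', he⟩ => h e ⟨w', by simp [hw'], he⟩
        simp only at h₃ h₄
        simp only [h₃, h₄]
      · rw [expect_mul _ _ (hdep w hw) h₁, hexp w hw, h₂]
        refine Set.disjoint_left.2 ?_
        rintro e he ⟨w', hw', he'⟩
        have hne : w ≠ w' := fun h => (List.nodup_cons.1 hL).1 (h ▸ hw')
        exact Finset.disjoint_left.1 (disjoint_comp (mem_kids.1 hw).1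
          (mem_kids.1 (hLs w' (by simp [hw']))).1 hne) he he'

end ExpectInfl

end BidirectedTree

/-! ### The final active set -/

section Diffusion

variable {V : Type} [Fintype V] [DecidableEq V] {ω : Finset (V × V)} {S : Finset V}

theorem mem_diffusion_succ_snd {t : ℕ} {v : V} : v ∈ (diffusion ω S (t + 1)).2 ↔
    v ∉ (diffusion ω S t).1 ∧ ∃ u ∈ (diffusion ω S t).2, (u, v) ∈ ω := by
  simp [diffusion]

theorem mem_diffusion_succ_fst {t : ℕ} {v : V} : v ∈ (diffusion ω S (t + 1)).1 ↔
    v ∈ (diffusion ω S t).1 ∨ v ∈ (diffusion ω S (t + 1)).2 := by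
  simp [diffusion]

theorem diffusion_snd_subset (t : ℕ) : (diffusion ω S t).2 ⊆ (diffusion ω S t).1 := by
  cases t with
  | zero => exact Finset.Subset.refl _
  | succ t => exact fun v hv => mem_diffusion_succ_fst.2 (Or.inr hv)

theorem seeds_subset_diffusion (t : ℕ) : S ⊆ (diffusion ω S t).1 := by
  induction t with
  | zero => exact Finset.Subset.refl _
  | succ t ih => exact fun v hv => mem_diffusion_succ_fst.2 (Or.inl (ih hv))

theorem diffusion_subset {A : Finset V} (hS : S ⊆ A)
    (hA : ∀ u ∈ A, ∀ v, (u, v) ∈ ω → v ∈ A) (t : ℕ) : (diffusion ω S t).1 ⊆ A := by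
  induction t with
  | zero => exact hS
  | succ t ih =>
    intro v hv
    rcases mem_diffusion_succ_fst.1 hv with hv | hv
    · exact ih hv
    · obtain ⟨-, u, hu, huv⟩ := mem_diffusion_succ_snd.1 hv
      exact hA u (ih (diffusion_snd_subset t hu)) v huv

theorem diffusion_spread (t : ℕ) : ∀ u ∈ (diffusion ω S t).1, u ∉ (diffusion ω S t).2 →
    ∀ v, (u, v) ∈ ω → v ∈ (diffusion ω S t).1 := by
  induction t with
  | zero => exact fun u hu hu' => absurd hu hu'
  | succ t ih =>
    intro u hu hu' v huv
    have hu := (mem_diffusion_succ_fst.1 hu).resolve_right hu'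
    rw [mem_diffusion_succ_fst, mem_diffusion_succ_snd]
    by_cases h : u ∈ (diffusion ω S t).2
    · by_cases hv : v ∈ (diffusion ω S t).1
      · exact Or.inl hv
      · exact Or.inr ⟨hv, u, h, huv⟩
    · exact Or.inl (ih u hu h v huv)

/-- Every step before the diffusion stops adds a node. At time `Fintype.card V` nothing can be newly
active, so the active set is then closed under successful attempts. -/
theorem diffusion_stops (t : ℕ) : (diffusion ω S t).2 = ∅ ∨ t < (diffusion ω S t).1.card := by
  induction t with
  | zero =>
    rcases Finset.eq_empty_or_nonempty (diffusion ω S 0).2 with h | h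
    · exact Or.inl h
    · exact Or.inr (Finset.card_pos.2 (h.mono (diffusion_snd_subset 0)))
  | succ t ih =>
    rcases Finset.eq_empty_or_nonempty (diffusion ω S (t + 1)).2 with h | ⟨v, hv⟩
    · exact Or.inl h
    · right
      obtain ⟨hv', u, hu, -⟩ := mem_diffusion_succ_snd.1 hv
      have h₁ := ih.resolve_left (Finset.nonempty_iff_ne_empty.1 ⟨u, hu⟩)
      have h₂ : (diffusion ω S t).1.card < (diffusion ω S (t + 1)).1.card := by
        refine Finset.card_lt_card ((Finset.ssubset_iff_of_subset fun w hw =>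
          mem_diffusion_succ_fst.2 (Or.inl hw)).2 ⟨v, mem_diffusion_succ_fst.2 (Or.inr hv), hv'⟩)
      omega

theorem finalActive_closed {u v : V} (hu : u ∈ finalActive ω S) (h : (u, v) ∈ ω) :
    v ∈ finalActive ω S := by
  refine diffusion_spread _ u hu ?_ v h
  rcases diffusion_stops (ω := ω) (S := S) (Fintype.card V) with h | h
  · simp [h]
  · exact absurd (Finset.card_le_univ _) (not_le.2 h)

end Diffusion

namespace BidirectedTree

variable {V : Type} [DecidableEq V] [Fintype V] {T : BidirectedTree V} {S : Finset V}

theorem infl_edgeInd_zero_or_one (ω : Finset (V × V)) (n : ℕ) (u : Option V) (v : V) :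
    T.inflAux S (edgeInd ω) n u v = 0 ∨ T.inflAux S (edgeInd ω) n u v = 1 := by
  induction n generalizing u v with
  | zero => exact Or.inl rfl
  | succ n ih =>
    rw [inflAux]
    split_ifs with hv
    · exact Or.inr rfl
    have h : ∀ L : List V, (L.map fun w => 1 - T.inflAux S (edgeInd ω) n (some v) w *
        edgeInd ω w v).prod = 0 ∨ (L.map fun w => 1 - T.inflAux S (edgeInd ω) n (some v) w *
        edgeInd ω w v).prod = 1 := by
      intro L
      induction L with
      | nil => simp
      | cons w L ihL =>
        rw [List.map_cons, List.prod_cons]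
        have h₂ : edgeInd ω w v = 0 ∨ edgeInd ω w v = 1 := by
          rw [edgeInd]; split_ifs <;> simp
        rcases ih (some v) w with h₁ | h₁ <;> rcases h₂ with h₂ | h₂ <;>
          rcases ihL with h₃ | h₃ <;> simp [h₁, h₂, h₃]
    rcases h (T.kids u v) with h | h <;> simp [h]

theorem mem_finalActive_of_inflAux {ω : Finset (V × V)} {n : ℕ} {u : Option V} {v : V}
    (h : T.inflAux S (edgeInd ω) n u v ≠ 0) : v ∈ finalActive ω S := by
  induction n generalizing u v with
  | zero => exact absurd rfl h
  | succ n ih =>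
    rw [inflAux] at h
    split_ifs at h with hv
    · exact seeds_subset_diffusion _ hv
    · by_contra hcon
      refine h ?_
      rw [sub_eq_zero, eq_comm]
      refine List.prod_eq_one fun x hx => ?_
      obtain ⟨w, -, rfl⟩ := List.mem_map.1 hx
      rw [sub_eq_self, mul_eq_zero]
      by_contra! hne
      refine hcon (finalActive_closed (ih hne.1) (?_ : (w, v) ∈ ω))
      by_contra hmem
      exact hne.2 (if_neg hmem)

/-- The nodes where the recursion gives one contain the seeds and are closed under successful
attempts, so they contain the final active set. The converse is `mem_finalActive_of_inflAux`. -/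
theorem infl_edgeInd_eq {ω : Finset (V × V)} (hω : ω ⊆ T.edges) (v : V) :
    T.infl S (edgeInd ω) none v = if v ∈ finalActive ω S then 1 else 0 := by
  split_ifs with hv
  · by_contra hne
    have hq := isProb_edgeInd (T := T) ω
    have hclosed : finalActive ω S ⊆
        Finset.univ.filter fun v => T.infl S (edgeInd ω) none v = 1 := by
      refine diffusion_subset (fun v hv => ?_) (fun u hu v huv => ?_) _
      · simpa using infl_seed hq (T.isDir_none v) hv
      · simp only [Finset.mem_filter, Finset.mem_univ, true_and] at hu ⊢
        have hadj : T.G.Adj u v := by simpa [edges] using hω huv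
        by_cases hvS : v ∈ S
        · exact infl_seed hq (T.isDir_none v) hvS
        have h₁ := infl_none_eq (S := S) hq (T.isDir_some hadj)
        rw [Option.toList_some, orL_singleton] at h₁
        have h₂ := infl_none_eq (S := S) hq (T.isDir_some hadj.symm)
        rw [Option.toList_some, orL_singleton] at h₂
        have he : edgeInd ω u v = 1 := if_pos huv
        rw [he, mul_one] at h₁
        -- If `u` is active without the help of `v`, the edge from `u` activates `v`. Otherwise `u`
        -- owes its activation to `v`, which is then active without `u`.
        rcases infl_edgeInd_zero_or_one (T := T) (S := S) ω (Fintype.card V) (some v) u with h | h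
        · rcases infl_edgeInd_zero_or_one (T := T) (S := S) ω (Fintype.card V) (some u) v
            with h' | h'
          · change T.infl S (edgeInd ω) (some v) u = 0 at h
            change T.infl S (edgeInd ω) (some u) v = 0 at h'
            rw [hu, h, h'] at h₂
            norm_num at h₂
          · change T.infl S (edgeInd ω) (some u) v = 1 at h'
            rw [h₁, h']
            ring
        · change T.infl S (edgeInd ω) (some v) u = 1 at h
          rw [h₁, h]
          ring
    exact hne (by simpa using hclosed hv)
  · by_contra hne
    exact hv (mem_finalActive_of_inflAux hne)

/-! ### The spread as a sum of activation probabilities -/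

variable (T) in
/-- The probabilities of the edges if the nodes marked in `β` are boosted. -/
noncomputable def bprob (β : V → Bool) (u v : V) : ℝ := T.prob (β v) u v

theorem prob_mem (b : Bool) {u v : V} (h : T.G.Adj u v) : 0 ≤ T.prob b u v ∧ T.prob b u v ≤ 1 := by
  have h₁ := T.p_nonneg u v h
  have h₂ := T.p_le_p' u v h
  have h₃ := T.p'_le_one u v h
  cases b <;> simp only [prob, if_true, if_false, Bool.false_eq_true] <;> constructor <;> linarith

theorem isProb_bprob (β : V → Bool) : T.IsProb (T.bprob β) := fun _ _ h => prob_mem _ h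

theorem spread_eq (B : Finset V) :
    T.spread S B = ∑ v, T.infl S (T.bprob fun v => decide (v ∈ B)) none v := by
  have h₀ := fun v => expect_inflAux (S := S) (T.bprob fun v => decide (v ∈ B)) (Fintype.card V)
    (T.isDir_none v)
  have h₁ : ∀ ω ∈ T.edges.powerset, T.outcomeProb B ω * ((finalActive ω S).card : ℝ) =
      ∑ v, T.outcomeProb B ω * T.infl S (edgeInd ω) none v := by
    intro ω hω
    rw [← Finset.mul_sum]
    simp only [infl_edgeInd_eq (Finset.mem_powerset.1 hω)]
    simp
  rw [spread, Finset.sum_congr rfl h₁, Finset.sum_comm]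
  simp only [expect] at h₀
  exact Finset.sum_congr rfl fun v _ => h₀ v

theorem infl_bprob_mono {β β' : V → Bool} (h : ∀ v ∉ S, β v = true → β' v = true) {u : Option V}
    {v : V} (hu : T.IsDir u v) : T.infl S (T.bprob β) u v ≤ T.infl S (T.bprob β') u v := by
  refine infl_mono hu fun y _ hy x hx => ⟨(prob_mem _ hx).1, ?_, (prob_mem _ hx).2⟩
  have h₁ := h y hy
  rw [bprob, bprob]
  cases hb : β y
  · cases hb' : β' y
    · exact le_rfl
    · exact T.p_le_p' x y hx
  · rw [h₁ hb]

end BidirectedTree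



/-! ### Values computed by the programs for the spread and by the greedy algorithm -/

namespace BidirectedTree

variable {V : Type} [DecidableEq V] {T : BidirectedTree V} {S : Finset V}

theorem foldl_adj {α : Type} (u : Option V) (v : V) (f : α → V → α) (s : α) :
    (T.adj v).foldl (fun s w => if u = some w then s else f s w) s = (T.kids u v).foldl f s := by
  rw [kids, List.foldl_filter]
  congr 1
  funext s w
  by_cases h : u = some w <;> simp [h]

theorem foldl_mul_eq {α : Type} (l : List α) (f : α → ℝ) (s : ℝ) :
    l.foldl (fun s a => s * f a) s = s * (l.map f).prod := by
  induction l generalizing s with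
  | nil => simp
  | cons a l ih => rw [List.foldl_cons, ih, List.map_cons, List.prod_cons, mul_assoc]

theorem foldl_add_eq {α : Type} (l : List α) (f : α → ℝ) (s : ℝ) :
    l.foldl (fun s a => s + f a) s = s + (l.map f).sum := by
  induction l generalizing s with
  | nil => simp
  | cons a l ih => rw [List.foldl_cons, ih, List.map_cons, List.sum_cons, add_assoc]

theorem activation_val (β : V → Bool) (n : ℕ) (u : Option V) (v : V) :
    (activation T S β n u v).val = T.inflAux S (T.bprob β) n u v := by
  induction n generalizing u v with
  | zero => rfl
  | succ n ih =>
    rw [activation, inflAux]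
    simp only [bind_val, isSeed, op_val, decide_eq_true_eq, ite_val, readAt, pure_val, isParent,
      forList_val, readProb, rmul, rsub, ih]
    rw [foldl_adj u v, foldl_mul_eq, one_mul]
    rfl

section Fintype

variable [Fintype V]

theorem sum_nodes (f : V → ℝ) : (T.nodes.map f).sum = ∑ v, f v := by
  rw [← List.sum_toFinset _ T.nodes_nodup]
  congr 1
  ext v
  simp [T.mem_nodes]

theorem length_nodes : T.nodes.length = Fintype.card V := by
  rw [← List.toFinset_card_of_nodup T.nodes_nodup, ← Finset.card_univ]
  congr 1
  ext v
  simp [T.mem_nodes]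

theorem computeSpread_val (β : V → Bool) :
    (computeSpread T S (Fintype.card V) β).val = ∑ v, T.infl S (T.bprob β) none v := by
  simp only [computeSpread, forList_val, bind_val, radd, op_val, activation_val]
  rw [foldl_add_eq, sum_nodes, zero_add]
  rfl

/-- A round adds at most one mark. No optimality of the choice is needed: the guarantee only uses
that the greedy value is the boost of some set of at most `k` nodes. -/
theorem greedyRound_val (n : ℕ) (β : V → Bool) : (greedyRound T S n β).val = β ∨
    ∃ v, (greedyRound T S n β).val = Function.update β v true := by
  -- The trial mark is undone after each evaluation, and it is only set on unmarked nodes, so the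
  -- array is back at `β`.
  have key : (forList T.nodes ((β, none) : (V → Bool) × Option (V × ℝ)) fun v st => do
      if ← readAt st.1 v then
        pure st
      else
        let B₁ ← writeAt st.1 v true
        let s ← computeSpread T S n B₁
        let B₂ ← writeAt B₁ v false
        match st.2 with
        | none => pure (B₂, some (v, s))
        | some (w, t) =>
          if ← rle s t then pure (B₂, some (w, t)) else pure (B₂, some (v, s))).val.1 = β := by
    refine forList_ind (fun st : (V → Bool) × Option (V × ℝ) => st.1 = β) rfl fun v _ st hst => ?_
    obtain ⟨γ, o⟩ := st
    simp only at hst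
    subst hst
    rw [bind_val]
    split
    · rfl
    · next hv =>
      have hup : Function.update (Function.update γ v true) v false = γ := by
        rw [Function.update_idem, Function.update_eq_self_iff]
        simpa [readAt] using hv
      cases o with
      | none => exact hup
      | some wt =>
        simp only [bind_val]
        split <;> exact hup
  rw [greedyRound, bind_val]
  revert key
  generalize (forList T.nodes ((β, none) : (V → Bool) × Option (V × ℝ)) _).val = st
  intro key
  obtain ⟨γ, o⟩ := st
  simp only at key
  subst key
  cases o with
  | none => exact Or.inl rfl
  | some vt => exact Or.inr ⟨vt.1, rfl⟩

/-- The nodes marked in `β`. -/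
def marked (β : V → Bool) : Finset V := Finset.univ.filter fun v => β v = true

theorem decide_mem_marked (β : V → Bool) : (fun v => decide (v ∈ marked β)) = β := by
  funext v; simp [marked]

theorem spread_marked (β : V → Bool) :
    T.spread S (marked β) = ∑ v, T.infl S (T.bprob β) none v := by
  rw [spread_eq, decide_mem_marked]

theorem boost_marked (β : V → Bool) :
    T.boost S (marked β) = ∑ v, (T.infl S (T.bprob β) none v -
      T.infl S (T.bprob fun _ => false) none v) := by
  rw [Finset.sum_sub_distrib, ← spread_marked, ← spread_marked, boost]
  congr 2
  simp [marked]

theorem greedyBoost_val (k : ℕ) : ∃ B : Finset V, B.card ≤ k ∧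
    (greedyBoost T S (Fintype.card V) k).val = T.boost S B := by
  have hcard : ∀ m, (marked (forRange m (fun _ => false)
      fun _ β => greedyRound T S (Fintype.card V) β).val).card ≤ m := by
    intro m
    induction m with
    | zero => simp [forRange, marked]
    | succ m ih =>
      rw [forRange_succ_val]
      generalize (forRange m (fun _ => false) fun _ β =>
        greedyRound T S (Fintype.card V) β).val = β at ih ⊢
      rcases greedyRound_val (T := T) (S := S) (Fintype.card V) β with h | ⟨v, h⟩
      · rw [h]; omega
      · rw [h]
        refine (Finset.card_le_card (t := insert v (marked β)) fun w hw => ?_).trans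
          ((Finset.card_insert_le _ _).trans (by omega))
        by_cases hwv : w = v
        · simp [hwv]
        · simpa [marked, hwv] using hw
  refine ⟨_, hcard k, ?_⟩
  rw [boost_marked, Finset.sum_sub_distrib]
  simp only [greedyBoost, bind_val, rsub, op_val, newTable_val, computeSpread_val]

/-! ### Products of probabilities along paths -/

/-- The product of the probabilities of the edges of a walk. -/
noncomputable def walkProd (q : V → V → ℝ) : {x y : V} → T.G.Walk x y → ℝ
  | _, _, .nil => 1
  | x, _, .cons (v := w) _ p => q x w * walkProd q p

theorem walkProd_append (q : V → V → ℝ) {x y z : V} (p : T.G.Walk x y) (p' : T.G.Walk y z) :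
    walkProd q (p.append p') = walkProd q p * walkProd q p' := by
  induction p with
  | nil => simp [walkProd]
  | cons h p ih => rw [SimpleGraph.Walk.cons_append, walkProd, walkProd, ih, mul_assoc]

theorem walkProd_nonneg {q : V → V → ℝ} (hq : T.IsProb q) {x y : V} (p : T.G.Walk x y) :
    0 ≤ walkProd q p := by
  induction p with
  | nil => simp [walkProd]
  | cons h p ih => exact mul_nonneg (hq _ _ h).1 ih

variable (T) in
/-- The product of the probabilities of the edges of the path from `x` to `y`. -/
noncomputable def pathProd (q : V → V → ℝ) (x y : V) : ℝ :=
  walkProd q (T.isTree.existsUnique_path x y).exists.choose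

theorem pathProd_eq (q : V → V → ℝ) {x y : V} {p : T.G.Walk x y} (hp : p.IsPath) :
    T.pathProd q x y = walkProd q p := by
  rw [pathProd, (T.isTree.existsUnique_path x y).unique
    (T.isTree.existsUnique_path x y).exists.choose_spec hp]

theorem pathProd_self (q : V → V → ℝ) (x : V) : T.pathProd q x x = 1 :=
  pathProd_eq q SimpleGraph.Walk.IsPath.nil

theorem exists_path_of_below {v w x : V} (hx : T.Below (some v) w x) :
    ∃ p : T.G.Walk w x, p.IsPath ∧ v ∉ p.support := by
  obtain ⟨p, hp⟩ := hx
  exact ⟨p.bypass, p.bypass_isPath, fun h => hp v rfl (p.support_bypass_subset_support h)⟩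

theorem pathProd_cons (q : V → V → ℝ) {v w x : V} (h : T.G.Adj v w) (hx : T.Below (some v) w x) :
    T.pathProd q v x = q v w * T.pathProd q w x := by
  obtain ⟨p, hp, hv⟩ := exists_path_of_below hx
  rw [pathProd_eq q hp, pathProd_eq q ((SimpleGraph.Walk.cons_isPath_iff h p).2 ⟨hp, hv⟩), walkProd]

theorem pathProd_concat (q : V → V → ℝ) {v w x : V} (h : T.G.Adj v w)
    (hx : T.Below (some v) w x) : T.pathProd q x v = T.pathProd q x w * q w v := by
  obtain ⟨p, hp, hv⟩ := exists_path_of_below hx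
  rw [pathProd_eq q hp.reverse,
    pathProd_eq q ((SimpleGraph.Walk.cons_isPath_iff h p).2 ⟨hp, hv⟩).reverse,
    SimpleGraph.Walk.reverse_cons, walkProd_append]
  simp [walkProd]

variable (T) in
/-- The sum of the path products from the nodes in the component of `v` to `v`. -/
noncomputable def inSum (q : V → V → ℝ) (u : Option V) (v : V) : ℝ :=
  ∑ x ∈ T.comp u v, T.pathProd q x v

variable (T) in
/-- The sum of the path products from `v` to the nodes in the component of `v`. -/
noncomputable def outSum (q : V → V → ℝ) (u : Option V) (v : V) : ℝ :=
  ∑ y ∈ T.comp u v, T.pathProd q v y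

variable (T) in
/-- The contribution of the neighbours in the list `L` to the sum of the path products to `v`. -/
noncomputable def inSumL (q : V → V → ℝ) (v : V) (L : List V) : ℝ :=
  (L.map fun w => T.inSum q (some v) w * q w v).sum

theorem pathProd_nonneg {q : V → V → ℝ} (hq : T.IsProb q) (x y : V) : 0 ≤ T.pathProd q x y :=
  walkProd_nonneg hq _

theorem inSum_nonneg {q : V → V → ℝ} (hq : T.IsProb q) (u : Option V) (v : V) :
    0 ≤ T.inSum q u v := Finset.sum_nonneg fun _ _ => pathProd_nonneg hq _ _

theorem inSum_eq (q : V → V → ℝ) {u : Option V} {v : V} (hu : T.IsDir u v) :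
    T.inSum q u v = 1 + T.inSumL q v (T.kids u v) := by
  rw [inSum, sum_comp _ hu, pathProd_self, inSumL]
  congr 2
  refine List.map_congr_left fun w hw => ?_
  rw [inSum, Finset.sum_mul]
  exact Finset.sum_congr rfl fun x hx => pathProd_concat q (mem_kids.1 hw).1 (mem_comp.1 hx)

theorem outSum_eq (q : V → V → ℝ) {u : Option V} {v : V} (hu : T.IsDir u v) :
    T.outSum q u v = 1 + ((T.kids u v).map fun w => q v w * T.outSum q (some v) w).sum := by
  rw [outSum, sum_comp _ hu, pathProd_self]
  congr 2
  refine List.map_congr_left fun w hw => ?_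
  rw [outSum, Finset.mul_sum]
  exact Finset.sum_congr rfl fun x hx => pathProd_cons q (mem_kids.1 hw).1 (mem_comp.1 hx)

/-- Rounding errors flow into a node, whereas `sumReach` walks outwards from a node; summed over all
nodes the two agree. -/
theorem sum_inSum_eq (q : V → V → ℝ) :
    ∑ v, T.inSum q none v = ∑ v, T.outSum q none v := by
  simp only [inSum, outSum, comp_none]
  exact Finset.sum_comm

theorem inSumL_perm (q : V → V → ℝ) (v : V) {L L' : List V} (h : L.Perm L') :
    T.inSumL q v L = T.inSumL q v L' := (h.map _).sum_eq

theorem inSumL_append (q : V → V → ℝ) (v : V) (L L' : List V) :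
    T.inSumL q v (L ++ L') = T.inSumL q v L + T.inSumL q v L' := by simp [inSumL]

theorem inSumL_cons (q : V → V → ℝ) (v w : V) (L : List V) :
    T.inSumL q v (w :: L) = T.inSum q (some v) w * q w v + T.inSumL q v L := by simp [inSumL]

@[simp] theorem inSumL_nil (q : V → V → ℝ) (v : V) : T.inSumL q v [] = 0 := by simp [inSumL]

theorem inSumL_nonneg {q : V → V → ℝ} (hq : T.IsProb q) {v : V} {L : List V}
    (hL : ∀ w ∈ L, T.G.Adj v w) : 0 ≤ T.inSumL q v L := by
  refine List.sum_nonneg fun x hx => ?_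
  obtain ⟨w, hw, rfl⟩ := List.mem_map.1 hx
  exact mul_nonneg (inSum_nonneg hq _ _) (hq _ _ (hL w hw).symm).1

theorem inSum_none_eq (q : V → V → ℝ) {u : Option V} {v : V} (hu : T.IsDir u v) :
    T.inSum q none v = T.inSum q u v + T.inSumL q v u.toList := by
  rw [inSum_eq q hu, inSum_eq q (T.isDir_none v), kids_none, inSumL_perm q v (adj_perm hu),
    inSumL_append, add_assoc]

/-! ### The rounding parameter -/

variable (T) in
/-- The table for the neighbour `w` of `v` computed in `sumReach` from the table `q` for `v`. -/
noncomputable def reachTable (k : ℕ) (v w : V) (q : ℕ → ℝ) : ℕ → ℝ :=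
  (forRange (k + 1) (fun _ => 0 : ℕ → ℝ) fun j t => do
    let a ← readAt q j
    let x ← rmul a (T.prob false v w)
    if j = 0 then
      writeAt t j x
    else
      let a' ← readAt q (j - 1)
      let y ← rmul a' (T.prob true v w)
      let m ← rmax x y
      writeAt t j m).val

theorem reachTable_eq {k j : ℕ} (hj : j ≤ k) (v w : V) (q : ℕ → ℝ) :
    T.reachTable k v w q j = if j = 0 then q j * T.prob false v w
      else max (q j * T.prob false v w) (q (j - 1) * T.prob true v w) := by
  rw [reachTable]
  refine forRange_reach (fun t : ℕ → ℝ => t j = _) (Nat.lt_succ_of_le hj) (fun t => ?_)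
    (fun i _ t ht => ?_)
  · simp only [bind_val, readAt, rmul, rmax, op_val, ite_val, writeAt]
    split_ifs <;> simp
  · by_cases hij : j = i
    · subst hij
      simp only [bind_val, readAt, rmul, rmax, op_val, ite_val, writeAt]
      split_ifs <;> simp
    · simp only [bind_val, readAt, rmul, rmax, op_val, ite_val, writeAt]
      rw [← ht]
      split_ifs <;> simp [hij]

theorem sumReach_succ_val (k n : ℕ) (u : Option V) (v : V) (q : ℕ → ℝ) :
    (sumReach T k (n + 1) u v q).val = q k + ((T.kids u v).map fun w =>
      (sumReach T k n (some v) w (T.reachTable k v w q)).val).sum := by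
  rw [← foldl_add_eq, ← foldl_adj, sumReach]
  simp only [bind_val, readAt, op_val, forList_val, isParent, ite_val, pure_val, radd, readProb,
    decide_eq_true_eq, newTable_val]
  rfl

theorem sumReach_mem {k n : ℕ} {u : Option V} {v : V} (hu : T.IsDir u v) {q : ℕ → ℝ}
    (hq : ∀ j ≤ k, 0 ≤ q j ∧ q j ≤ 1) : 0 ≤ (sumReach T k n u v q).val ∧
      (sumReach T k n u v q).val ≤ (T.comp u v).card := by
  induction n generalizing u v q with
  | zero => exact ⟨le_rfl, Nat.cast_nonneg _⟩
  | succ n ih =>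
    have hk : ∀ w ∈ T.kids u v, 0 ≤ (sumReach T k n (some v) w (T.reachTable k v w q)).val ∧
        (sumReach T k n (some v) w (T.reachTable k v w q)).val ≤
          ((T.comp (some v) w).card : ℝ) := by
      intro w hw
      refine ih (isDir_kid hw) fun j hj => ?_
      have hp₀ := T.prob_mem false (mem_kids.1 hw).1
      have hp₁ := T.prob_mem true (mem_kids.1 hw).1
      have h₁ := hq j hj
      have h₂ := hq (j - 1) (by omega)
      have h₃ := mul_nonneg h₁.1 hp₀.1
      have h₄ := mul_le_one₀ h₁.2 hp₀.1 hp₀.2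
      have h₅ := mul_le_one₀ h₂.2 hp₁.1 hp₁.2
      rw [reachTable_eq hj]
      split_ifs
      · exact ⟨h₃, h₄⟩
      · exact ⟨h₃.trans (le_max_left _ _), max_le h₄ h₅⟩
    rw [sumReach_succ_val, card_comp hu, Nat.cast_add, Nat.cast_one, Nat.cast_list_sum,
      List.map_map]
    constructor
    · refine add_nonneg (hq k le_rfl).1 (List.sum_nonneg fun x hx => ?_)
      obtain ⟨w, hw, rfl⟩ := List.mem_map.1 hx
      exact (hk w hw).1
    · exact add_le_add (hq k le_rfl).2 (List.sum_le_sum fun w hw => (hk w hw).2)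

/-- Here `a` is the product of the probabilities along the path walked so far and `j₀` counts the
boosts charged to it. The marked nodes still ahead fit into the remaining budget `k - j₀`, so the
table dominates the path products of the assignment `β`. -/
theorem le_sumReach {β : V → Bool} {k n j₀ : ℕ} {a : ℝ} {u : Option V} {v : V} (hu : T.IsDir u v)
    (hn : (T.comp u v).card ≤ n) {q : ℕ → ℝ}
    (hk : j₀ + ((T.comp u v).filter fun y => y ≠ v ∧ β y = true).card ≤ k)
    (hq : ∀ j ≤ k, j₀ ≤ j → a ≤ q j) :
    a * T.outSum (T.bprob β) u v ≤ (sumReach T k n u v q).val := by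
  induction n generalizing u v q j₀ a with
  | zero =>
    have := Finset.card_pos.2 ⟨v, self_mem_comp hu⟩
    omega
  | succ n ih =>
    rw [sumReach_succ_val, outSum_eq _ hu, mul_add, mul_one]
    refine add_le_add (hq k le_rfl (by omega)) ?_
    rw [← List.sum_map_mul_left]
    refine List.sum_le_sum fun w hw => ?_
    rw [← mul_assoc]
    have hlt := card_comp_kid_lt hu hw
    have hadj := (mem_kids.1 hw).1
    have hp₀ := T.prob_mem false hadj
    have hp₁ := T.prob_mem true hadj
    have hsub : ∀ s : Finset V, s ⊆ T.comp (some v) w → (∀ y ∈ s, β y = true) →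
        s.card ≤ ((T.comp u v).filter fun y => y ≠ v ∧ β y = true).card := by
      intro s hs hsβ
      refine Finset.card_le_card fun y hy => Finset.mem_filter.2
        ⟨comp_kid_subset hu hw (hs hy), ?_, hsβ y hy⟩
      rintro rfl
      exact not_mem_comp_kid _ _ (hs hy)
    -- Entering a boosted node spends one boost, in step with the index shift `j - 1` in
    -- `reachTable`.
    refine ih (j₀ := if β w then j₀ + 1 else j₀) (isDir_kid hw) (by omega) ?_ ?_
    · split_ifs with hβ
      · have := hsub (insert w ((T.comp (some v) w).filter fun y => y ≠ w ∧ β y = true)) ?_ ?_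
        · rw [Finset.card_insert_of_notMem (by simp)] at this
          omega
        · refine Finset.insert_subset (self_mem_comp (isDir_kid hw)) (Finset.filter_subset _ _)
        · simp only [Finset.mem_insert, Finset.mem_filter]
          rintro y (rfl | h)
          exacts [hβ, h.2.2]
      · have := hsub ((T.comp (some v) w).filter fun y => y ≠ w ∧ β y = true)
          (Finset.filter_subset _ _) fun y hy => (Finset.mem_filter.1 hy).2.2
        omega
    · intro j hj hj₀
      rw [reachTable_eq hj, bprob]
      cases hβ : β w
      · simp only [hβ, Bool.false_eq_true, if_false] at hj₀
        have h := mul_le_mul_of_nonneg_right (hq j hj hj₀) hp₀.1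
        split_ifs
        exacts [h, h.trans (le_max_left _ _)]
      · simp only [hβ, if_true] at hj₀
        rw [if_neg (by omega)]
        exact (mul_le_mul_of_nonneg_right (hq (j - 1) (by omega) (by omega)) hp₁.1).trans
          (le_max_right _ _)

theorem roundingParameter_val (k : ℕ) (ε : ℝ) :
    (roundingParameter T S (Fintype.card V) k ε).val =
      ε * max (greedyBoost T S (Fintype.card V) k).val 1 /
        (2 * ∑ x, (sumReach T k (Fintype.card V) none x fun _ => 1).val) := by
  simp only [roundingParameter, bind_val, rmax, rmul, rdiv, op_val, forList_val, radd,
    newTable_val]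
  rw [foldl_add_eq, sum_nodes, zero_add]

theorem sum_sumReach_le (k : ℕ) :
    ∑ x, (sumReach T k (Fintype.card V) none x fun _ => 1).val ≤ (Fintype.card V : ℝ) ^ 2 := by
  have h : ∀ x ∈ Finset.univ, (sumReach T k (Fintype.card V) none x fun _ => 1).val ≤
      (Fintype.card V : ℝ) := fun x _ => by
    simpa [comp_none] using
      (sumReach_mem (T := T) (k := k) (n := Fintype.card V) (T.isDir_none x) (q := fun _ => 1)
        (by norm_num)).2
  refine (Finset.sum_le_sum h).trans_eq ?_
  rw [Finset.sum_const, Finset.card_univ, nsmul_eq_mul, sq]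

/-- The total weight of the errors for a fixed assignment is bounded by the sum in the denominator
of `δ`. -/
theorem sum_inSum_le {β : V → Bool} {k : ℕ} (hβ : (marked β).card ≤ k) :
    ∑ v, T.inSum (T.bprob β) none v ≤
      ∑ x, (sumReach T k (Fintype.card V) none x fun _ => 1).val := by
  rw [sum_inSum_eq]
  refine Finset.sum_le_sum fun x _ => ?_
  have h := le_sumReach (T := T) (β := β) (k := k) (j₀ := 0) (a := 1) (T.isDir_none x)
    (Finset.card_le_univ _) (q := fun _ => 1) ?_ (by simp)
  · simpa using h
  · rw [Nat.zero_add]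
    refine (Finset.card_le_card fun y hy => ?_).trans hβ
    simpa [marked] using (Finset.mem_filter.1 hy).2.2

theorem sum_sumReach_pos [Nonempty V] (k : ℕ) :
    0 < ∑ x, (sumReach T k (Fintype.card V) none x fun _ => 1).val := by
  refine lt_of_lt_of_le ?_ (sum_inSum_le (T := T) (β := fun _ => false) (by simp [marked]))
  refine Finset.sum_pos (fun v _ => ?_) Finset.univ_nonempty
  rw [inSum_eq _ (T.isDir_none v)]
  have := inSumL_nonneg (T.isProb_bprob fun _ => false) (v := v) (L := T.kids none v)
    fun w hw => (mem_kids.1 hw).1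
  linarith

end Fintype

end BidirectedTree



/-! ### Rounding -/

/-- `1 - (1 - x) (1 - y)`. -/
def orR (x y : ℝ) : ℝ := 1 - (1 - x) * (1 - y)

/-- `max {1 - (1 - c) (1 - f e) - ap, 0}`. -/
noncomputable def nodeGain (c f e ap : ℝ) : ℝ := max (orR c (f * e) - ap) 0

theorem orProb_val (x y : ℝ) : (orProb x y).val = orR x y := rfl

theorem nodeBoost_val (c f e ap : ℝ) : (nodeBoost c f e ap).val = nodeGain c f e ap := rfl

theorem orR_mem {x y : ℝ} (hx : 0 ≤ x ∧ x ≤ 1) (hy : 0 ≤ y ∧ y ≤ 1) :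
    0 ≤ orR x y ∧ orR x y ≤ 1 := by
  have h₁ := mul_nonneg (sub_nonneg.2 hx.2) (sub_nonneg.2 hy.2)
  have h₂ := mul_le_one₀ (sub_le_self 1 hx.1) (sub_nonneg.2 hy.2) (sub_le_self 1 hy.1)
  rw [orR]
  constructor <;> linarith

/-- The difference is `(x' - x) (1 - y) + (1 - x') (y' - y)`, which explains which two arguments
must be at most one. -/
theorem orR_mono {x x' y y' : ℝ} (hx : x ≤ x') (hy : y ≤ y') (hx' : x' ≤ 1) (hy₁ : y ≤ 1) :
    orR x y ≤ orR x' y' := by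
  rw [orR, orR]
  nlinarith [mul_nonneg (sub_nonneg.2 hx) (sub_nonneg.2 hy₁),
    mul_nonneg (sub_nonneg.2 hx') (sub_nonneg.2 hy)]

/-- The core of the error analysis: the telescoped difference has coefficients `1 - y` and `1 - x'`
in the unit interval, so errors add and are never amplified. -/
theorem orR_sub_le {x x' y y' a b : ℝ} (hx : x - x' ≤ a) (hy : y - y' ≤ b) (ha : 0 ≤ a)
    (hb : 0 ≤ b) (hx' : 0 ≤ x' ∧ x' ≤ 1) (hy₁ : 0 ≤ y ∧ y ≤ 1) :
    orR x y - orR x' y' ≤ a + b := by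
  have h₁ : (x - x') * (1 - y) ≤ a * 1 :=
    mul_le_mul hx (by linarith) (by linarith) ha
  have h₂ : (1 - x') * (y - y') ≤ 1 * b := by
    rw [mul_comm, mul_comm 1 b]
    exact mul_le_mul hy (by linarith) (by linarith) hb
  have h₃ : orR x y - orR x' y' = (x - x') * (1 - y) + (1 - x') * (y - y') := by
    rw [orR, orR]; ring
  linarith

namespace Grid

/-- The value with index `i`. -/
noncomputable def pt (γ : Grid) (i : ℕ) : ℝ := min (i * γ.mesh) 1

/-- The index of the largest value that is at most `x`. -/
noncomputable def idx (γ : Grid) (x : ℝ) : ℕ := if 1 ≤ x then γ.top else ⌊x / γ.mesh⌋₊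

/-- The mesh is positive, and the largest index is the one of the value one. -/
structure Proper (γ : Grid) : Prop where
  mesh_pos : 0 < γ.mesh
  top_eq : γ.top = ⌈1 / γ.mesh⌉₊

theorem value_val (γ : Grid) (i : ℕ) : (γ.value i).val = γ.pt i := rfl

theorem round_val (γ : Grid) (x : ℝ) : (γ.round x).val = γ.idx x := by
  rw [round, idx, bind_val, ite_val]
  simp [rle, rdiv, rfloor]

theorem mkGrid_proper {η : ℝ} (hη : 0 < η) : (mkGrid η).val.Proper := ⟨hη, rfl⟩

variable {γ : Grid}

@[simp] theorem pt_zero : γ.pt 0 = 0 := by simp [pt]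

theorem Proper.pt_mem (h : γ.Proper) (i : ℕ) : 0 ≤ γ.pt i ∧ γ.pt i ≤ 1 :=
  ⟨le_min (mul_nonneg (Nat.cast_nonneg _) h.mesh_pos.le) zero_le_one, min_le_right _ _⟩

/-- The product of `top` and the mesh may exceed one; the cap in `pt` makes the last index stand for
the value one, whether or not one is a multiple of the mesh. -/
theorem Proper.pt_top (h : γ.Proper) : γ.pt γ.top = 1 := by
  rw [pt, min_eq_right]
  have := Nat.le_ceil (1 / γ.mesh)
  rw [← h.top_eq, div_le_iff₀ h.mesh_pos] at this
  exact this

theorem Proper.idx_le_top (h : γ.Proper) (x : ℝ) : γ.idx x ≤ γ.top := by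
  rw [idx]
  split_ifs with hx
  · exact le_rfl
  · rw [h.top_eq]
    refine (Nat.floor_le_floor ?_).trans (Nat.floor_le_ceil _)
    exact div_le_div_of_nonneg_right (not_le.1 hx).le h.mesh_pos.le

theorem Proper.pt_idx_le (h : γ.Proper) {x : ℝ} (hx : 0 ≤ x) : γ.pt (γ.idx x) ≤ x := by
  rw [idx]
  split_ifs with hx₁
  · rwa [h.pt_top]
  · refine (min_le_left _ _).trans ?_
    rw [← le_div_iff₀ h.mesh_pos]
    exact Nat.floor_le (div_nonneg hx h.mesh_pos.le)

theorem Proper.sub_mesh_le (h : γ.Proper) {x : ℝ} (hx : x ≤ 1) :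
    x - γ.pt (γ.idx x) ≤ γ.mesh := by
  have hpos := h.mesh_pos
  rw [idx]
  split_ifs with hx₁
  · rw [h.pt_top]; linarith
  · have := Nat.lt_floor_add_one (x / γ.mesh)
    rw [div_lt_iff₀ hpos] at this
    rw [pt, sub_le_comm]
    refine le_min ?_ (by linarith)
    nlinarith

end Grid

/-! ### Tables -/

section Tables

variable {V ι : Type} [DecidableEq ι]

/-- All finite entries of a table satisfy `R`. -/
def AllEntries (R : ι → ℝ → NodeSet V → Prop) (t : ι → Entry V) : Prop :=
  ∀ i x A, t i = some (x, A) → R i x A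

/-- The value of an entry is at least `L`. -/
def AtLeast (e : Entry V) (L : ℝ) : Prop := ∃ x A, e = some (x, A) ∧ L ≤ x

theorem AtLeast.mono {e : Entry V} {L L' : ℝ} (h : AtLeast e L) (hL : L' ≤ L) : AtLeast e L' := by
  obtain ⟨x, A, he, hx⟩ := h
  exact ⟨x, A, he, hL.trans hx⟩

theorem addEntry_val_eq_some {a b : Entry V} {x : ℝ} {A : NodeSet V}
    (h : (addEntry a b).val = some (x, A)) : ∃ x₁ A₁ x₂ A₂, a = some (x₁, A₁) ∧
      b = some (x₂, A₂) ∧ x = x₁ + x₂ ∧ A = .union A₁ A₂ := by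
  cases a with
  | none => cases h
  | some a =>
    cases b with
    | none => cases h
    | some b =>
      simp only [addEntry, op_val, Option.some.injEq, Prod.mk.injEq] at h
      exact ⟨a.1, a.2, b.1, b.2, rfl, rfl, h.1.symm, h.2.symm⟩

theorem AtLeast.add {a b : Entry V} {L L' : ℝ} (ha : AtLeast a L) (hb : AtLeast b L') :
    AtLeast (addEntry a b).val (L + L') := by
  obtain ⟨x, A, rfl, hx⟩ := ha
  obtain ⟨y, B, rfl, hy⟩ := hb
  exact ⟨x + y, _, rfl, add_le_add hx hy⟩

theorem maxEntry_val_eq_some {a b : Entry V} {p : ℝ × NodeSet V}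
    (h : (maxEntry a b).val = some p) : a = some p ∨ b = some p := by
  cases a with
  | none => exact Or.inr h
  | some a =>
    cases b with
    | none => exact Or.inl h
    | some b =>
      simp only [maxEntry, op_val] at h
      split_ifs at h
      exacts [Or.inr h, Or.inl h]

theorem AtLeast.max_left {a : Entry V} {L : ℝ} (ha : AtLeast a L) (b : Entry V) :
    AtLeast (maxEntry a b).val L := by
  obtain ⟨x, A, rfl, hx⟩ := ha
  cases b with
  | none => exact ⟨x, A, rfl, hx⟩
  | some b =>
    simp only [maxEntry, op_val]
    split_ifs with h
    exacts [⟨_, _, rfl, hx.trans h.le⟩, ⟨_, _, rfl, hx⟩]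

theorem AtLeast.max_right {b : Entry V} {L : ℝ} (hb : AtLeast b L) (a : Entry V) :
    AtLeast (maxEntry a b).val L := by
  obtain ⟨x, A, rfl, hx⟩ := hb
  cases a with
  | none => exact ⟨x, A, rfl, hx⟩
  | some a =>
    simp only [maxEntry, op_val]
    split_ifs with h
    exacts [⟨_, _, rfl, hx⟩, ⟨_, _, rfl, hx.trans (not_lt.1 h)⟩]

theorem improve_val (t : ι → Entry V) (i : ι) (e : Entry V) :
    (improve t i e).val = Function.update t i (maxEntry (t i) e).val := rfl

theorem AllEntries.none {R : ι → ℝ → NodeSet V → Prop} : AllEntries R fun _ => none :=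
  fun _ _ _ h => by cases h

theorem AllEntries.update {R : ι → ℝ → NodeSet V → Prop} {t : ι → Entry V} (h : AllEntries R t)
    {i : ι} {e : Entry V} (he : ∀ x A, e = some (x, A) → R i x A) :
    AllEntries R (Function.update t i e) := by
  intro j x A hj
  by_cases hji : j = i
  · subst hji
    rw [Function.update_self] at hj
    exact he _ _ hj
  · rw [Function.update_of_ne hji] at hj
    exact h _ _ _ hj

theorem AllEntries.improve {R : ι → ℝ → NodeSet V → Prop} {t : ι → Entry V} (h : AllEntries R t)
    {i : ι} {e : Entry V} (he : ∀ x A, e = some (x, A) → R i x A) :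
    AllEntries R (improve t i e).val :=
  h.update fun _ _ hx => (maxEntry_val_eq_some hx).elim (h _ _ _) (he _ _)

theorem AtLeast.improve_self {e : Entry V} {L : ℝ} (he : AtLeast e L) (t : ι → Entry V) (i : ι) :
    AtLeast ((improve t i e).val i) L := by
  rw [improve_val, Function.update_self]
  exact he.max_right _

theorem AtLeast.improve {t : ι → Entry V} {i : ι} {L : ℝ} (h : AtLeast (t i) L) (j : ι)
    (e : Entry V) : AtLeast ((improve t j e).val i) L := by
  rw [improve_val]
  by_cases hij : i = j
  · subst hij
    rw [Function.update_self]
    exact h.max_left _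
  · rwa [Function.update_of_ne hij]

theorem forRange_max_eq_some {m : ℕ} {F : ℕ → Timed (Entry V)} {p : ℝ × NodeSet V}
    (h : (forRange m none fun c a => do
      let e ← F c
      maxEntry a e).val = some p) : ∃ c < m, (F c).val = some p := by
  revert h
  refine forRange_ind (fun a : Entry V => a = some p → ∃ c < m, (F c).val = some p)
    (fun h => by cases h) fun i hi a ha h => ?_
  exact (maxEntry_val_eq_some h).elim ha fun h => ⟨i, hi, h⟩

theorem AtLeast.forRange_max {m c : ℕ} {F : ℕ → Timed (Entry V)} {L : ℝ} (hc : c < m)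
    (h : AtLeast (F c).val L) : AtLeast (forRange m none fun c a => do
      let e ← F c
      maxEntry a e).val L :=
  forRange_reach (fun a : Entry V => AtLeast a L) hc (fun _ => h.max_right _)
    fun _ _ _ ha => ha.max_left _

end Tables

/-! ### The single steps of the dynamic programming -/

section Specs

variable {V : Type} [DecidableEq V] {T : BidirectedTree V} {S : Finset V} {k : ℕ} {γ : Grid}

variable (T) in
/-- The probability of the edge from the parent of `v`. -/
noncomputable def parentProb (b : Bool) (u : Option V) (v : V) : ℝ := (readParentProb T b u v).val

/-- The programs below are used through two kinds of facts. Tables start with `none` everywhere, so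
a property `R` of all written candidates holds for all finite entries. Conversely, a single
admissible combination bounds the entry at its index from below. -/
theorem leaf_sound {R : ℕ × ℕ × ℕ → ℝ → NodeSet V → Prop} {ap : ℝ} {u : Option V} {v : V}
    (h : ∀ κ ≤ k, ∀ f ≤ γ.top, R (κ, if v ∈ S then γ.top else 0, f)
      (nodeGain (γ.pt (if v ∈ S then γ.top else 0)) (γ.pt f) (parentProb T (decide (0 < κ)) u v) ap)
      (singleIf (decide (0 < κ)) v)) :
    AllEntries R (leaf T S k γ ap u v).val := by
  simp only [leaf, bind_val, newTable_val, isSeed, op_val, decide_eq_true_eq]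
  refine forRange_ind _ AllEntries.none fun κ hκ t ht => ?_
  refine forRange_ind _ ht fun f hf t ht => ?_
  refine ht.update fun x A hx => ?_
  cases hx
  exact h κ (by omega) f (by omega)

theorem leaf_complete {ap : ℝ} {u : Option V} {v : V} {κ f : ℕ} (hκ : κ ≤ k) (hf : f ≤ γ.top) :
    (leaf T S k γ ap u v).val (κ, if v ∈ S then γ.top else 0, f) = some
      (nodeGain (γ.pt (if v ∈ S then γ.top else 0)) (γ.pt f) (parentProb T (decide (0 < κ)) u v) ap,
      singleIf (decide (0 < κ)) v) := by
  simp only [leaf, bind_val, newTable_val, isSeed, op_val, decide_eq_true_eq]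
  -- The cells are overwritten here, not improved, so it matters that a second write to the same
  -- cell would store the same entry.
  have hpres : ∀ κ' f' : ℕ, ∀ t : Table V, t (κ, if v ∈ S then γ.top else 0, f) = some
      (nodeGain (γ.pt (if v ∈ S then γ.top else 0)) (γ.pt f) (parentProb T (decide (0 < κ)) u v) ap,
      singleIf (decide (0 < κ)) v) → Function.update t (κ', if v ∈ S then γ.top else 0, f') (some
      (nodeGain (γ.pt (if v ∈ S then γ.top else 0)) (γ.pt f')
        (parentProb T (decide (0 < κ')) u v) ap, singleIf (decide (0 < κ')) v))
      (κ, if v ∈ S then γ.top else 0, f) = some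
      (nodeGain (γ.pt (if v ∈ S then γ.top else 0)) (γ.pt f) (parentProb T (decide (0 < κ)) u v) ap,
      singleIf (decide (0 < κ)) v) := by
    intro κ' f' t ht
    by_cases hne : κ = κ' ∧ f = f'
    · obtain ⟨rfl, rfl⟩ := hne
      rw [Function.update_self]
    · rw [Function.update_of_ne, ht]
      simp only [ne_eq, Prod.mk.injEq]
      tauto
  refine forRange_reach (fun t : Table V => t (κ, if v ∈ S then γ.top else 0, f) = _)
    (Nat.lt_succ_of_le hκ) (fun t => ?_) (fun κ' _ t ht => ?_)
  · refine forRange_reach (fun t : Table V => t (κ, if v ∈ S then γ.top else 0, f) = _)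
      (Nat.lt_succ_of_le hf) (fun t => ?_) (fun f' _ t ht => hpres κ f' t ht)
    exact Function.update_self _ _ _
  · exact forRange_ind (fun t : Table V => t (κ, if v ∈ S then γ.top else 0, f) = _) ht
      fun f' _ t ht => hpres κ' f' t ht

/-- The treatment of one child in `internalSeed`. -/
noncomputable def seedStep (k : ℕ) (γ : Grid) (kid : V × Table V) (h : ℕ → Entry V) :
    Timed (ℕ → Entry V) := do
  let h' ← newTable (k + 1) none
  forRange (k + 1) h' fun κi h' => do
    let best ← forRange (γ.top + 1) none fun c m => do
      let e ← readAt kid.2 (κi, c, γ.top)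
      maxEntry m e
    forRange (k + 1 - κi) h' fun j h' => do
      let a ← readAt h j
      let e ← addEntry a best
      improve h' (κi + j) e

theorem seedStep_sound {R : ℕ → ℝ → NodeSet V → Prop} {kid : V × Table V} {h : ℕ → Entry V}
    (hR : ∀ κi j c, κi + j ≤ k → c ≤ γ.top → ∀ x₁ A₁ x₂ A₂, h j = some (x₁, A₁) →
      kid.2 (κi, c, γ.top) = some (x₂, A₂) → R (κi + j) (x₁ + x₂) (.union A₁ A₂)) :
    AllEntries R (seedStep k γ kid h).val := by
  simp only [seedStep, bind_val, newTable_val]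
  refine forRange_ind _ AllEntries.none fun κi hκi t ht => ?_
  rw [bind_val]
  refine forRange_ind _ ht fun j hj t ht => ?_
  refine ht.improve fun x A hx => ?_
  obtain ⟨x₁, A₁, x₂, A₂, h₁, h₂, rfl, rfl⟩ := addEntry_val_eq_some hx
  obtain ⟨c, hc, hc'⟩ := forRange_max_eq_some h₂
  exact hR κi j c (by omega) (by omega) _ _ _ _ h₁ hc'

theorem seedStep_complete {kid : V × Table V} {h : ℕ → Entry V} {κi j c : ℕ} (hκ : κi + j ≤ k)
    (hc : c ≤ γ.top) {L₁ L₂ : ℝ} (h₁ : AtLeast (h j) L₁)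
    (h₂ : AtLeast (kid.2 (κi, c, γ.top)) L₂) :
    AtLeast ((seedStep k γ kid h).val (κi + j)) (L₁ + L₂) := by
  simp only [seedStep, bind_val, newTable_val]
  refine forRange_reach (fun t : ℕ → Entry V => AtLeast (t (κi + j)) (L₁ + L₂))
    (by omega : κi < k + 1) (fun t => ?_) (fun i _ t ht => ?_)
  · rw [bind_val]
    refine forRange_reach (fun t : ℕ → Entry V => AtLeast (t (κi + j)) (L₁ + L₂))
      (by omega : j < k + 1 - κi) (fun t => ?_) (fun i _ t ht => ?_)
    · refine AtLeast.improve_self (AtLeast.add h₁ ?_) _ _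
      exact AtLeast.forRange_max (Nat.lt_succ_of_le hc) h₂
    · exact ht.improve _ _
  · rw [bind_val]
    exact forRange_ind (fun t : ℕ → Entry V => AtLeast (t (κi + j)) (L₁ + L₂)) ht
      fun _ _ t ht => ht.improve _ _

/-- The helper table of an internal seed node after all children are treated. -/
noncomputable def seedTable (k : ℕ) (γ : Grid) (kids : List (V × Table V)) (h : ℕ → Entry V) :
    ℕ → Entry V := (forList kids h (seedStep k γ)).val

theorem internalSeed_val (kids : List (V × Table V)) : (internalSeed k γ kids).val =
    (forRange (k + 1) (fun _ => none) fun κ (g : Table V) =>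
      forRange (γ.top + 1) g fun f g => do
        let e ← readAt (seedTable k γ kids fun _ => some (0, .empty)) κ
        writeAt g (κ, γ.top, f) e).val := rfl

theorem internalSeed_sound {R : ℕ × ℕ × ℕ → ℝ → NodeSet V → Prop} {kids : List (V × Table V)}
    (h : ∀ κ ≤ k, ∀ f ≤ γ.top, ∀ x A, seedTable k γ kids (fun _ => some (0, .empty)) κ =
      some (x, A) → R (κ, γ.top, f) x A) : AllEntries R (internalSeed k γ kids).val := by
  rw [internalSeed_val]
  refine forRange_ind _ AllEntries.none fun κ hκ t ht => ?_
  refine forRange_ind _ ht fun f hf t ht => ?_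
  exact ht.update fun x A hx => h κ (by omega) f (by omega) x A hx

theorem internalSeed_complete {kids : List (V × Table V)} {κ f : ℕ} (hκ : κ ≤ k)
    (hf : f ≤ γ.top) {L : ℝ}
    (h : AtLeast (seedTable k γ kids (fun _ => some (0, .empty)) κ) L) :
    AtLeast ((internalSeed k γ kids).val (κ, γ.top, f)) L := by
  rw [internalSeed_val]
  have hpres : ∀ κ' f' : ℕ, ∀ t : Table V, AtLeast (t (κ, γ.top, f)) L →
      AtLeast (Function.update t (κ', γ.top, f')
        (seedTable k γ kids (fun _ => some (0, .empty)) κ') (κ, γ.top, f)) L := by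
    intro κ' f' t ht
    by_cases hne : κ = κ' ∧ f = f'
    · obtain ⟨rfl, rfl⟩ := hne
      rwa [Function.update_self]
    · rw [Function.update_of_ne]
      · exact ht
      · simp only [ne_eq, Prod.mk.injEq]
        tauto
  refine forRange_reach (fun t : Table V => AtLeast (t (κ, γ.top, f)) L)
    (Nat.lt_succ_of_le hκ) (fun t => ?_) (fun κ' _ t ht => ?_)
  · refine forRange_reach (fun t : Table V => AtLeast (t (κ, γ.top, f)) L)
      (Nat.lt_succ_of_le hf) (fun t => ?_) (fun f' _ t ht => hpres κ f' t ht)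
    simp only [bind_val, readAt, op_val, writeAt, Function.update_self]
    exact h
  · exact forRange_ind (fun t : Table V => AtLeast (t (κ, γ.top, f)) L) ht
      fun f' _ t ht => hpres κ' f' t ht

theorem nonseedWithChild_sound {R : ℕ × ℕ × ℕ → ℝ → NodeSet V → Prop} {ap : ℝ} {u : Option V}
    {v w : V} {g₁ : Table V}
    (h : ∀ (b : Bool) (κ₁ c₁ f : ℕ), κ₁ + b.toNat ≤ k → c₁ ≤ γ.top → f ≤ γ.top → ∀ x₁ A₁,
      g₁ (κ₁, c₁, γ.idx (γ.pt f * parentProb T b u v)) = some (x₁, A₁) →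
      R (κ₁ + b.toNat, γ.idx (γ.pt c₁ * T.prob b w v), f)
        (x₁ + nodeGain (γ.pt (γ.idx (γ.pt c₁ * T.prob b w v))) (γ.pt f) (parentProb T b u v) ap)
        (.union A₁ (singleIf b v))) :
    AllEntries R (nonseedWithChild T k γ ap u v w g₁).val := by
  simp only [nonseedWithChild, bind_val, newTable_val]
  refine forList_ind _ AllEntries.none fun b _ t ht => ?_
  simp only [bind_val, readProb, op_val]
  refine forRange_ind _ ht fun c₁ hc₁ t ht => ?_
  refine forRange_ind _ ht fun f hf t ht => ?_
  simp only [bind_val, Grid.value_val, Grid.round_val, rmul, op_val, nodeBoost_val]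
  refine forRange_ind _ ht fun κ₁ hκ₁ t ht => ?_
  refine ht.improve fun x A hx => ?_
  obtain ⟨x₁, A₁, x₂, A₂, h₁, h₂, rfl, rfl⟩ := addEntry_val_eq_some hx
  cases h₂
  exact h b κ₁ c₁ f (by omega) (by omega) (by omega) x₁ A₁ h₁

theorem nonseedWithChild_complete {ap : ℝ} {u : Option V} {v w : V} {g₁ : Table V} {b : Bool}
    {κ₁ c₁ f : ℕ} (hκ : κ₁ + b.toNat ≤ k) (hc : c₁ ≤ γ.top) (hf : f ≤ γ.top) {L : ℝ}
    (h : AtLeast (g₁ (κ₁, c₁, γ.idx (γ.pt f * parentProb T b u v))) L) :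
    AtLeast ((nonseedWithChild T k γ ap u v w g₁).val
      (κ₁ + b.toNat, γ.idx (γ.pt c₁ * T.prob b w v), f))
      (L + nodeGain (γ.pt (γ.idx (γ.pt c₁ * T.prob b w v))) (γ.pt f) (parentProb T b u v) ap) := by
  simp only [nonseedWithChild, bind_val, newTable_val]
  set I : Table V → Prop := fun t => AtLeast (t
    (κ₁ + b.toNat, γ.idx (γ.pt c₁ * T.prob b w v), f))
      (L + nodeGain (γ.pt (γ.idx (γ.pt c₁ * T.prob b w v))) (γ.pt f) (parentProb T b u v) ap)
    with hI
  refine forList_reach I (a₀ := b) (by cases b <;> simp) (fun t => ?_) (fun b' _ t ht => ?_)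
  · simp only [bind_val, readProb, op_val]
    refine forRange_reach I (Nat.lt_succ_of_le hc) (fun t => ?_) (fun c' _ t ht => ?_)
    · refine forRange_reach I (Nat.lt_succ_of_le hf) (fun t => ?_) (fun f' _ t ht => ?_)
      · simp only [bind_val, Grid.value_val, Grid.round_val, rmul, op_val, nodeBoost_val]
        refine forRange_reach I (by omega : κ₁ < k + 1 - b.toNat) (fun t => ?_)
          (fun κ' _ t ht => ht.improve _ _)
        exact AtLeast.improve_self (AtLeast.add h ⟨_, _, rfl, le_rfl⟩) _ _
      · simp only [bind_val]
        exact forRange_ind I ht fun _ _ t ht => ht.improve _ _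
    · refine forRange_ind I ht fun _ _ t ht => ?_
      simp only [bind_val]
      exact forRange_ind I ht fun _ _ t ht => ht.improve _ _
  · simp only [bind_val]
    refine forRange_ind I ht fun _ _ t ht => ?_
    refine forRange_ind I ht fun _ _ t ht => ?_
    simp only [bind_val]
    exact forRange_ind I ht fun _ _ t ht => ht.improve _ _

/-- The probability `y_j` that the index `z` of the helper table for the first `j` children stands
for: for the last child it is obtained from the value for the parent. -/
noncomputable def zval (T : BidirectedTree V) (b last : Bool) (γ' : Grid) (u : Option V) (v : V)
    (z : ℕ) : ℝ := if last then γ'.pt z * parentProb T b u v else γ'.pt z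

theorem helperStart_sound {R : ℕ × ℕ × ℕ → ℝ → NodeSet V → Prop} {b last : Bool} {γ₂ : Grid}
    {u : Option V} {v w₁ w₂ : V} {g₁ g₂ : Table V}
    (h : ∀ c₁ c₂ z κ₁ κ₂ : ℕ, c₁ ≤ γ.top → c₂ ≤ γ.top → z ≤ γ₂.top → κ₁ + κ₂ + b.toNat ≤ k →
      ∀ x₁ A₁ x₂ A₂,
      g₁ (κ₁, c₁, γ.idx (orR (γ.pt c₂ * T.prob b w₂ v) (zval T b last γ₂ u v z))) =
        some (x₁, A₁) →
      g₂ (κ₂, c₂, γ.idx (orR (γ.pt c₁ * T.prob b w₁ v) (zval T b last γ₂ u v z))) =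
        some (x₂, A₂) →
      R (κ₁ + κ₂ + b.toNat, γ₂.idx (orR (γ.pt c₁ * T.prob b w₁ v) (γ.pt c₂ * T.prob b w₂ v)), z)
        (x₁ + x₂) (.union A₁ A₂)) :
    AllEntries R (helperStart T k γ b last γ₂ u v w₁ w₂ g₁ g₂).val := by
  cases last
  all_goals
    simp only [helperStart, bind_val, newTable_val]
    refine forRange_ind _ AllEntries.none fun c₁ hc₁ t ht => ?_
    refine forRange_ind _ ht fun c₂ hc₂ t ht => ?_
    refine forRange_ind _ ht fun z hz t ht => ?_
    simp only [bind_val, Grid.value_val, Grid.round_val, rmul, op_val, orProb_val, readProb, pure_val,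
          Bool.false_eq_true, if_true, if_false]
    refine forRange_ind _ ht fun κ₁ hκ₁ t ht => ?_
    refine forRange_ind _ ht fun κ₂ hκ₂ t ht => ?_
    refine ht.improve fun x A hx => ?_
    obtain ⟨x₁, A₁, x₂, A₂, h₁, h₂, rfl, rfl⟩ := addEntry_val_eq_some hx
    refine h c₁ c₂ z κ₁ κ₂ (by omega) (by omega) (by omega) (by omega) x₁ A₁ x₂ A₂ ?_ ?_
    · exact h₁
    · exact h₂

theorem helperStart_complete {b last : Bool} {γ₂ : Grid} {u : Option V} {v w₁ w₂ : V}
    {g₁ g₂ : Table V} {c₁ c₂ z κ₁ κ₂ : ℕ} (hc₁ : c₁ ≤ γ.top) (hc₂ : c₂ ≤ γ.top) (hz : z ≤ γ₂.top)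
    (hκ : κ₁ + κ₂ + b.toNat ≤ k) {L₁ L₂ : ℝ}
    (h₁ : AtLeast (g₁ (κ₁, c₁,
      γ.idx (orR (γ.pt c₂ * T.prob b w₂ v) (zval T b last γ₂ u v z)))) L₁)
    (h₂ : AtLeast (g₂ (κ₂, c₂,
      γ.idx (orR (γ.pt c₁ * T.prob b w₁ v) (zval T b last γ₂ u v z)))) L₂) :
    AtLeast ((helperStart T k γ b last γ₂ u v w₁ w₂ g₁ g₂).val (κ₁ + κ₂ + b.toNat,
      γ₂.idx (orR (γ.pt c₁ * T.prob b w₁ v) (γ.pt c₂ * T.prob b w₂ v)), z)) (L₁ + L₂) := by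
  cases last
  all_goals
    simp only [helperStart, bind_val, newTable_val]
    set I : Table V → Prop := fun t => AtLeast (t (κ₁ + κ₂ + b.toNat,
      γ₂.idx (orR (γ.pt c₁ * T.prob b w₁ v) (γ.pt c₂ * T.prob b w₂ v)), z)) (L₁ + L₂) with hI
    refine forRange_reach I (Nat.lt_succ_of_le hc₁) (fun t => ?_) (fun _ _ t ht => ?_)
    · refine forRange_reach I (Nat.lt_succ_of_le hc₂) (fun t => ?_) (fun _ _ t ht => ?_)
      · refine forRange_reach I (Nat.lt_succ_of_le hz) (fun t => ?_) (fun _ _ t ht => ?_)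
        · simp only [bind_val, Grid.value_val, Grid.round_val, rmul, op_val, orProb_val, readProb, pure_val,
          Bool.false_eq_true, if_true, if_false]
          refine forRange_reach I (by omega : κ₁ < k + 1) (fun t => ?_) (fun _ _ t ht => ?_)
          · refine forRange_reach I (by omega : κ₂ < k + 1 - κ₁ - b.toNat) (fun t => ?_)
              (fun _ _ t ht => ht.improve _ _)
            exact AtLeast.improve_self (AtLeast.add h₁ h₂) _ _
          · exact forRange_ind I ht fun _ _ t ht => ht.improve _ _
        · simp only [bind_val, Bool.false_eq_true, if_true, if_false]
          refine forRange_ind I ht fun _ _ t ht => ?_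
          exact forRange_ind I ht fun _ _ t ht => ht.improve _ _
      · refine forRange_ind I ht fun _ _ t ht => ?_
        simp only [bind_val, Bool.false_eq_true, if_true, if_false]
        refine forRange_ind I ht fun _ _ t ht => ?_
        exact forRange_ind I ht fun _ _ t ht => ht.improve _ _
    · refine forRange_ind I ht fun _ _ t ht => ?_
      refine forRange_ind I ht fun _ _ t ht => ?_
      simp only [bind_val, Bool.false_eq_true, if_true, if_false]
      refine forRange_ind I ht fun _ _ t ht => ?_
      exact forRange_ind I ht fun _ _ t ht => ht.improve _ _

theorem helperStep_sound {R : ℕ × ℕ × ℕ → ℝ → NodeSet V → Prop} {b last : Bool} {γf γi : Grid}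
    {u : Option V} {v w : V} {g gi : Table V}
    (h : ∀ x c z κ κi : ℕ, x ≤ γf.top → c ≤ γ.top → z ≤ γi.top → κ + κi ≤ k →
      ∀ x₁ A₁ x₂ A₂,
      g (κ, x, γf.idx (orR (γ.pt c * T.prob b w v) (zval T b last γi u v z))) = some (x₁, A₁) →
      gi (κi, c, γ.idx (orR (γf.pt x) (zval T b last γi u v z))) = some (x₂, A₂) →
      R (κ + κi, γi.idx (orR (γf.pt x) (γ.pt c * T.prob b w v)), z) (x₁ + x₂) (.union A₁ A₂)) :
    AllEntries R (helperStep T k γ b last γf γi u v w g gi).val := by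
  cases last
  all_goals
    simp only [helperStep, bind_val, newTable_val]
    refine forRange_ind _ AllEntries.none fun x hx t ht => ?_
    refine forRange_ind _ ht fun c hc t ht => ?_
    refine forRange_ind _ ht fun z hz t ht => ?_
    simp only [bind_val, Grid.value_val, Grid.round_val, rmul, op_val, orProb_val, readProb, pure_val,
          Bool.false_eq_true, if_true, if_false]
    refine forRange_ind _ ht fun κ hκ t ht => ?_
    refine forRange_ind _ ht fun κi hκi t ht => ?_
    refine ht.improve fun y A hy => ?_
    obtain ⟨x₁, A₁, x₂, A₂, h₁, h₂, rfl, rfl⟩ := addEntry_val_eq_some hy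
    -- The program enumerates the total budget and the share of the new child; the hypothesis is
    -- phrased in the two summands.
    have h₃ := h x c z (κ - κi) κi (by omega) (by omega) (by omega) (by omega) x₁ A₁ x₂ A₂
      (by exact h₁) (by exact h₂)
    rwa [Nat.sub_add_cancel (by omega)] at h₃

theorem helperStep_complete {b last : Bool} {γf γi : Grid} {u : Option V} {v w : V}
    {g gi : Table V} {x c z κ κi : ℕ} (hx : x ≤ γf.top) (hc : c ≤ γ.top) (hz : z ≤ γi.top)
    (hκ : κ + κi ≤ k) {L₁ L₂ : ℝ}
    (h₁ : AtLeast (g (κ, x,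
      γf.idx (orR (γ.pt c * T.prob b w v) (zval T b last γi u v z)))) L₁)
    (h₂ : AtLeast (gi (κi, c, γ.idx (orR (γf.pt x) (zval T b last γi u v z)))) L₂) :
    AtLeast ((helperStep T k γ b last γf γi u v w g gi).val (κ + κi,
      γi.idx (orR (γf.pt x) (γ.pt c * T.prob b w v)), z)) (L₁ + L₂) := by
  cases last
  all_goals
    simp only [helperStep, bind_val, newTable_val]
    set I : Table V → Prop := fun t => AtLeast (t (κ + κi,
      γi.idx (orR (γf.pt x) (γ.pt c * T.prob b w v)), z)) (L₁ + L₂) with hI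
    refine forRange_reach I (Nat.lt_succ_of_le hx) (fun t => ?_) (fun _ _ t ht => ?_)
    · refine forRange_reach I (Nat.lt_succ_of_le hc) (fun t => ?_) (fun _ _ t ht => ?_)
      · refine forRange_reach I (Nat.lt_succ_of_le hz) (fun t => ?_) (fun _ _ t ht => ?_)
        · simp only [bind_val, Grid.value_val, Grid.round_val, rmul, op_val, orProb_val, readProb, pure_val,
          Bool.false_eq_true, if_true, if_false]
          refine forRange_reach I (by omega : κ + κi < k + 1) (fun t => ?_) (fun _ _ t ht => ?_)
          · refine forRange_reach I (by omega : κi < κ + κi + 1) (fun t => ?_)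
              (fun _ _ t ht => ht.improve _ _)
            refine AtLeast.improve_self (AtLeast.add ?_ h₂) _ _
            simp only [readAt, op_val, Nat.add_sub_cancel]
            exact h₁
          · exact forRange_ind I ht fun _ _ t ht => ht.improve _ _
        · simp only [bind_val, Bool.false_eq_true, if_true, if_false]
          refine forRange_ind I ht fun _ _ t ht => ?_
          exact forRange_ind I ht fun _ _ t ht => ht.improve _ _
      · refine forRange_ind I ht fun _ _ t ht => ?_
        simp only [bind_val, Bool.false_eq_true, if_true, if_false]
        refine forRange_ind I ht fun _ _ t ht => ?_
        exact forRange_ind I ht fun _ _ t ht => ht.improve _ _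
    · refine forRange_ind I ht fun _ _ t ht => ?_
      refine forRange_ind I ht fun _ _ t ht => ?_
      simp only [bind_val, Bool.false_eq_true, if_true, if_false]
      refine forRange_ind I ht fun _ _ t ht => ?_
      exact forRange_ind I ht fun _ _ t ht => ht.improve _ _

/-- The grid for the intermediate values at a node whose children from the third one on are in the
list `rest`. -/
noncomputable def fineGrid (γ : Grid) (rest : List (V × Table V)) : Grid :=
  (mkGrid (γ.mesh / rest.length)).val

/-- The grid for the values of the helper table if the children in `rest` are still untreated. -/
def stageGrid (γ γf : Grid) (rest : List (V × Table V)) : Grid :=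
  if rest.isEmpty then γ else γf

variable (T k) in
/-- The helper table of a node with at least two children after all children are treated. -/
noncomputable def helperTable (γ : Grid) (b : Bool) (u : Option V) (v : V)
    (kid₁ kid₂ : V × Table V) (rest : List (V × Table V)) : Table V :=
  (helperSteps T k γ b (fineGrid γ rest) u v rest
    (helperStart T k γ b rest.isEmpty (stageGrid γ (fineGrid γ rest) rest) u v
      kid₁.1 kid₂.1 kid₁.2 kid₂.2).val).val

theorem helperSteps_cons_val (b : Bool) (γf : Grid) (u : Option V) (v : V) (kid : V × Table V)
    (rest : List (V × Table V)) (h : Table V) :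
    (helperSteps T k γ b γf u v (kid :: rest) h).val = (helperSteps T k γ b γf u v rest
      (helperStep T k γ b rest.isEmpty γf (stageGrid γ γf rest) u v kid.1 h kid.2).val).val := rfl

theorem nonseedWithChildren_sound {R : ℕ × ℕ × ℕ → ℝ → NodeSet V → Prop} {ap : ℝ} {u : Option V}
    {v : V} {kid₁ kid₂ : V × Table V} {rest : List (V × Table V)}
    (h : ∀ (b : Bool) (κ c f : ℕ), κ ≤ k → c ≤ γ.top → f ≤ γ.top → ∀ x A,
      helperTable T k γ b u v kid₁ kid₂ rest (κ, c, f) = some (x, A) →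
      R (κ, c, f) (x + nodeGain (γ.pt c) (γ.pt f) (parentProb T b u v) ap)
        (.union A (singleIf b v))) :
    AllEntries R (nonseedWithChildren T k γ ap u v kid₁ kid₂ rest).val := by
  simp only [nonseedWithChildren, bind_val, newTable_val, lengthOf_val, rcast, rdiv, op_val]
  refine forList_ind _ AllEntries.none fun b _ t ht => ?_
  simp only [bind_val]
  refine forRange_ind _ ht fun κ hκ t ht => ?_
  refine forRange_ind _ ht fun c hc t ht => ?_
  refine forRange_ind _ ht fun f hf t ht => ?_
  refine ht.improve fun x A hx => ?_
  obtain ⟨x₁, A₁, x₂, A₂, h₁, h₂, rfl, rfl⟩ := addEntry_val_eq_some hx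
  cases h₂
  exact h b κ c f (by omega) (by omega) (by omega) x₁ A₁ h₁

theorem nonseedWithChildren_complete {ap : ℝ} {u : Option V} {v : V} {kid₁ kid₂ : V × Table V}
    {rest : List (V × Table V)} {b : Bool} {κ c f : ℕ} (hκ : κ ≤ k) (hc : c ≤ γ.top)
    (hf : f ≤ γ.top) {L : ℝ}
    (h : AtLeast (helperTable T k γ b u v kid₁ kid₂ rest (κ, c, f)) L) :
    AtLeast ((nonseedWithChildren T k γ ap u v kid₁ kid₂ rest).val (κ, c, f))
      (L + nodeGain (γ.pt c) (γ.pt f) (parentProb T b u v) ap) := by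
  simp only [nonseedWithChildren, bind_val, newTable_val, lengthOf_val, rcast, rdiv, op_val]
  set I : Table V → Prop := fun t => AtLeast (t (κ, c, f))
    (L + nodeGain (γ.pt c) (γ.pt f) (parentProb T b u v) ap) with hI
  refine forList_reach I (a₀ := b) (by cases b <;> simp) (fun t => ?_) (fun b' _ t ht => ?_)
  · simp only [bind_val]
    refine forRange_reach I (Nat.lt_succ_of_le hκ) (fun t => ?_) (fun _ _ t ht => ?_)
    · refine forRange_reach I (Nat.lt_succ_of_le hc) (fun t => ?_) (fun _ _ t ht => ?_)
      · refine forRange_reach I (Nat.lt_succ_of_le hf) (fun t => ?_)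
          (fun _ _ t ht => ht.improve _ _)
        exact AtLeast.improve_self (AtLeast.add h ⟨_, _, rfl, le_rfl⟩) _ _
      · exact forRange_ind I ht fun _ _ t ht => ht.improve _ _
    · refine forRange_ind I ht fun _ _ t ht => ?_
      exact forRange_ind I ht fun _ _ t ht => ht.improve _ _
  · simp only [bind_val]
    refine forRange_ind I ht fun _ _ t ht => ?_
    refine forRange_ind I ht fun _ _ t ht => ?_
    exact forRange_ind I ht fun _ _ t ht => ht.improve _ _

variable (S k) in
/-- The table computed by `solve` at a node from the tables of its children. -/
noncomputable def nodeTable (T : BidirectedTree V) (γ : Grid) (ap : ℝ) (u : Option V) (v : V) :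
    List (V × Table V) → Table V
  | [] => (leaf T S k γ ap u v).val
  | [kid] =>
    if v ∈ S then (internalSeed k γ [kid]).val
    else (nonseedWithChild T k γ ap u v kid.1 kid.2).val
  | kid₁ :: kid₂ :: rest =>
    if v ∈ S then (internalSeed k γ (kid₁ :: kid₂ :: rest)).val
    else (nonseedWithChildren T k γ ap u v kid₁ kid₂ rest).val

theorem foldl_cons_eq {α β : Type} (l : List α) (f : α → β) (s : List β) :
    l.foldl (fun s a => f a :: s) s = (l.map f).reverse ++ s := by
  induction l generalizing s with
  | nil => rfl
  | cons a l ih => simp [ih]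

/-- The list of children comes out reversed, because each is put in front. The order is irrelevant:
what follows only uses that the list is a permutation of the children. -/
theorem solve_succ_val (n m : ℕ) (β₀ : V → Bool) (u : Option V) (v : V) :
    (solve T S k γ n β₀ (m + 1) u v).val = nodeTable S k T γ (activation T S β₀ n none v).val u v
      ((T.kids u v).reverse.map fun w => (w, (solve T S k γ n β₀ m (some v) w).val)) := by
  rw [List.map_reverse, ← List.append_nil (List.reverse _), ← foldl_cons_eq,
    ← BidirectedTree.foldl_adj, solve]
  simp only [bind_val, forList_val, isParent, op_val, ite_val, pure_val, isSeed,
    decide_eq_true_eq]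
  generalize List.foldl _ _ _ = l
  match l with
  | [] => rfl
  | [_] => simp only [nodeTable, ite_val]
  | _ :: _ :: _ => simp only [nodeTable, ite_val]

end Specs



/-! ### Members and size of formal unions -/

namespace NodeSet

variable {V : Type}

/-- The members of a formal union. -/
def mems : NodeSet V → List V
  | .empty => []
  | .single v => [v]
  | .union A B => A.mems ++ B.mems

/-- The number of nodes of the expression tree of a formal union. -/
def size : NodeSet V → ℕ
  | .empty => 1
  | .single _ => 1
  | .union A B => A.size + B.size + 1

theorem collect_val (A : NodeSet V) (acc : List V) : (A.collect acc).val = A.mems ++ acc := by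
  induction A generalizing acc with
  | empty => rfl
  | single v => rfl
  | union A B ihA ihB =>
    rw [collect, mems, bind_val, bind_val, ihA, ihB, List.append_assoc]

theorem collect_steps (A : NodeSet V) (acc : List V) : (A.collect acc).steps ≤ 2 * A.size := by
  induction A generalizing acc with
  | empty => simp [collect, size]
  | single v => simp [collect, size]
  | union A B ihA ihB =>
    have h₁ := ihB acc
    have h₂ := ihA (B.collect acc).val
    simp only [collect, size, bind_steps, call_steps]
    omega

end NodeSet

theorem singleIf_mems {V : Type} (b : Bool) (v : V) :
    (singleIf b v).mems = if b then [v] else [] := by cases b <;> rfl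

theorem singleIf_size {V : Type} (b : Bool) (v : V) : (singleIf b v).size = 1 := by
  cases b <;> rfl

open BidirectedTree

variable {V : Type} [DecidableEq V] [Fintype V] {T : BidirectedTree V} {S : Finset V} {k : ℕ} {γ : Grid}

theorem parentProb_mem (b : Bool) {u : Option V} {v : V} (hu : T.IsDir u v) :
    0 ≤ parentProb T b u v ∧ parentProb T b u v ≤ 1 := by
  cases u with
  | none => simp [parentProb, readParentProb]
  | some u => exact T.prob_mem b (hu u rfl)

theorem zval_mem {γ' : Grid} (hγ' : γ'.Proper) (b last : Bool) {u : Option V} {v : V}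
    (hu : T.IsDir u v) (z : ℕ) : 0 ≤ zval T b last γ' u v z ∧ zval T b last γ' u v z ≤ 1 := by
  have h₁ := hγ'.pt_mem z
  have h₂ := parentProb_mem (T := T) b hu
  rw [zval]
  split_ifs
  · exact ⟨mul_nonneg h₁.1 h₂.1, mul_le_one₀ h₁.2 h₂.1 h₂.2⟩
  · exact h₁


/-! ### The exact quantities that the table entries approximate -/

variable (T S) in
/-- The activation probability of `v` if no node is boosted. -/
noncomputable def baseline (v : V) : ℝ := T.infl S (T.bprob fun _ => false) none v

variable (T S) in
/-- The increase of the activation probability of `y` if the nodes marked in `β` are boosted. -/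
noncomputable def gain (β : V → Bool) (y : V) : ℝ :=
  max (T.infl S (T.bprob β) none y - baseline T S y) 0

variable (T S) in
/-- The activation probability of the parent `u` of `v` in its component after the removal of
`v`. -/
noncomputable def above (β : V → Bool) : Option V → V → ℝ
  | none, _ => 0
  | some u, v => T.infl S (T.bprob β) (some v) u

/-- The parent acts like one more neighbour; at the root both sides vanish, so the root needs no
separate treatment. -/
theorem above_mul_parentProb (β : V → Bool) (u : Option V) (v : V) :
    above T S β u v * parentProb T (β v) u v = T.orL S (T.bprob β) v u.toList := by
  cases u with
  | none => simp [above]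
  | some u => rw [Option.toList_some, orL_singleton]; rfl

theorem infl_none_eq_orR (β : V → Bool) {u : Option V} {v : V} (hu : T.IsDir u v) :
    T.infl S (T.bprob β) none v =
      orR (T.infl S (T.bprob β) u v) (above T S β u v * parentProb T (β v) u v) := by
  rw [above_mul_parentProb, orR, infl_none_eq (T.isProb_bprob β) hu]

/-- The exact value that `f_i` approximates: `K` corresponds to `x_{i-1}`, and `R` together with the
parent to `y_i`. -/
theorem infl_kid_eq (β : V → Bool) {u : Option V} {v w : V} {K R : List V} (hu : T.IsDir u v)
    (hv : v ∉ S) (hp : (T.kids u v).Perm (K ++ w :: R)) : above T S β (some v) w =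
      T.orL S (T.bprob β) v (K ++ (R ++ u.toList)) := by
  have hw : w ∈ T.kids u v := hp.mem_iff.2 (by simp)
  rw [above, infl_of_notMem (T.isProb_bprob β) (T.isDir_some (mem_kids.1 hw).1.symm) hv,
    orL_perm (kids_some_perm hu hp)]

/-! ### Soundness: every entry of a table is attained -/

variable (T S γ) in
/-- The conditions on the entry `(x, A)` with index `i` of the table of `v`. -/
def EntrySound (u : Option V) (v : V) (i : ℕ × ℕ × ℕ) (x : ℝ) (A : NodeSet V) : Prop :=
  (∀ y ∈ A.mems, y ∈ T.comp u v) ∧ A.mems.length ≤ i.1 ∧ A.size + 1 ≤ 4 * (T.comp u v).card ∧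
    ∀ β : V → Bool, (∀ y ∈ T.comp u v, β y = decide (y ∈ A.mems)) →
      γ.pt i.2.1 ≤ T.infl S (T.bprob β) u v ∧
      (γ.pt i.2.2 ≤ above T S β u v → x ≤ ∑ y ∈ T.comp u v, gain T S β y)

variable (T) in
/-- The conditions on the set of an entry for the children in `K` with `κ - m` boosted nodes. -/
structure ForestSet (v : V) (K : List V) (m κ : ℕ) (A : NodeSet V) : Prop where
  mem : ∀ y ∈ A.mems, ∃ w ∈ K, y ∈ T.comp (some v) w
  len : A.mems.length + m ≤ κ
  size : A.size ≤ 4 * (K.map fun w => (T.comp (some v) w).card).sum + 1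

variable (T) in
/-- `β` marks exactly the members of `A` among the nodes below the children in `K`. -/
def Agrees (v : V) (K : List V) (β : V → Bool) (A : NodeSet V) : Prop :=
  ∀ w ∈ K, ∀ y ∈ T.comp (some v) w, β y = decide (y ∈ A.mems)

variable (T S) in
/-- The total gain of the nodes below the children in `K`. -/
noncomputable def forestGain (v : V) (K : List V) (β : V → Bool) : ℝ :=
  (K.map fun w => ∑ y ∈ T.comp (some v) w, gain T S β y).sum

theorem gain_nonneg (β : V → Bool) (y : V) : 0 ≤ gain T S β y := le_max_right _ _

theorem sum_gain_eq (β : V → Bool) {u : Option V} {v : V} {K : List V} (hu : T.IsDir u v)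
    (hK : (T.kids u v).Perm K) :
    ∑ y ∈ T.comp u v, gain T S β y = gain T S β v + forestGain T S v K β := by
  rw [sum_comp _ hu, forestGain, (hK.map _).sum_eq]

theorem card_comp_eq {u : Option V} {v : V} {K : List V} (hu : T.IsDir u v)
    (hK : (T.kids u v).Perm K) :
    (T.comp u v).card = 1 + (K.map fun w => (T.comp (some v) w).card).sum := by
  rw [card_comp hu, (hK.map _).sum_eq]

theorem ForestSet.append {v w : V} {K : List V} {m κ κ' : ℕ} {A A' : NodeSet V}
    (h : ForestSet T v K m κ A) {i : ℕ × ℕ} {x : ℝ}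
    (h' : EntrySound T S γ (some v) w (κ', i) x A') :
    ForestSet T v (K ++ [w]) m (κ + κ') (.union A A') := by
  obtain ⟨h₁, h₂, h₃, -⟩ := h'
  refine ⟨fun y hy => ?_, ?_, ?_⟩
  · rw [NodeSet.mems, List.mem_append] at hy
    rcases hy with hy | hy
    · obtain ⟨w', hw', hy'⟩ := h.mem y hy
      exact ⟨w', by simp [hw'], hy'⟩
    · exact ⟨w, by simp, h₁ y hy⟩
  · have := h.len
    rw [NodeSet.mems, List.length_append]
    simp only at h₂
    omega
  · have := h.size
    rw [NodeSet.size]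
    simp only [List.map_append, List.sum_append, List.map_cons, List.map_nil, List.sum_cons,
      List.sum_nil]
    omega

theorem forestSet_singleton {v w : V} {κ m : ℕ} {A : NodeSet V} {i : ℕ × ℕ} {x : ℝ}
    (h : EntrySound T S γ (some v) w (κ, i) x A) : ForestSet T v [w] m (κ + m) A := by
  obtain ⟨h₁, h₂, h₃, -⟩ := h
  refine ⟨fun y hy => ⟨w, by simp, h₁ y hy⟩, ?_, ?_⟩
  · simp only at h₂
    omega
  · simp only [List.map_cons, List.map_nil, List.sum_cons, List.sum_nil]
    omega

/-- The components of different children are disjoint, so in each of them only one of the two sets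
can have members. -/
theorem Agrees.union {v w : V} {K : List V} {β : V → Bool} {A A' : NodeSet V}
    (hadj : ∀ w' ∈ K ++ [w], T.G.Adj v w') (hnd : (K ++ [w]).Nodup)
    (hA : ∀ y ∈ A.mems, ∃ w ∈ K, y ∈ T.comp (some v) w)
    (hA' : ∀ y ∈ A'.mems, y ∈ T.comp (some v) w) (h : Agrees T v (K ++ [w]) β (.union A A')) :
    Agrees T v K β A ∧ ∀ y ∈ T.comp (some v) w, β y = decide (y ∈ A'.mems) := by
  have hne : ∀ w' ∈ K, w' ≠ w := by
    rintro w' hw' rfl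
    exact (List.nodup_append.1 hnd).2.2 _ hw' _ (by simp) rfl
  have hdis : ∀ w' ∈ K, ∀ y ∈ T.comp (some v) w', y ∉ T.comp (some v) w := fun w' hw' y hy hy' =>
    Finset.disjoint_left.1 (disjoint_comp (hadj w' (by simp [hw'])) (hadj w (by simp))
      (hne w' hw')) hy hy'
  constructor
  · intro w' hw' y hy
    have h₁ : y ∉ A'.mems := fun hy' => hdis w' hw' y hy (hA' y hy')
    rw [h w' (by simp [hw']) y hy]
    simp [NodeSet.mems, h₁]
  · intro y hy
    have h₁ : y ∉ A.mems := fun hy' => by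
      obtain ⟨w', hw', hy''⟩ := hA y hy'
      exact hdis w' hw' y hy'' hy
    rw [h w (by simp) y hy]
    simp [NodeSet.mems, h₁]

theorem forestGain_append (v w : V) (K : List V) (β : V → Bool) :
    forestGain T S v (K ++ [w]) β = forestGain T S v K β + ∑ y ∈ T.comp (some v) w, gain T S β y := by
  simp [forestGain]

theorem adj_nodup_of_perm {u : Option V} {v : V} {K : List V} (h : (T.kids u v).Perm K) :
    (∀ w ∈ K, T.G.Adj v w) ∧ K.Nodup :=
  ⟨fun _ hw => (mem_kids.1 (h.mem_iff.2 hw)).1, h.nodup_iff.1 (kids_nodup u v)⟩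

/-- The final step at a non-seed, whatever the number of its children: the own term of `v` is
evaluated at underestimates of its two arguments, so by `orR_mono` it is at most the true gain of
`v`. -/
theorem entrySound_of_forest (hγ : γ.Proper) {u : Option V} {v : V} (hu : T.IsDir u v)
    (hv : v ∉ S) {K : List V} (hK : (T.kids u v).Perm K) {b : Bool} {κ c f : ℕ} {x : ℝ}
    {A : NodeSet V} (hA : ForestSet T v K b.toNat κ A)
    (h : ∀ β : V → Bool, β v = b → Agrees T v K β A → γ.pt c ≤ T.orL S (T.bprob β) v K ∧
      (γ.pt f * parentProb T b u v ≤ T.orL S (T.bprob β) v u.toList → x ≤ forestGain T S v K β)) :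
    EntrySound T S γ u v (κ, c, f)
      (x + nodeGain (γ.pt c) (γ.pt f) (parentProb T b u v) (baseline T S v))
      (.union A (singleIf b v)) := by
  have hvA : v ∉ A.mems := fun hmem => by
    obtain ⟨w, -, hw'⟩ := hA.mem v hmem
    exact not_mem_comp_kid _ _ hw'
  refine ⟨fun y hy => ?_, ?_, ?_, fun β hβ => ?_⟩
  · rw [NodeSet.mems, List.mem_append, singleIf_mems] at hy
    rcases hy with hy | hy
    · obtain ⟨w, hw, hyw⟩ := hA.mem y hy
      exact comp_kid_subset hu (hK.mem_iff.2 hw) hyw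
    · cases b <;> simp at hy
      exact hy.symm ▸ self_mem_comp hu
  · have := hA.len
    rw [NodeSet.mems, List.length_append, singleIf_mems]
    cases b <;> simpa using this
  -- The forest bound is `4 Σ + 1`. The new union and the singleton make it `4 Σ + 3`, one less than
  -- four times the component with `v` included.
  · have := hA.size
    rw [NodeSet.size, singleIf_size, card_comp_eq hu hK]
    omega
  · have hb : β v = b := by
      rw [hβ v (self_mem_comp hu), NodeSet.mems, singleIf_mems]
      cases b <;> simp [hvA]
    have hagr : Agrees T v K β A := by
      intro w hw y hy
      have hyv : y ≠ v := by
        rintro rfl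
        exact not_mem_comp_kid _ _ hy
      rw [hβ y (comp_kid_subset hu (hK.mem_iff.2 hw) hy), NodeSet.mems, singleIf_mems]
      cases b <;> simp [hyv]
    obtain ⟨h₁, h₂⟩ := h β hb hagr
    have hq := T.isProb_bprob β
    have h₃ : T.infl S (T.bprob β) u v = T.orL S (T.bprob β) v K := by
      rw [infl_of_notMem hq hu hv, orL_perm hK]
    refine ⟨h₃ ▸ h₁, fun hf => ?_⟩
    have hpp := parentProb_mem (T := T) b hu
    have h₄ : γ.pt f * parentProb T b u v ≤ above T S β u v * parentProb T b u v :=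
      mul_le_mul_of_nonneg_right hf hpp.1
    have h₅ := above_mul_parentProb (T := T) (S := S) β u v
    rw [hb] at h₅
    rw [sum_gain_eq β hu hK, add_comm]
    refine add_le_add ?_ (h₂ (h₅ ▸ h₄))
    rw [nodeGain, gain, infl_none_eq_orR β hu, hb]
    refine max_le_max (sub_le_sub_right (orR_mono (h₃ ▸ h₁) h₄ (infl_mem hq hu).2 ?_) _) le_rfl
    exact mul_le_one₀ (hγ.pt_mem f).2 hpp.1 hpp.2

theorem leaf_entrySound (hγ : γ.Proper) {u : Option V} {v : V} (hu : T.IsDir u v)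
    (hk : T.kids u v = []) :
    AllEntries (EntrySound T S γ u v) (leaf T S k γ (baseline T S v) u v).val := by
  have hcomp : T.comp u v = {v} := by rw [comp_eq hu, hk]; simp
  refine leaf_sound fun κ _ f _ => ?_
  set b := decide (0 < κ) with hb
  refine ⟨fun y hy => ?_, ?_, ?_, fun β hβ => ?_⟩
  · rw [singleIf_mems] at hy
    rw [hcomp, Finset.mem_singleton]
    revert hy
    cases b <;> simp
  · rw [singleIf_mems]
    by_cases h : 0 < κ
    · simp only [hb, h]
      exact h
    · simp [hb, h]
  · rw [singleIf_size, hcomp]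
    simp
  · have hβv : β v = b := by
      rw [hβ v (self_mem_comp hu), singleIf_mems]
      cases b <;> simp
    have hq := T.isProb_bprob β
    have hc : γ.pt (if v ∈ S then γ.top else 0) = T.infl S (T.bprob β) u v := by
      rw [infl_eq hq hu, hk, orL_nil]
      split_ifs
      exacts [hγ.pt_top, Grid.pt_zero]
    refine ⟨hc.le, fun hf => ?_⟩
    have hpp := parentProb_mem (T := T) b hu
    rw [hcomp, Finset.sum_singleton, nodeGain, gain, infl_none_eq_orR β hu, hβv, hc]
    refine max_le_max (sub_le_sub_right (orR_mono le_rfl (mul_le_mul_of_nonneg_right hf hpp.1)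
      (infl_mem hq hu).2 ?_) _) le_rfl
    exact mul_le_one₀ (hγ.pt_mem f).2 hpp.1 hpp.2

/-- A seed is active with certainty, so the subtrees below it decouple, and `f = 1` is the exact
value for each child. -/
theorem seedTable_forestSound (hγ : γ.Proper) {v : V} (hv : v ∈ S) {L : List (V × Table V)}
    {K : List V} {h : ℕ → Entry V} (hadj : ∀ w ∈ K ++ L.map Prod.fst, T.G.Adj v w)
    (hnd : (K ++ L.map Prod.fst).Nodup)
    (hL : ∀ kid ∈ L, AllEntries (EntrySound T S γ (some v) kid.1) kid.2)
    (hh : AllEntries (fun κ x A => ForestSet T v K 0 κ A ∧ ∀ β, Agrees T v K β A →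
      x ≤ forestGain T S v K β) h) :
    AllEntries (fun κ x A => ForestSet T v (K ++ L.map Prod.fst) 0 κ A ∧ ∀ β,
      Agrees T v (K ++ L.map Prod.fst) β A → x ≤ forestGain T S v (K ++ L.map Prod.fst) β)
      (seedTable k γ L h) := by
  induction L generalizing K h with
  | nil => simpa [seedTable] using hh
  | cons kid L ih =>
    have hsplit : K ++ (kid :: L).map Prod.fst = (K ++ [kid.1]) ++ L.map Prod.fst := by simp
    rw [hsplit] at hadj hnd ⊢
    rw [seedTable, forList_cons_val]
    refine ih hadj hnd (fun kid' hk' => hL kid' (by simp [hk'])) ?_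
    refine seedStep_sound fun κi j c _ _ x₁ A₁ x₂ A₂ h₁ h₂ => ?_
    obtain ⟨hF, hx₁⟩ := hh _ _ _ h₁
    have hE := hL kid (by simp) _ _ _ h₂
    rw [Nat.add_comm κi j]
    refine ⟨hF.append hE, fun β hβ => ?_⟩
    obtain ⟨ha₁, ha₂⟩ := Agrees.union (fun w hw => hadj w (List.mem_append_left _ hw))
      (List.nodup_append.1 hnd).1 hF.mem hE.1 hβ
    rw [forestGain_append]
    refine add_le_add (hx₁ β ha₁) ((hE.2.2.2 β ha₂).2 ?_)
    have hw := hadj kid.1 (by simp)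
    rw [above, infl_seed (T.isProb_bprob β) (T.isDir_some hw.symm) hv]
    exact (hγ.pt_mem _).2

theorem internalSeed_entrySound (hγ : γ.Proper) {u : Option V} {v : V} (hu : T.IsDir u v)
    (hv : v ∈ S) {L : List (V × Table V)} (hp : (T.kids u v).Perm (L.map Prod.fst))
    (hL : ∀ kid ∈ L, AllEntries (EntrySound T S γ (some v) kid.1) kid.2) :
    AllEntries (EntrySound T S γ u v) (internalSeed k γ L).val := by
  refine internalSeed_sound fun κ _ f _ x A hx => ?_
  obtain ⟨hadj, hnd⟩ := adj_nodup_of_perm hp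
  -- The value zero is present for every budget, not only for zero; thus an internal seed may leave
  -- budget unspent.
  have h₀ : AllEntries (fun κ x A => ForestSet T v [] 0 κ A ∧ ∀ β, Agrees T v [] β A →
      x ≤ forestGain T S v [] β) (fun _ : ℕ => (some (0, .empty) : Entry V)) := by
    intro κ x A h
    cases h
    exact ⟨⟨by simp [NodeSet.mems], by simp [NodeSet.mems], by simp [NodeSet.size]⟩,
      fun β _ => by simp [forestGain]⟩
  obtain ⟨hF, hg⟩ := seedTable_forestSound (K := []) hγ hv (by simpa using hadj)
    (by simpa using hnd) hL h₀ _ _ _ hx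
  rw [List.nil_append] at hF hg
  refine ⟨fun y hy => ?_, hF.len, ?_, fun β hβ => ⟨?_, fun _ => ?_⟩⟩
  · obtain ⟨w, hw, hyw⟩ := hF.mem y hy
    exact comp_kid_subset hu (hp.mem_iff.2 hw) hyw
  · have := hF.size
    rw [card_comp_eq hu hp]
    omega
  · rw [infl_seed (T.isProb_bprob β) hu hv]
    exact (hγ.pt_mem _).2
  · rw [sum_gain_eq β hu hp]
    have h₁ := hg β fun w hw y hy => hβ y (comp_kid_subset hu (hp.mem_iff.2 hw) hy)
    have h₂ := gain_nonneg (T := T) (S := S) β v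
    linarith

theorem nonseedWithChild_entrySound (hγ : γ.Proper) {u : Option V} {v w : V} (hu : T.IsDir u v)
    (hv : v ∉ S) (hp : T.kids u v = [w]) {g : Table V}
    (hg : AllEntries (EntrySound T S γ (some v) w) g) :
    AllEntries (EntrySound T S γ u v)
      (nonseedWithChild T k γ (baseline T S v) u v w g).val := by
  have hw : T.G.Adj v w := (mem_kids.1 (by rw [hp]; simp : w ∈ T.kids u v)).1
  refine nonseedWithChild_sound fun b κ₁ c₁ f _ _ _ x₁ A₁ h₁ => ?_
  have hE := hg _ _ _ h₁
  refine entrySound_of_forest hγ hu hv (hp ▸ List.Perm.refl _) (forestSet_singleton hE)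
    fun β hβ hagr => ?_
  obtain ⟨hc, hx⟩ := hE.2.2.2 β (hagr w (by simp))
  have hprob := T.prob_mem b hw.symm
  have hpt := hγ.pt_mem c₁
  constructor
  · refine (hγ.pt_idx_le (mul_nonneg hpt.1 hprob.1)).trans ?_
    rw [orL_singleton, bprob, hβ]
    exact mul_le_mul_of_nonneg_right hc hprob.1
  · intro hf
    rw [forestGain]
    simp only [List.map_cons, List.map_nil, List.sum_cons, List.sum_nil, add_zero]
    refine hx ?_
    rw [infl_kid_eq (K := []) (R := []) β hu hv (hp ▸ List.Perm.refl _)]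
    exact (hγ.pt_idx_le (mul_nonneg (hγ.pt_mem f).1 (parentProb_mem b hu).1)).trans hf

variable (T S) in
/-- The conditions on the entry `(x, A)` with index `i` of the helper table of `v` for the children
in `K`, if the children in `R` are still untreated. -/
def HelperSound (u : Option V) (v : V) (b last : Bool) (γ' : Grid) (K R : List V)
    (i : ℕ × ℕ × ℕ) (x : ℝ) (A : NodeSet V) : Prop :=
  ForestSet T v K b.toNat i.1 A ∧ ∀ β : V → Bool, β v = b → Agrees T v K β A →
    γ'.pt i.2.1 ≤ T.orL S (T.bprob β) v K ∧
    (zval T b last γ' u v i.2.2 ≤ T.orL S (T.bprob β) v (R ++ u.toList) →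
      x ≤ forestGain T S v K β)

theorem orR_mul_mono {v w : V} (hw : T.G.Adj v w) {β : V → Bool} {b : Bool} (hβ : β v = b)
    {K : List V} (hK : ∀ w ∈ K, T.G.Adj v w) {x c : ℝ} (hx : x ≤ T.orL S (T.bprob β) v K)
    (hc₁ : c ≤ 1) (hc : c ≤ T.infl S (T.bprob β) (some v) w) :
    orR x (c * T.prob b w v) ≤ T.orL S (T.bprob β) v (K ++ [w]) := by
  have hprob := T.prob_mem b hw.symm
  rw [orL_append, orL_singleton, bprob, hβ]
  exact orR_mono hx (mul_le_mul_of_nonneg_right hc hprob.1)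
    (orL_mem (T.isProb_bprob β) hK).2 (mul_le_one₀ hc₁ hprob.1 hprob.2)

theorem orR_mul_mono' {v w : V} (hw : T.G.Adj v w) {β : V → Bool} {b : Bool} (hβ : β v = b)
    {R : List V} {y c : ℝ} (hy : y ≤ T.orL S (T.bprob β) v R)
    (hy₁ : y ≤ 1) (hc : c ≤ T.infl S (T.bprob β) (some v) w) :
    orR (c * T.prob b w v) y ≤ T.orL S (T.bprob β) v (w :: R) := by
  have hprob := T.prob_mem b hw.symm
  rw [orL_cons, bprob, hβ]
  refine orR_mono (mul_le_mul_of_nonneg_right hc hprob.1) hy ?_ hy₁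
  have := (infl_mul_mem (S := S) (T.isProb_bprob β) hw).2
  rwa [bprob, hβ] at this

theorem orR_orL_mono {v : V} {β : V → Bool} {K R : List V} (hK : ∀ w ∈ K, T.G.Adj v w)
    {x y : ℝ} (hx : x ≤ T.orL S (T.bprob β) v K) (hy : y ≤ T.orL S (T.bprob β) v R)
    (hy₁ : y ≤ 1) : orR x y ≤ T.orL S (T.bprob β) v (K ++ R) := by
  rw [orL_append]
  exact orR_mono hx hy (orL_mem (T.isProb_bprob β) hK).2 hy₁

theorem pt_mul_prob_mem (hγ : γ.Proper) (c : ℕ) (b : Bool) {v w : V} (hw : T.G.Adj v w) :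
    0 ≤ γ.pt c * T.prob b w v ∧ γ.pt c * T.prob b w v ≤ 1 := by
  have hprob := T.prob_mem b hw.symm
  have hpt := hγ.pt_mem c
  exact ⟨mul_nonneg hpt.1 hprob.1, mul_le_one₀ hpt.2 hprob.1 hprob.2⟩

/-- Each of the first two children sees the other one and everything behind both, which is
summarized by `z`. All these summaries are rounded down, so both premises on `f` hold. -/
theorem helperStart_helperSound (hγ : γ.Proper) {γ₂ : Grid} (hγ₂ : γ₂.Proper) {u : Option V}
    {v w₁ w₂ : V} {R : List V} (hu : T.IsDir u v) (hv : v ∉ S)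
    (hp : (T.kids u v).Perm (w₁ :: w₂ :: R)) {g₁ g₂ : Table V} (b last : Bool)
    (hg₁ : AllEntries (EntrySound T S γ (some v) w₁) g₁)
    (hg₂ : AllEntries (EntrySound T S γ (some v) w₂) g₂) :
    AllEntries (HelperSound T S u v b last γ₂ [w₁, w₂] R)
      (helperStart T k γ b last γ₂ u v w₁ w₂ g₁ g₂).val := by
  obtain ⟨hadj, hnd⟩ := adj_nodup_of_perm hp
  have hw₁ := hadj w₁ (by simp)
  have hw₂ := hadj w₂ (by simp)
  refine helperStart_sound fun c₁ c₂ z κ₁ κ₂ _ _ _ _ x₁ A₁ x₂ A₂ h₁ h₂ => ?_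
  have hE₁ := hg₁ _ _ _ h₁
  have hE₂ := hg₂ _ _ _ h₂
  have hF := forestSet_singleton (m := b.toNat) hE₁
  have hF' := hF.append hE₂
  rw [Nat.add_right_comm] at hF'
  refine ⟨hF', fun β hβ hagr => ?_⟩
  have hsub : ∀ w ∈ [w₁] ++ [w₂], T.G.Adj v w := fun w hw => hadj w (by
    simp only [List.cons_append, List.nil_append, List.mem_cons, List.not_mem_nil, or_false] at hw ⊢
    tauto)
  have hnd' : ([w₁] ++ [w₂]).Nodup :=
    hnd.sublist (by simp)
  obtain ⟨ha₁, ha₂⟩ := Agrees.union (K := [w₁]) hsub hnd' hF.mem hE₂.1 hagr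
  obtain ⟨hc₁, hx₁⟩ := hE₁.2.2.2 β (ha₁ w₁ (by simp))
  obtain ⟨hc₂, hx₂⟩ := hE₂.2.2.2 β ha₂
  have hm₁ := pt_mul_prob_mem hγ c₁ b hw₁
  have hm₂ := pt_mul_prob_mem hγ c₂ b hw₂
  have hz := zval_mem hγ₂ b last hu z
  have hb₁ : γ.pt c₁ * T.prob b w₁ v ≤ T.orL S (T.bprob β) v [w₁] := by
    rw [orL_singleton, bprob, hβ]
    exact mul_le_mul_of_nonneg_right hc₁ (T.prob_mem b hw₁.symm).1
  constructor
  · exact (hγ₂.pt_idx_le (orR_mem hm₁ hm₂).1).trans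
      (orR_mul_mono (K := [w₁]) hw₂ hβ (by simpa using hw₁) hb₁ (hγ.pt_mem _).2 hc₂)
  · intro hzR
    have hgain : forestGain T S v [w₁, w₂] β = (∑ y ∈ T.comp (some v) w₁, gain T S β y) +
        ∑ y ∈ T.comp (some v) w₂, gain T S β y := by simp [forestGain]
    rw [hgain]
    refine add_le_add (hx₁ ?_) (hx₂ ?_)
    · rw [infl_kid_eq (K := []) β hu hv hp]
      exact (hγ.pt_idx_le (orR_mem hm₂ hz).1).trans (orR_mul_mono' hw₂ hβ hzR hz.2 hc₂)
    · rw [infl_kid_eq (K := [w₁]) β hu hv hp]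
      exact (hγ.pt_idx_le (orR_mem hm₁ hz).1).trans
        (orR_orL_mono (by simpa using hw₁) hb₁ hzR hz.2)

/-- The index `x` summarizes what precedes `w`. The old table is read at the rounded combination of
`w` with what follows it, an underestimate of the influence of `w :: R` and the parent. So the
conditional bound of the old entry applies. -/
theorem helperStep_helperSound (hγ : γ.Proper) {γf γi : Grid} (hγf : γf.Proper) (hγi : γi.Proper)
    {u : Option V} {v w : V} {K R : List V} (hu : T.IsDir u v) (hv : v ∉ S)
    (hp : (T.kids u v).Perm (K ++ w :: R)) {g gi : Table V} (b last : Bool)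
    (hg : AllEntries (HelperSound T S u v b false γf K (w :: R)) g)
    (hgi : AllEntries (EntrySound T S γ (some v) w) gi) :
    AllEntries (HelperSound T S u v b last γi (K ++ [w]) R)
      (helperStep T k γ b last γf γi u v w g gi).val := by
  obtain ⟨hadj, hnd⟩ := adj_nodup_of_perm hp
  have hw := hadj w (by simp)
  have hKadj : ∀ w' ∈ K, T.G.Adj v w' := fun w' hw' => hadj w' (by simp [hw'])
  have hsplit : K ++ w :: R = (K ++ [w]) ++ R := by simp
  refine helperStep_sound fun x c z κ κi _ _ _ _ x₁ A₁ x₂ A₂ h₁ h₂ => ?_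
  obtain ⟨hF, hx₁⟩ := hg _ _ _ h₁
  have hE := hgi _ _ _ h₂
  refine ⟨hF.append hE, fun β hβ hagr => ?_⟩
  obtain ⟨ha₁, ha₂⟩ := Agrees.union (fun w' hw' => hadj w' (by
    rw [hsplit]; exact List.mem_append_left _ hw')) (by
    rw [hsplit] at hnd; exact (List.nodup_append.1 hnd).1) hF.mem hE.1 hagr
  obtain ⟨hX, hx₁⟩ := hx₁ β hβ ha₁
  obtain ⟨hc, hx₂⟩ := hE.2.2.2 β ha₂
  have hm := pt_mul_prob_mem hγ c b hw
  have hz := zval_mem hγi b last hu z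
  have hpx := hγf.pt_mem x
  constructor
  · exact (hγi.pt_idx_le (orR_mem hpx hm).1).trans (orR_mul_mono hw hβ hKadj hX (hγ.pt_mem _).2 hc)
  · intro hzR
    rw [forestGain_append]
    refine add_le_add (hx₁ ?_) (hx₂ ?_)
    · exact (hγf.pt_idx_le (orR_mem hm hz).1).trans (orR_mul_mono' hw hβ hzR hz.2 hc)
    · rw [infl_kid_eq β hu hv hp]
      exact (hγ.pt_idx_le (orR_mem hpx hz).1).trans (orR_orL_mono hKadj hX hzR hz.2)

theorem helperSteps_helperSound (hγ : γ.Proper) {γf : Grid} {u : Option V} {v : V}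
    (hu : T.IsDir u v) (hv : v ∉ S) (b : Bool) {rest : List (V × Table V)} {K : List V}
    (hγf : rest ≠ [] → γf.Proper) (hp : (T.kids u v).Perm (K ++ rest.map Prod.fst))
    (hL : ∀ kid ∈ rest, AllEntries (EntrySound T S γ (some v) kid.1) kid.2) {h : Table V}
    (hh : AllEntries (HelperSound T S u v b rest.isEmpty (stageGrid γ γf rest) K
      (rest.map Prod.fst)) h) :
    AllEntries (HelperSound T S u v b true γ (K ++ rest.map Prod.fst) [])
      (helperSteps T k γ b γf u v rest h).val := by
  induction rest generalizing K h with
  | nil => simpa [helperSteps, stageGrid] using hh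
  | cons kid rest ih =>
    have hf := hγf (by simp)
    have hsplit : K ++ (kid :: rest).map Prod.fst = (K ++ [kid.1]) ++ rest.map Prod.fst := by simp
    rw [helperSteps_cons_val, hsplit]
    refine ih (fun _ => hf) (hsplit ▸ hp) (fun kid' hk' => hL kid' (by simp [hk'])) ?_
    refine helperStep_helperSound hγ hf ?_ hu hv hp b _ hh (hL kid (by simp))
    rw [stageGrid]
    split_ifs
    exacts [hγ, hf]

/-- With exactly two children the fine mesh is `γ.mesh / 0 = 0` and its grid is not proper;
`stageGrid` then selects `γ`. -/
theorem fineGrid_proper (hγ : γ.Proper) {rest : List (V × Table V)} (h : rest ≠ []) :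
    (fineGrid γ rest).Proper := by
  refine Grid.mkGrid_proper (div_pos hγ.mesh_pos ?_)
  exact_mod_cast List.length_pos_iff.2 h

theorem stageGrid_proper (hγ : γ.Proper) (rest : List (V × Table V)) :
    (stageGrid γ (fineGrid γ rest) rest).Proper := by
  rw [stageGrid]
  split_ifs with h
  · exact hγ
  · exact fineGrid_proper hγ (by simpa using h)

theorem nonseedWithChildren_entrySound (hγ : γ.Proper) {u : Option V} {v : V}
    (hu : T.IsDir u v) (hv : v ∉ S) {kid₁ kid₂ : V × Table V} {rest : List (V × Table V)}
    (hp : (T.kids u v).Perm ((kid₁ :: kid₂ :: rest).map Prod.fst))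
    (hL : ∀ kid ∈ kid₁ :: kid₂ :: rest, AllEntries (EntrySound T S γ (some v) kid.1) kid.2) :
    AllEntries (EntrySound T S γ u v)
      (nonseedWithChildren T k γ (baseline T S v) u v kid₁ kid₂ rest).val := by
  refine nonseedWithChildren_sound fun b κ c f _ _ _ x A hx => ?_
  have h₁ := helperSteps_helperSound (k := k) (K := [kid₁.1, kid₂.1]) hγ hu hv b
    (fun h => fineGrid_proper hγ h) hp (fun kid hk => hL kid (by simp [hk]))
    (helperStart_helperSound (k := k) hγ (stageGrid_proper hγ rest) hu hv hp b rest.isEmpty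
      (hL kid₁ (by simp)) (hL kid₂ (by simp)))
  obtain ⟨hF, hx⟩ := h₁ _ _ _ hx
  exact entrySound_of_forest hγ hu hv hp hF fun β hβ hagr => hx β hβ hagr

theorem nodeTable_entrySound (hγ : γ.Proper) {u : Option V} {v : V} (hu : T.IsDir u v)
    {L : List (V × Table V)} (hp : (T.kids u v).Perm (L.map Prod.fst))
    (hL : ∀ kid ∈ L, AllEntries (EntrySound T S γ (some v) kid.1) kid.2) :
    AllEntries (EntrySound T S γ u v) (nodeTable S k T γ (baseline T S v) u v L) := by
  match L with
  | [] => exact leaf_entrySound hγ hu (List.perm_nil.1 hp)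
  | [kid] =>
    rw [nodeTable]
    split_ifs with hv
    · exact internalSeed_entrySound hγ hu hv hp hL
    · exact nonseedWithChild_entrySound hγ hu hv (List.perm_singleton.1 hp) (hL kid (by simp))
  | kid₁ :: kid₂ :: rest =>
    rw [nodeTable]
    split_ifs with hv
    · exact internalSeed_entrySound hγ hu hv hp hL
    · exact nonseedWithChildren_entrySound hγ hu hv hp hL

theorem solve_succ_eq (m : ℕ) (u : Option V) (v : V) :
    (solve T S k γ (Fintype.card V) (fun _ => false) (m + 1) u v).val =
      nodeTable S k T γ (baseline T S v) u v ((T.kids u v).reverse.map fun w =>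
        (w, (solve T S k γ (Fintype.card V) (fun _ => false) m (some v) w).val)) := by
  rw [solve_succ_val, activation_val]
  rfl

theorem solve_entrySound (hγ : γ.Proper) {m : ℕ} {u : Option V} {v : V} (hu : T.IsDir u v)
    (hm : (T.comp u v).card ≤ m) : AllEntries (EntrySound T S γ u v)
      (solve T S k γ (Fintype.card V) (fun _ => false) m u v).val := by
  induction m generalizing u v with
  | zero =>
    have := Finset.card_pos.2 ⟨v, self_mem_comp hu⟩
    omega
  | succ m ih =>
    rw [solve_succ_eq]
    refine nodeTable_entrySound hγ hu ?_ fun kid hkid => ?_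
    · rw [List.map_map]
      simp [Function.comp_def]
    · obtain ⟨w, hw, rfl⟩ := List.mem_map.1 hkid
      have hw := List.mem_reverse.1 hw
      have := card_comp_kid_lt hu hw
      refine ih (isDir_kid hw) ?_
      change (T.comp (some v) w).card ≤ m
      omega



open BidirectedTree

variable {V : Type} [DecidableEq V] [Fintype V] {T : BidirectedTree V} {S : Finset V} {k : ℕ}
  {γ : Grid} {β : V → Bool}

/-! ### Completeness: the entries are at least the rounded values of every feasible assignment -/

variable (T) in
/-- The weight of the rounding error of the activation probability of the parent of `v`. -/
noncomputable def errAbove (β : V → Bool) : Option V → V → ℝ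
  | none, _ => 0
  | some u, v => T.inSum (T.bprob β) (some v) u

variable (T S) in
/-- The gain of `y` minus the rounding error, for the mesh `δ`. -/
noncomputable def target (δ : ℝ) (β : V → Bool) (y : V) : ℝ :=
  gain T S β y - 2 * δ * T.inSum (T.bprob β) none y

variable (T S) in
/-- The total target of the nodes below the children in `K`. -/
noncomputable def forestTarget (δ : ℝ) (β : V → Bool) (v : V) (K : List V) : ℝ :=
  (K.map fun w => ∑ y ∈ T.comp (some v) w, target T S δ β y).sum

variable (T S γ β) in
/-- For some rounded value `c`, the entries of the table `g` of `v` for `κ`, `c` and the rounded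
values `f` are at least the total target. -/
def TableComplete (u : Option V) (v : V) (κ : ℕ) (g : Table V) : Prop :=
  ∃ c ≤ γ.top,
    T.infl S (T.bprob β) u v - γ.pt c ≤ 2 * γ.mesh * T.inSum (T.bprob β) u v ∧
    ∀ f ≤ γ.top, above T S β u v - γ.pt f ≤ 2 * γ.mesh * errAbove T β u v →
      AtLeast (g (κ, c, f)) (∑ y ∈ T.comp u v, target T S γ.mesh β y)

theorem errAbove_mul_parentProb (u : Option V) (v : V) :
    errAbove T β u v * parentProb T (β v) u v = T.inSumL (T.bprob β) v u.toList := by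
  cases u with
  | none => simp [errAbove]
  | some u => simp [inSumL, errAbove, parentProb, readParentProb, readProb, bprob]

theorem errAbove_nonneg (u : Option V) (v : V) : 0 ≤ errAbove T β u v := by
  cases u with
  | none => exact le_rfl
  | some u => exact inSum_nonneg (T.isProb_bprob β) _ _

/-- The summand `1` leaves room for an error of `2δ` from the roundings made at `v`; the rest is
what the other neighbours of `v` transmit. -/
theorem errAbove_kid_eq {u : Option V} {v w : V} {K R : List V} (hu : T.IsDir u v)
    (hp : (T.kids u v).Perm (K ++ w :: R)) :
    errAbove T β (some v) w = 1 + T.inSumL (T.bprob β) v (K ++ (R ++ u.toList)) := by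
  have hw : w ∈ T.kids u v := hp.mem_iff.2 (by simp)
  rw [errAbove, inSum_eq _ (T.isDir_some (mem_kids.1 hw).1.symm),
    inSumL_perm _ _ (kids_some_perm hu hp)]

theorem mul_parentProb_sub_le {u : Option V} {v : V} (hu : T.IsDir u v) {f δ : ℝ}
    (hf : above T S β u v - f ≤ 2 * δ * errAbove T β u v) :
    T.orL S (T.bprob β) v u.toList - f * parentProb T (β v) u v ≤
      2 * δ * T.inSumL (T.bprob β) v u.toList := by
  have := mul_le_mul_of_nonneg_right hf (parentProb_mem (T := T) (β v) hu).1
  rw [← above_mul_parentProb, ← errAbove_mul_parentProb]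
  linarith

theorem toList_adj {u : Option V} {v : V} (hu : T.IsDir u v) : ∀ w ∈ u.toList, T.G.Adj v w := by
  intro w hw
  exact (hu w (by simpa using hw)).symm

/-- The errors from below and from the parent side add to `2δ` times the sum of all path products
into `v`, which is exactly what `target` subtracts. -/
theorem target_le_nodeGain (hγ : γ.Proper) {u : Option V} {v : V} (hu : T.IsDir u v) {c f : ℕ}
    (hc : T.infl S (T.bprob β) u v - γ.pt c ≤ 2 * γ.mesh * T.inSum (T.bprob β) u v)
    (hf : above T S β u v - γ.pt f ≤ 2 * γ.mesh * errAbove T β u v) :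
    target T S γ.mesh β v ≤
      nodeGain (γ.pt c) (γ.pt f) (parentProb T (β v) u v) (baseline T S v) := by
  have hq := T.isProb_bprob β
  have hδ := hγ.mesh_pos
  have h₁ := mul_parentProb_sub_le hu hf
  have hadj := toList_adj hu
  have h₂ : 0 ≤ T.inSum (T.bprob β) u v := inSum_nonneg hq u v
  have h₃ := inSumL_nonneg hq hadj
  have h₄ := orR_sub_le hc h₁ (by positivity) (by positivity) (hγ.pt_mem c) (orL_mem hq hadj)
  rw [target, gain, nodeGain, infl_none_eq_orR β hu, above_mul_parentProb, inSum_none_eq _ hu]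
  have h₅ : 0 ≤ 2 * γ.mesh * (T.inSum (T.bprob β) u v + T.inSumL (T.bprob β) v u.toList) := by
    positivity
  rw [sub_le_iff_le_add]
  refine max_le ?_ (add_nonneg (le_max_right _ _) h₅)
  have := le_max_left (orR (γ.pt c) (γ.pt f * parentProb T (β v) u v) - baseline T S v) 0
  linarith

theorem sum_target_eq (δ : ℝ) {u : Option V} {v : V} {K : List V} (hu : T.IsDir u v)
    (hK : (T.kids u v).Perm K) : ∑ y ∈ T.comp u v, target T S δ β y =
      target T S δ β v + forestTarget T S δ β v K := by
  rw [sum_comp _ hu, forestTarget, (hK.map _).sum_eq]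

theorem leaf_tableComplete (hγ : γ.Proper) {u : Option V} {v : V} (hu : T.IsDir u v)
    (hk : T.kids u v = []) {κ : ℕ} (hκ : κ ≤ k) (hβ : β v = decide (0 < κ)) :
    TableComplete T S γ β u v κ (leaf T S k γ (baseline T S v) u v).val := by
  have hq := T.isProb_bprob β
  have hc : T.infl S (T.bprob β) u v - γ.pt (if v ∈ S then γ.top else 0) ≤
      2 * γ.mesh * T.inSum (T.bprob β) u v := by
    have h₁ : γ.pt (if v ∈ S then γ.top else 0) = T.infl S (T.bprob β) u v := by
      rw [infl_eq hq hu, hk, orL_nil]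
      split_ifs
      exacts [hγ.pt_top, Grid.pt_zero]
    rw [h₁, sub_self]
    exact mul_nonneg (mul_nonneg zero_le_two hγ.mesh_pos.le) (inSum_nonneg hq u v)
  refine ⟨_, ?_, hc, fun f hf hfe => ⟨_, _, leaf_complete hκ hf, ?_⟩⟩
  · split_ifs
    exacts [le_rfl, Nat.zero_le _]
  · have h := target_le_nodeGain hγ hu hc hfe
    rw [hβ] at h
    simpa [sum_comp _ hu, hk] using h

theorem forestTarget_cons (δ : ℝ) (v w : V) (K : List V) : forestTarget T S δ β v (w :: K) =
    (∑ y ∈ T.comp (some v) w, target T S δ β y) + forestTarget T S δ β v K := by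
  simp [forestTarget]

theorem forestTarget_append (δ : ℝ) (v w : V) (K : List V) :
    forestTarget T S δ β v (K ++ [w]) =
      forestTarget T S δ β v K + ∑ y ∈ T.comp (some v) w, target T S δ β y := by
  simp [forestTarget]

theorem seedTable_complete (hγ : γ.Proper) {v : V} (hv : v ∈ S) {L : List (V × Table V)}
    {κ' : V → ℕ} (hadj : ∀ kid ∈ L, T.G.Adj v kid.1)
    (hL : ∀ kid ∈ L, TableComplete T S γ β (some v) kid.1 (κ' kid.1) kid.2) {h : ℕ → Entry V}
    {j : ℕ} {x : ℝ} (hj : j + (L.map fun kid => κ' kid.1).sum ≤ k) (hh : AtLeast (h j) x) :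
    AtLeast (seedTable k γ L h (j + (L.map fun kid => κ' kid.1).sum))
      (x + forestTarget T S γ.mesh β v (L.map Prod.fst)) := by
  induction L generalizing h j x with
  | nil => simpa [seedTable, forestTarget] using hh
  | cons kid L ih =>
    rw [List.map_cons, List.sum_cons] at hj
    rw [seedTable, forList_cons_val, List.map_cons, List.map_cons, List.sum_cons,
      forestTarget_cons, ← add_assoc, ← add_assoc]
    refine ih (fun kid' hk' => hadj kid' (by simp [hk'])) (fun kid' hk' => hL kid' (by simp [hk']))
      (by omega) ?_
    obtain ⟨c, hc, -, hf⟩ := hL kid (by simp)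
    rw [Nat.add_comm]
    refine seedStep_complete (by omega) hc hh (hf γ.top le_rfl ?_)
    rw [hγ.pt_top, above,
      infl_seed (T.isProb_bprob β) (T.isDir_some (hadj kid (by simp)).symm) hv, sub_self]
    exact mul_nonneg (mul_nonneg zero_le_two hγ.mesh_pos.le) (errAbove_nonneg _ _)

theorem internalSeed_tableComplete (hγ : γ.Proper) {u : Option V} {v : V} (hu : T.IsDir u v)
    (hv : v ∈ S) {L : List (V × Table V)} (hp : (T.kids u v).Perm (L.map Prod.fst)) {κ' : V → ℕ}
    (hL : ∀ kid ∈ L, TableComplete T S γ β (some v) kid.1 (κ' kid.1) kid.2) {κ : ℕ} (hκ : κ ≤ k)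
    (hsum : ((T.kids u v).map κ').sum ≤ κ) :
    TableComplete T S γ β u v κ (internalSeed k γ L).val := by
  have hq := T.isProb_bprob β
  have hδ := hγ.mesh_pos
  refine ⟨γ.top, le_rfl, ?_, fun f hf _ => internalSeed_complete hκ hf ?_⟩
  · rw [infl_seed hq hu hv, hγ.pt_top, sub_self]
    exact mul_nonneg (mul_nonneg zero_le_two hδ.le) (inSum_nonneg hq u v)
  · have hs : (L.map fun kid => κ' kid.1).sum ≤ κ := by
      rw [(hp.map κ').sum_eq, List.map_map] at hsum
      exact hsum
    -- Starting at the unspent budget, where the initial table also holds zero, makes the final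
    -- index equal to `κ`.
    have h := seedTable_complete (k := k) hγ hv
      (fun kid hk => (adj_nodup_of_perm hp).1 _ (List.mem_map_of_mem hk)) hL
      (h := fun _ => some (0, .empty)) (j := κ - (L.map fun kid => κ' kid.1).sum) (x := 0)
      (by omega) ⟨0, _, rfl, le_rfl⟩
    rw [Nat.sub_add_cancel hs] at h
    refine h.mono ?_
    rw [sum_target_eq _ hu hp]
    -- The table entry of a seed contains no term for the seed itself, and its target is not
    -- positive: its gain is zero.
    refine add_le_add_left ?_ _
    rw [target, gain, baseline, infl_seed hq (T.isDir_none v) hv,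
      infl_seed (T.isProb_bprob _) (T.isDir_none v) hv, sub_self, max_self, zero_sub,
      neg_nonpos]
    exact mul_nonneg (mul_nonneg zero_le_two hδ.le) (inSum_nonneg hq none v)

theorem kid_mul_sub_le {v w : V} (hw : T.G.Adj v w) {c δ : ℝ}
    (hc : T.infl S (T.bprob β) (some v) w - c ≤ 2 * δ * T.inSum (T.bprob β) (some v) w) :
    T.orL S (T.bprob β) v [w] - c * T.prob (β v) w v ≤ 2 * δ * T.inSumL (T.bprob β) v [w] := by
  have := mul_le_mul_of_nonneg_right hc (T.prob_mem (β v) hw.symm).1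
  simp only [orL_singleton, inSumL_cons, inSumL_nil, bprob, add_zero]
  linarith

/-- Each value is rounded only once here, so an error of `δ` out of the allowed `2δ` suffices. -/
theorem nonseedWithChild_tableComplete (hγ : γ.Proper) {u : Option V} {v w : V}
    (hu : T.IsDir u v) (hv : v ∉ S) (hp : T.kids u v = [w]) {g : Table V} {κ₁ : ℕ}
    (hg : TableComplete T S γ β (some v) w κ₁ g) (hκ : κ₁ + (β v).toNat ≤ k) :
    TableComplete T S γ β u v (κ₁ + (β v).toNat)
      (nonseedWithChild T k γ (baseline T S v) u v w g).val := by
  have hq := T.isProb_bprob β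
  have hδ := hγ.mesh_pos
  have hw : T.G.Adj v w := (mem_kids.1 (by rw [hp]; simp : w ∈ T.kids u v)).1
  obtain ⟨c₁, hc₁, hc, hf⟩ := hg
  have h₁ := kid_mul_sub_le hw hc
  have hm := pt_mul_prob_mem (T := T) hγ c₁ (β v) hw
  have hc' : T.infl S (T.bprob β) u v - γ.pt (γ.idx (γ.pt c₁ * T.prob (β v) w v)) ≤
      2 * γ.mesh * T.inSum (T.bprob β) u v := by
    have h₂ := hγ.sub_mesh_le hm.2
    rw [infl_of_notMem hq hu hv, hp, inSum_eq _ hu, hp]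
    linarith
  refine ⟨_, hγ.idx_le_top _, hc', fun f hft hfe => ?_⟩
  have hpp := parentProb_mem (T := T) (β v) hu
  have hfm : γ.pt f * parentProb T (β v) u v ≤ 1 := mul_le_one₀ (hγ.pt_mem f).2 hpp.1 hpp.2
  refine (nonseedWithChild_complete hκ hc₁ hft (hf _ (hγ.idx_le_top _) ?_)).mono ?_
  · rw [infl_kid_eq (K := []) (R := []) β hu hv (hp ▸ List.Perm.refl _),
      errAbove_kid_eq (K := []) (R := []) hu (hp ▸ List.Perm.refl _)]
    simp only [List.nil_append]
    have h₃ := mul_parentProb_sub_le hu hfe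
    have h₄ := hγ.sub_mesh_le hfm
    linarith
  · rw [sum_target_eq _ hu (hp ▸ List.Perm.refl _ : (T.kids u v).Perm [w]), forestTarget_cons,
      add_comm]
    have h₅ := target_le_nodeGain hγ hu hc' hfe
    simp only [forestTarget, List.map_nil, List.sum_nil, add_zero]
    linarith

variable (T S γ β) in
/-- The analogue of `TableComplete` for the helper table `h` of `v` for the children in `K`, if the
children in `R` are still untreated; the intermediate roundings contribute `eX` and `eZ` to the
errors. -/
def HelperComplete (u : Option V) (v : V) (last : Bool) (γ' : Grid) (K R : List V) (κ : ℕ)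
    (eX eZ : ℝ) (h : Table V) : Prop :=
  ∃ x ≤ γ'.top,
    T.orL S (T.bprob β) v K - γ'.pt x ≤ 2 * γ.mesh * T.inSumL (T.bprob β) v K + eX ∧
    ∀ z ≤ γ'.top, T.orL S (T.bprob β) v (R ++ u.toList) - zval T (β v) last γ' u v z ≤
      2 * γ.mesh * T.inSumL (T.bprob β) v (R ++ u.toList) + eZ →
      AtLeast (h (κ, x, z)) (forestTarget T S γ.mesh β v K)

theorem HelperComplete.mono {u : Option V} {v : V} {last : Bool} {γ' : Grid} {K R : List V}
    {κ : ℕ} {eX eX' eZ : ℝ} {h : Table V} (hh : HelperComplete T S γ β u v last γ' K R κ eX eZ h)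
    (he : eX ≤ eX') : HelperComplete T S γ β u v last γ' K R κ eX' eZ h := by
  obtain ⟨x, hx, hX, hZ⟩ := hh
  exact ⟨x, hx, by linarith, hZ⟩

theorem orL_append_sub_le {v : V} {K R : List V} (hK : ∀ w ∈ K, T.G.Adj v w)
    (hR : ∀ w ∈ R, T.G.Adj v w) {x y δ eX eY : ℝ} (hδ : 0 ≤ δ) (heX : 0 ≤ eX) (heY : 0 ≤ eY)
    (hx : 0 ≤ x ∧ x ≤ 1)
    (hX : T.orL S (T.bprob β) v K - x ≤ 2 * δ * T.inSumL (T.bprob β) v K + eX)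
    (hY : T.orL S (T.bprob β) v R - y ≤ 2 * δ * T.inSumL (T.bprob β) v R + eY) :
    T.orL S (T.bprob β) v (K ++ R) - orR x y ≤
      2 * δ * T.inSumL (T.bprob β) v (K ++ R) + (eX + eY) := by
  have hq := T.isProb_bprob β
  have h₁ := inSumL_nonneg hq hK
  have h₂ := inSumL_nonneg hq hR
  have h₃ := orR_sub_le hX hY (by positivity) (by positivity) hx (orL_mem hq hR)
  rw [orL_append, inSumL_append]
  rw [orR] at h₃
  linarith

/-- The values `x_1` and `y_1` are not rounded, so `x` has been rounded once so far. The bound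
`heZ'` keeps the errors of `f_1` and `f_2` within `2δ` after their own rounding. -/
theorem helperStart_helperComplete (hγ : γ.Proper) {γ₂ : Grid} (hγ₂ : γ₂.Proper) {u : Option V}
    {v w₁ w₂ : V} {R : List V} (hu : T.IsDir u v) (hv : v ∉ S)
    (hp : (T.kids u v).Perm (w₁ :: w₂ :: R)) {g₁ g₂ : Table V} (last : Bool) {κ₁ κ₂ : ℕ}
    (hg₁ : TableComplete T S γ β (some v) w₁ κ₁ g₁)
    (hg₂ : TableComplete T S γ β (some v) w₂ κ₂ g₂) (hκ : κ₁ + κ₂ + (β v).toNat ≤ k) {eZ : ℝ}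
    (heZ : 0 ≤ eZ) (heZ' : eZ ≤ γ.mesh) :
    HelperComplete T S γ β u v last γ₂ [w₁, w₂] R (κ₁ + κ₂ + (β v).toNat) γ₂.mesh eZ
      (helperStart T k γ (β v) last γ₂ u v w₁ w₂ g₁ g₂).val := by
  have hδ := hγ.mesh_pos
  obtain ⟨hadj, -⟩ := adj_nodup_of_perm hp
  have hw₁ := hadj w₁ (by simp)
  have hw₂ := hadj w₂ (by simp)
  have hR : ∀ w ∈ R ++ u.toList, T.G.Adj v w := fun w hw =>
    (List.mem_append.1 hw).elim (fun h => hadj w (by simp [h])) (toList_adj hu w)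
  obtain ⟨c₁, hc₁, he₁, hf₁⟩ := hg₁
  obtain ⟨c₂, hc₂, he₂, hf₂⟩ := hg₂
  have hk₁ := kid_mul_sub_le hw₁ he₁
  have hk₂ := kid_mul_sub_le hw₂ he₂
  have hm₁ := pt_mul_prob_mem (T := T) hγ c₁ (β v) hw₁
  have hm₂ := pt_mul_prob_mem (T := T) hγ c₂ (β v) hw₂
  have ha₁ : ∀ w ∈ [w₁], T.G.Adj v w := by simpa using hw₁
  have ha₂ : ∀ w ∈ [w₂], T.G.Adj v w := by simpa using hw₂
  refine ⟨γ₂.idx (orR (γ.pt c₁ * T.prob (β v) w₁ v) (γ.pt c₂ * T.prob (β v) w₂ v)),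
    hγ₂.idx_le_top _, ?_, fun z hz hze => ?_⟩
  · have h₁ := orL_append_sub_le ha₁ ha₂ hδ.le le_rfl le_rfl hm₁ (hk₁.trans_eq (add_zero _).symm)
      (hk₂.trans_eq (add_zero _).symm)
    have h₂ := hγ₂.sub_mesh_le (orR_mem hm₁ hm₂).2
    rw [List.singleton_append] at h₁
    linarith
  · have hzm := zval_mem (T := T) hγ₂ (β v) last hu z
    have hgoal : forestTarget T S γ.mesh β v [w₁, w₂] =
        (∑ y ∈ T.comp (some v) w₁, target T S γ.mesh β y) +
          ∑ y ∈ T.comp (some v) w₂, target T S γ.mesh β y := by simp [forestTarget]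
    rw [hgoal]
    refine helperStart_complete hc₁ hc₂ hz hκ (hf₁ _ (hγ.idx_le_top _) ?_)
      (hf₂ _ (hγ.idx_le_top _) ?_)
    · rw [infl_kid_eq (K := []) β hu hv hp, errAbove_kid_eq (K := []) hu hp]
      have h₁ := orL_append_sub_le ha₂ hR hδ.le le_rfl heZ hm₂ (hk₂.trans_eq (add_zero _).symm) hze
      have h₂ := hγ.sub_mesh_le (orR_mem hm₂ hzm).2
      simp only [List.nil_append, List.cons_append] at h₁ ⊢
      linarith
    · rw [infl_kid_eq (K := [w₁]) β hu hv hp, errAbove_kid_eq (K := [w₁]) hu hp]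
      have h₁ := orL_append_sub_le ha₁ hR hδ.le le_rfl heZ hm₁ (hk₁.trans_eq (add_zero _).symm) hze
      have h₂ := hγ.sub_mesh_le (orR_mem hm₁ hzm).2
      linarith

/-- The value `f` of the new child combines the roundings of `x` before it with those of `y` after
it. By `he` these sum to at most `δ`, and rounding `f` itself costs another `δ`. -/
theorem helperStep_helperComplete (hγ : γ.Proper) {γf γi : Grid} (hγf : γf.Proper)
    (hγi : γi.Proper) {u : Option V} {v w : V} {K R : List V} (hu : T.IsDir u v) (hv : v ∉ S)
    (hp : (T.kids u v).Perm (K ++ w :: R)) {g gi : Table V} (last : Bool) {κ κi : ℕ}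
    {eX eZ : ℝ} (heX : 0 ≤ eX) (heZ : 0 ≤ eZ) (he : eX + eZ ≤ γ.mesh)
    (hg : HelperComplete T S γ β u v false γf K (w :: R) κ eX (eZ + γf.mesh) g)
    (hgi : TableComplete T S γ β (some v) w κi gi) (hκ : κ + κi ≤ k) :
    HelperComplete T S γ β u v last γi (K ++ [w]) R (κ + κi) (eX + γi.mesh) eZ
      (helperStep T k γ (β v) last γf γi u v w g gi).val := by
  have hδ := hγ.mesh_pos
  obtain ⟨hadj, -⟩ := adj_nodup_of_perm hp
  have hw := hadj w (by simp)
  have hK : ∀ w' ∈ K, T.G.Adj v w' := fun w' hw' => hadj w' (by simp [hw'])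
  have hR : ∀ w ∈ R ++ u.toList, T.G.Adj v w := fun w hw =>
    (List.mem_append.1 hw).elim (fun h => hadj w (by simp [h])) (toList_adj hu w)
  obtain ⟨x, hx, hX, hZ⟩ := hg
  obtain ⟨c, hc, hce, hf⟩ := hgi
  have hk := kid_mul_sub_le hw hce
  have hm := pt_mul_prob_mem (T := T) hγ c (β v) hw
  have ha : ∀ w' ∈ [w], T.G.Adj v w' := by simpa using hw
  have hxm := hγf.pt_mem x
  refine ⟨γi.idx (orR (γf.pt x) (γ.pt c * T.prob (β v) w v)), hγi.idx_le_top _, ?_,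
    fun z hz hze => ?_⟩
  · have h₁ := orL_append_sub_le hK ha hδ.le heX le_rfl hxm hX (hk.trans_eq (add_zero _).symm)
    have h₂ := hγi.sub_mesh_le (orR_mem hxm hm).2
    linarith
  · have hzm := zval_mem (T := T) hγi (β v) last hu z
    rw [forestTarget_append]
    refine helperStep_complete hx hc hz hκ (hZ _ (hγf.idx_le_top _) ?_)
      (hf _ (hγ.idx_le_top _) ?_)
    · have h₁ := orL_append_sub_le ha hR hδ.le le_rfl heZ hm (hk.trans_eq (add_zero _).symm) hze
      have h₂ := hγf.sub_mesh_le (orR_mem hm hzm).2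
      simp only [List.nil_append, List.cons_append] at h₁ ⊢
      simp only [zval, Bool.false_eq_true, if_false] at h₁ h₂ ⊢
      linarith
    · rw [infl_kid_eq β hu hv hp, errAbove_kid_eq hu hp]
      have h₁ := orL_append_sub_le hK hR hδ.le heX heZ hxm hX hze
      have h₂ := hγ.sub_mesh_le (orR_mem hxm hzm).2
      linarith

/-- The roundings of `x` already made and those of `y` still ahead balance: each step moves one fine
mesh from the second to the first. After the last child only errors of `x` remain, at most `δ` from
the fine grid and `δ` from the final rounding. -/
theorem helperSteps_helperComplete (hγ : γ.Proper) {γf : Grid} {u : Option V} {v : V}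
    (hu : T.IsDir u v) (hv : v ∉ S) {rest : List (V × Table V)} {K : List V} {κ' : V → ℕ}
    (hγf : rest ≠ [] → γf.Proper) (hp : (T.kids u v).Perm (K ++ rest.map Prod.fst))
    (hL : ∀ kid ∈ rest, TableComplete T S γ β (some v) kid.1 (κ' kid.1) kid.2) {h : Table V}
    {κ : ℕ} (hκ : κ + (rest.map fun kid => κ' kid.1).sum ≤ k) {eX : ℝ} (heX : 0 ≤ eX)
    (heX₁ : rest = [] → eX ≤ 2 * γ.mesh)
    (heX₂ : rest ≠ [] → eX + rest.length * γf.mesh ≤ γ.mesh + γf.mesh)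
    (hh : HelperComplete T S γ β u v rest.isEmpty (stageGrid γ γf rest) K (rest.map Prod.fst) κ eX
      (rest.length * γf.mesh) h) :
    HelperComplete T S γ β u v true γ (K ++ rest.map Prod.fst) []
      (κ + (rest.map fun kid => κ' kid.1).sum) (2 * γ.mesh) 0
      (helperSteps T k γ (β v) γf u v rest h).val := by
  induction rest generalizing K h κ eX with
  | nil =>
    have h₁ := hh.mono (heX₁ rfl)
    simpa [helperSteps, stageGrid] using h₁
  | cons kid rest ih =>
    have hf := hγf (by simp)
    have hδ := hγ.mesh_pos
    have hη := hf.mesh_pos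
    have h₂ := heX₂ (by simp)
    rw [List.length_cons, Nat.cast_succ, add_mul, one_mul] at h₂ hh
    rw [List.map_cons, List.sum_cons, ← Nat.add_assoc] at hκ
    have hsplit : K ++ (kid :: rest).map Prod.fst = (K ++ [kid.1]) ++ rest.map Prod.fst := by simp
    have hlen : (0 : ℝ) ≤ rest.length * γf.mesh := by positivity
    have hγi : (stageGrid γ γf rest).Proper := by
      rw [stageGrid]
      split_ifs
      exacts [hγ, hf]
    have hstep := helperStep_helperComplete (k := k) hγ hf hγi hu hv hp rest.isEmpty heX hlen
      (by linarith) hh (hL kid (by simp)) (by omega)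
    rw [helperSteps_cons_val, hsplit, List.map_cons, List.sum_cons, ← Nat.add_assoc]
    refine ih (fun _ => hf) (hsplit ▸ hp) (fun kid' hk' => hL kid' (by simp [hk'])) hκ
      (add_nonneg heX hγi.mesh_pos.le) ?_ ?_ hstep
    · rintro rfl
      simp only [stageGrid, List.isEmpty_nil, if_true]
      linarith
    · intro hne
      have hem : rest.isEmpty = false := by simpa using hne
      simp only [stageGrid, hem, Bool.false_eq_true, if_false]
      linarith

theorem nonseedWithChildren_tableComplete (hγ : γ.Proper) {u : Option V} {v : V}
    (hu : T.IsDir u v) (hv : v ∉ S) {kid₁ kid₂ : V × Table V} {rest : List (V × Table V)}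
    (hp : (T.kids u v).Perm ((kid₁ :: kid₂ :: rest).map Prod.fst)) {κ' : V → ℕ}
    (hL : ∀ kid ∈ kid₁ :: kid₂ :: rest,
      TableComplete T S γ β (some v) kid.1 (κ' kid.1) kid.2)
    (hκ : ((T.kids u v).map κ').sum + (β v).toNat ≤ k) :
    TableComplete T S γ β u v (((T.kids u v).map κ').sum + (β v).toNat)
      (nonseedWithChildren T k γ (baseline T S v) u v kid₁ kid₂ rest).val := by
  have hδ := hγ.mesh_pos
  have hsum : ((T.kids u v).map κ').sum + (β v).toNat =
      (κ' kid₁.1 + κ' kid₂.1 + (β v).toNat) + (rest.map fun kid => κ' kid.1).sum := by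
    rw [(hp.map κ').sum_eq]
    simp only [List.map_cons, List.sum_cons, List.map_map, Function.comp_def]
    omega
  rw [hsum] at hκ ⊢
  have hmesh : rest ≠ [] → rest.length * (fineGrid γ rest).mesh = γ.mesh := by
    intro hne
    have : (rest.length : ℝ) ≠ 0 := by
      exact_mod_cast (List.length_pos_iff.2 hne).ne'
    change (rest.length : ℝ) * (γ.mesh / rest.length) = γ.mesh
    field_simp
  -- Without a third child there are no intermediate roundings, and the product is zero.
  have hle : 0 ≤ rest.length * (fineGrid γ rest).mesh ∧
      rest.length * (fineGrid γ rest).mesh ≤ γ.mesh := by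
    by_cases hne : rest = []
    · subst hne
      simpa using hδ.le
    · rw [hmesh hne]
      exact ⟨hδ.le, le_rfl⟩
  have h := helperSteps_helperComplete (k := k) (κ' := κ') (K := [kid₁.1, kid₂.1]) hγ hu hv
    (fun h => fineGrid_proper hγ h) hp (fun kid hk => hL kid (by simp [hk])) hκ
    (stageGrid_proper hγ rest).mesh_pos.le ?_ ?_
    (helperStart_helperComplete (k := k) hγ (stageGrid_proper hγ rest) hu hv hp rest.isEmpty
      (hL kid₁ (by simp)) (hL kid₂ (by simp)) (by omega) hle.1 hle.2)
  · obtain ⟨x, hx, hX, hZ⟩ := h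
    have hc : T.infl S (T.bprob β) u v - γ.pt x ≤ 2 * γ.mesh * T.inSum (T.bprob β) u v := by
      rw [infl_of_notMem (T.isProb_bprob β) hu hv, inSum_eq _ hu, orL_perm hp, inSumL_perm _ _ hp]
      have : (kid₁ :: kid₂ :: rest).map Prod.fst = [kid₁.1, kid₂.1] ++ rest.map Prod.fst := rfl
      rw [this]
      linarith
    refine ⟨x, hx, hc, fun f hf hfe => ?_⟩
    refine (nonseedWithChildren_complete hκ hx hf (hZ f hf ?_)).mono ?_
    · have h₃ := mul_parentProb_sub_le hu hfe
      simp only [List.nil_append, zval, if_true, add_zero]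
      exact h₃
    · rw [sum_target_eq _ hu hp, add_comm]
      exact add_le_add le_rfl (target_le_nodeGain hγ hu hc hfe)
  · rintro rfl
    simp only [stageGrid, List.isEmpty_nil, if_true]
    linarith
  · intro hne
    have hem : rest.isEmpty = false := by simpa using hne
    have := hmesh hne
    simp only [stageGrid, hem, Bool.false_eq_true, if_false]
    linarith

/-! ### Feasible assignments -/

variable (T S) in
/-- The nodes marked in `β` in the component of `v` are an admissible choice for the table entries
with `κ` nodes to boost. -/
inductive Feasible (β : V → Bool) : Option V → V → ℕ → Prop
  | leaf {u : Option V} {v : V} {κ : ℕ} : T.kids u v = [] → β v = decide (0 < κ) → Feasible β u v κ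
  | seed {u : Option V} {v : V} {κ : ℕ} (κ' : V → ℕ) : v ∈ S → T.kids u v ≠ [] →
      (∀ w ∈ T.kids u v, Feasible β (some v) w (κ' w)) → ((T.kids u v).map κ').sum ≤ κ →
      Feasible β u v κ
  | nonseed {u : Option V} {v : V} {κ : ℕ} (κ' : V → ℕ) : v ∉ S → T.kids u v ≠ [] →
      (∀ w ∈ T.kids u v, Feasible β (some v) w (κ' w)) →
      ((T.kids u v).map κ').sum + (β v).toNat = κ → Feasible β u v κ

theorem Feasible.congr {β β' : V → Bool} {u : Option V} {v : V} {κ : ℕ}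
    (h : Feasible T S β u v κ) (hu : T.IsDir u v) (hβ : ∀ y ∈ T.comp u v, β y = β' y) :
    Feasible T S β' u v κ := by
  induction h with
  | leaf hk hv => exact .leaf hk (by rw [← hβ _ (self_mem_comp hu), hv])
  | seed κ' hv hne _ hsum ih =>
    exact .seed κ' hv hne (fun w hw => ih w hw (isDir_kid hw) fun y hy =>
      hβ y (comp_kid_subset hu hw hy)) hsum
  | nonseed κ' hv hne _ hsum ih =>
    exact .nonseed κ' hv hne (fun w hw => ih w hw (isDir_kid hw) fun y hy =>
      hβ y (comp_kid_subset hu hw hy)) (by rw [← hβ _ (self_mem_comp hu), hsum])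

theorem solve_tableComplete (hγ : γ.Proper) {u : Option V} {v : V} {κ : ℕ}
    (h : Feasible T S β u v κ) (hu : T.IsDir u v) (hκ : κ ≤ k) {m : ℕ}
    (hm : (T.comp u v).card ≤ m) : TableComplete T S γ β u v κ
      (solve T S k γ (Fintype.card V) (fun _ => false) m u v).val := by
  have hkids : ∀ (u : Option V) (v : V) (m : ℕ), (T.kids u v).Perm
      (((T.kids u v).reverse.map fun w => (w, (solve T S k γ (Fintype.card V) (fun _ => false) m
        (some v) w).val)).map Prod.fst) := by
    intro u v m
    rw [List.map_map]
    simp [Function.comp_def, (T.kids u v).reverse_perm.symm]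
  have hle : ∀ {u : Option V} {v w : V} {κ' : V → ℕ}, w ∈ T.kids u v →
      κ' w ≤ ((T.kids u v).map κ').sum := fun hw =>
    List.single_le_sum (fun _ _ => Nat.zero_le _) _ (List.mem_map_of_mem hw)
  induction h generalizing m with
  | @leaf u v κ hk hv =>
    have hpos := Finset.card_pos.2 ⟨v, self_mem_comp hu⟩
    obtain ⟨m, rfl⟩ := Nat.exists_eq_add_of_lt (lt_of_lt_of_le hpos hm)
    rw [zero_add, solve_succ_eq, hk]
    exact leaf_tableComplete hγ hu hk hκ hv
  | @seed u v κ κ' hv hne hfeas hsum ih =>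
    have hpos := Finset.card_pos.2 ⟨v, self_mem_comp hu⟩
    obtain ⟨m, rfl⟩ := Nat.exists_eq_add_of_lt (lt_of_lt_of_le hpos hm)
    rw [zero_add] at hm ⊢
    rw [solve_succ_eq]
    have hp := hkids u v m
    have hL : ∀ kid ∈ (T.kids u v).reverse.map fun w => (w, (solve T S k γ (Fintype.card V)
        (fun _ => false) m (some v) w).val),
        TableComplete T S γ β (some v) kid.1 (κ' kid.1) kid.2 := by
      intro kid hkid
      obtain ⟨w, hw, rfl⟩ := List.mem_map.1 hkid
      have hw := List.mem_reverse.1 hw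
      have h₁ := card_comp_kid_lt hu hw
      have h₂ := hle (κ' := κ') hw
      exact ih w hw (isDir_kid hw) (by omega) (by omega)
    revert hp hL
    generalize ((T.kids u v).reverse.map fun w => (w, (solve T S k γ (Fintype.card V)
      (fun _ => false) m (some v) w).val)) = L
    intro hp hL
    match L with
    | [] => exact absurd (List.perm_nil.1 hp) hne
    | [_] =>
      rw [nodeTable, if_pos hv]
      exact internalSeed_tableComplete hγ hu hv hp hL hκ hsum
    | _ :: _ :: _ =>
      rw [nodeTable, if_pos hv]
      exact internalSeed_tableComplete hγ hu hv hp hL hκ hsum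
  | @nonseed u v κ κ' hv hne hfeas hsum ih =>
    have hpos := Finset.card_pos.2 ⟨v, self_mem_comp hu⟩
    obtain ⟨m, rfl⟩ := Nat.exists_eq_add_of_lt (lt_of_lt_of_le hpos hm)
    rw [zero_add] at hm ⊢
    rw [solve_succ_eq]
    have hp := hkids u v m
    have hL : ∀ kid ∈ (T.kids u v).reverse.map fun w => (w, (solve T S k γ (Fintype.card V)
        (fun _ => false) m (some v) w).val),
        TableComplete T S γ β (some v) kid.1 (κ' kid.1) kid.2 := by
      intro kid hkid
      obtain ⟨w, hw, rfl⟩ := List.mem_map.1 hkid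
      have hw := List.mem_reverse.1 hw
      have h₁ := card_comp_kid_lt hu hw
      have h₂ := hle (κ' := κ') hw
      exact ih w hw (isDir_kid hw) (by omega) (by omega)
    revert hp hL
    generalize ((T.kids u v).reverse.map fun w => (w, (solve T S k γ (Fintype.card V)
      (fun _ => false) m (some v) w).val)) = L
    intro hp hL
    subst hsum
    match L with
    | [] => exact absurd (List.perm_nil.1 hp) hne
    | [kid] =>
      rw [nodeTable, if_neg hv]
      have hk := List.perm_singleton.1 hp
      have h₁ : ((T.kids u v).map κ').sum = κ' kid.1 := by rw [hk]; simp
      rw [h₁] at hκ ⊢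
      exact nonseedWithChild_tableComplete hγ hu hv hk (hL kid (by simp)) hκ
    | kid₁ :: kid₂ :: rest =>
      rw [nodeTable, if_neg hv]
      exact nonseedWithChildren_tableComplete hγ hu hv hp hL hκ

variable (T S) in
/-- The number of nodes in the component of `v` that are marked in `β` and are not seeds. -/
def numMarked (β : V → Bool) (s : Finset V) : ℕ :=
  ∑ y ∈ s, if y ∉ S ∧ β y = true then 1 else 0

theorem sum_map_add_ite {l : List V} (hl : l.Nodup) {a : V} (ha : a ∈ l) (f : V → ℕ) (m : ℕ) :
    (l.map fun w => f w + if w = a then m else 0).sum = (l.map f).sum + m := by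
  rw [List.sum_map_add, ← List.sum_toFinset _ hl, ← List.sum_toFinset _ hl]
  simp [ha]

/-- Marks on seeds are useless and need not be kept. At an internal node the surplus budget is
handed to one child, so that the budgets add up exactly; a leaf that receives a surplus is simply
boosted, which stays within its budget. -/
theorem exists_feasible (β : V → Bool) (u : Option V) (v : V) (hu : T.IsDir u v) :
    ∀ κ, numMarked S β (T.comp u v) ≤ κ → ∃ β' : V → Bool,
      (∀ y ∈ T.comp u v, y ∉ S → β y = true → β' y = true) ∧
      (∑ y ∈ T.comp u v, if β' y = true then 1 else 0) ≤ κ ∧ Feasible T S β' u v κ := by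
  refine tree_induction (P := fun u v => ∀ κ, numMarked S β (T.comp u v) ≤ κ →
    ∃ β' : V → Bool, (∀ y ∈ T.comp u v, y ∉ S → β y = true → β' y = true) ∧
      (∑ y ∈ T.comp u v, if β' y = true then 1 else 0) ≤ κ ∧ Feasible T S β' u v κ)
    (fun u v hu ih κ hκ => ?_) u v hu
  rcases List.eq_nil_or_concat (T.kids u v) with hk | ⟨L₀, w₀, hw₀⟩
  · have hcomp : T.comp u v = {v} := by rw [comp_eq hu, hk]; simp
    refine ⟨fun _ => decide (0 < κ), fun y hy hyS hβ => ?_, ?_, .leaf hk rfl⟩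
    · rw [hcomp, Finset.mem_singleton] at hy
      subst hy
      rw [hcomp, numMarked, Finset.sum_singleton, if_pos ⟨hyS, hβ⟩] at hκ
      exact decide_eq_true (by omega)
    · rw [hcomp, Finset.sum_singleton]
      split_ifs with h
      · exact of_decide_eq_true h
      · exact Nat.zero_le _
  have hw₀ : w₀ ∈ T.kids u v := by rw [hw₀]; simp
  have hne : T.kids u v ≠ [] := List.ne_nil_of_mem hw₀
  -- An internal seed is never boosted by the program, so its mark is dropped.
  set bv : Bool := decide (v ∉ S) && β v with hbv
  have hnum : numMarked S β (T.comp u v) = bv.toNat +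
      ((T.kids u v).map fun w => numMarked S β (T.comp (some v) w)).sum := by
    rw [numMarked, sum_comp _ hu]
    congr 1
    by_cases h₁ : v ∈ S <;> cases h₂ : β v <;> simp [hbv, h₁, h₂]
  set r := κ - numMarked S β (T.comp u v) with hr
  set κ' : V → ℕ := fun w => numMarked S β (T.comp (some v) w) + if w = w₀ then r else 0 with hκ'
  have hsum : ((T.kids u v).map κ').sum + bv.toNat = κ := by
    rw [hκ', sum_map_add_ite (kids_nodup u v) hw₀]
    omega
  have hch : ∀ w, ∃ β' : V → Bool, w ∈ T.kids u v →
      (∀ y ∈ T.comp (some v) w, y ∉ S → β y = true → β' y = true) ∧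
      (∑ y ∈ T.comp (some v) w, if β' y = true then 1 else 0) ≤ κ' w ∧
      Feasible T S β' (some v) w (κ' w) := by
    intro w
    by_cases hw : w ∈ T.kids u v
    · obtain ⟨β', h⟩ := ih w hw (κ' w) (Nat.le_add_right _ _)
      exact ⟨β', fun _ => h⟩
    · exact ⟨β, fun h => absurd h hw⟩
  choose βw hβw using hch
  classical
  -- The assignments of the subtrees glue together, because every node other than `v` lies below at
  -- most one child.
  set β' : V → Bool := fun y => if y = v then bv else
    decide (∃ w ∈ T.kids u v, y ∈ T.comp (some v) w ∧ βw w y = true) with hβ'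
  have hv' : β' v = bv := by simp [hβ']
  have hagree : ∀ w ∈ T.kids u v, ∀ y ∈ T.comp (some v) w, βw w y = β' y := by
    intro w hw y hy
    have hyv : y ≠ v := by
      rintro rfl
      exact not_mem_comp_kid _ _ hy
    rw [hβ']
    simp only [hyv, if_false]
    rw [Bool.eq_iff_iff, decide_eq_true_eq]
    refine ⟨fun h => ⟨w, hw, hy, h⟩, ?_⟩
    rintro ⟨w', hw', hy', h⟩
    have : w = w' := (mem_comp.1 hy).trans_avoiding (mem_kids.1 hw).1 (mem_kids.1 hw').1
      (mem_comp.1 hy')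
    rwa [this]
  refine ⟨β', fun y hy hyS hβy => ?_, ?_, ?_⟩
  · rcases (mem_comp_iff hu).1 hy with rfl | ⟨w, hw, hyw⟩
    · rw [hv', hbv]
      simp [hyS, hβy]
    · rw [← hagree w hw y hyw]
      exact (hβw w hw).1 y hyw hyS hβy
  · rw [sum_comp _ hu, hv']
    have h₁ : ((T.kids u v).map fun w => ∑ y ∈ T.comp (some v) w,
        if β' y = true then 1 else 0).sum ≤ ((T.kids u v).map κ').sum := by
      refine List.sum_le_sum fun w hw => le_trans (le_of_eq ?_) (hβw w hw).2.1
      exact Finset.sum_congr rfl fun y hy => by rw [hagree w hw y hy]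
    have h₂ : (if bv = true then 1 else 0) = bv.toNat := by cases bv <;> rfl
    omega
  · have hfeas : ∀ w ∈ T.kids u v, Feasible T S β' (some v) w (κ' w) := fun w hw =>
      (hβw w hw).2.2.congr (isDir_kid hw) (hagree w hw)
    by_cases hv : v ∈ S
    · exact .seed κ' hv hne hfeas (by omega)
    · exact .nonseed κ' hv hne hfeas (by rw [hv', hsum])


/-! ### The approximation guarantee -/

section Guarantee

open BidirectedTree

variable {V : Type} [Fintype V] [DecidableEq V] {T : BidirectedTree V} {S : Finset V}

theorem gain_none (β : V → Bool) (v : V) : gain T S β v =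
    T.infl S (T.bprob β) none v - T.infl S (T.bprob fun _ => false) none v := by
  rw [gain, baseline]
  exact max_eq_left (sub_nonneg.2 (infl_bprob_mono (by simp) (T.isDir_none v)))

theorem sum_gain (β : V → Bool) : ∑ v, gain T S β v = T.boost S (marked β) := by
  rw [boost_marked]
  exact Finset.sum_congr rfl fun v _ => gain_none β v

theorem boost_marked_mono {β β' : V → Bool} (h : ∀ v ∉ S, β v = true → β' v = true) :
    T.boost S (marked β) ≤ T.boost S (marked β') := by
  rw [← sum_gain, ← sum_gain]
  refine Finset.sum_le_sum fun v _ => ?_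
  rw [gain_none, gain_none]
  have := infl_bprob_mono (T := T) (S := S) h (T.isDir_none v)
  linarith

theorem marked_decide (B : Finset V) : marked (fun v => decide (v ∈ B)) = B := by
  ext v; simp [marked]

theorem roundingParameter_pos [Nonempty V] (k : ℕ) {ε : ℝ} (hε : 0 < ε) :
    0 < (roundingParameter T S (Fintype.card V) k ε).val := by
  rw [roundingParameter_val]
  have := sum_sumReach_pos (T := T) k
  have : 0 < max (greedyBoost T S (Fintype.card V) k).val 1 := lt_max_of_lt_right one_pos
  positivity

/-- There is a feasible assignment that is at least as good as `B`. -/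
theorem exists_feasible_boost_le {B : Finset V} {k : ℕ} (hB : B.card ≤ k) (r : V) :
    ∃ β : V → Bool, (marked β).card ≤ k ∧ T.boost S B ≤ T.boost S (marked β) ∧
      Feasible T S β none r k := by
  obtain ⟨β, h₁, h₂, h₃⟩ := exists_feasible (T := T) (S := S) (fun v => decide (v ∈ B)) none r
    (T.isDir_none r) k (by
      rw [comp_none, numMarked]
      refine le_trans ?_ hB
      rw [Finset.sum_boole, Nat.cast_id]
      exact Finset.card_le_card fun v hv => by simpa using (Finset.mem_filter.1 hv).2.2)
  rw [comp_none] at h₁ h₂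
  refine ⟨β, ?_, ?_, h₃⟩
  · rwa [Finset.sum_boole, Nat.cast_id] at h₂
  · rw [← marked_decide B]
    exact boost_marked_mono fun v hv => h₁ v (Finset.mem_univ v) hv

theorem dpBoost_val (r : V) (k : ℕ) (ε : ℝ) :
    (dpBoost T r S k ε).val =
      match (forRange ((mkGrid (roundingParameter T S (Fintype.card V) k ε).val).val.top + 1) none
        fun c m => do
          let e ← readAt (solve T S k (mkGrid (roundingParameter T S (Fintype.card V) k ε).val).val
            (Fintype.card V) (fun _ => false) (Fintype.card V) none r).val (k, c, 0)
          maxEntry m e).val with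
      | none => []
      | some (_, A) => A.mems := by
  simp only [dpBoost, bind_val, newTable_val, lengthOf_val, length_nodes]
  generalize (forRange _ none _).val = best
  rcases best with _ | ⟨x, A⟩
  · rfl
  · simp [NodeSet.collect_val]

/-- The returned value `x` is at most the boost of the returned set by soundness, and at least the
boost of an admissible assignment no worse than `B`, less the accumulated rounding error, by
completeness. -/
theorem dpBoost_guarantee (r : V) {k : ℕ} {ε : ℝ} (hε : 0 < ε) {B : Finset V}
    (hB : T.IsOptimalBoost S k B) (hB₁ : 1 ≤ T.boost S B) :
    (dpBoost T r S k ε).val.toFinset.card ≤ k ∧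
      (1 - ε) * T.boost S B ≤ T.boost S (dpBoost T r S k ε).val.toFinset := by
  have : Nonempty V := ⟨r⟩
  set δ := (roundingParameter T S (Fintype.card V) k ε).val with hδ
  have hδ₀ : 0 < δ := roundingParameter_pos k hε
  have hγ := Grid.mkGrid_proper hδ₀
  have hr := T.isDir_none r
  have hm : (T.comp none r).card ≤ Fintype.card V := Finset.card_le_univ _
  obtain ⟨β, hβ, hBβ, hfeas⟩ := exists_feasible_boost_le (T := T) (S := S) hB.1 r
  obtain ⟨c, hc, -, hcf⟩ := solve_tableComplete (k := k) hγ hfeas hr le_rfl hm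
  have hbest := AtLeast.forRange_max (F := fun c => readAt (solve T S k (mkGrid δ).val
    (Fintype.card V) (fun _ => false) (Fintype.card V) none r).val (k, c, 0))
    -- At the root there is no influence from above, so `f = 0` is exact.
    (Nat.lt_succ_of_le hc) (hcf 0 (Nat.zero_le _) (by simp [above, errAbove]))
  obtain ⟨x, A, hA, hx⟩ := hbest
  have hval : (dpBoost T r S k ε).val = A.mems := by rw [dpBoost_val, ← hδ, hA]
  obtain ⟨c', -, hc'⟩ := forRange_max_eq_some hA
  obtain ⟨-, hlen, -, hs⟩ := solve_entrySound hγ hr hm _ _ _ hc'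
  obtain ⟨-, hs⟩ := hs (fun y => decide (y ∈ A.mems)) fun _ _ => rfl
  replace hs := hs (by simp [above])
  have hAm : marked (fun y => decide (y ∈ A.mems)) = A.mems.toFinset := by ext v; simp [marked]
  rw [comp_none, sum_gain, hAm] at hs
  rw [hval]
  refine ⟨(List.toFinset_card_le _).trans hlen, le_trans ?_ hs⟩
  refine le_trans ?_ hx
  have hmesh : (mkGrid δ).val.mesh = δ := rfl
  rw [comp_none, hmesh]
  simp only [target]
  rw [Finset.sum_sub_distrib, sum_gain, ← Finset.mul_sum]
  have hsum := sum_inSum_le (T := T) hβ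
  have hpos := sum_sumReach_pos (T := T) k
  obtain ⟨Bg, hBg, hg⟩ := greedyBoost_val (T := T) (S := S) k
  -- The greedy set competes with the optimum, and the optimum is at least one by hypothesis; so the
  -- numerator of `δ` is at most `ε` times the optimum.
  have hlb : max (greedyBoost T S (Fintype.card V) k).val 1 ≤ T.boost S B :=
    max_le (hg ▸ hB.2 Bg hBg) hB₁
  have herr : 2 * δ * ∑ v, T.inSum (T.bprob β) none v ≤ ε * T.boost S B := by
    refine (mul_le_mul_of_nonneg_left hsum (by positivity)).trans ?_
    refine le_trans (le_of_eq ?_) (mul_le_mul_of_nonneg_left hlb hε.le)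
    rw [hδ, roundingParameter_val]
    field_simp
  linarith

end Guarantee


/-! ### Counting steps -/

section Costs

variable {α β σ : Type} {a b c : ℕ}

theorem op_bind_steps_le {x : α} {f : α → Timed β} (h : (f x).steps ≤ b) :
    (op x >>= f).steps ≤ b + 1 := by
  rw [bind_steps, op_steps, op_val]
  omega

theorem bind_steps_le {x : Timed α} {f : α → Timed β} (hx : x.steps ≤ a)
    (h : ∀ s, (f s).steps ≤ b) : (x >>= f).steps ≤ b + a := by
  have := h x.val
  rw [bind_steps]
  omega

/-- For continuations whose cost is bounded only at the value actually computed, such as loops over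
a grid that has just been made. -/
theorem bind_steps_le_val {x : Timed α} {f : α → Timed β} (hx : x.steps ≤ a)
    (h : (f x.val).steps ≤ b) : (x >>= f).steps ≤ b + a := by
  rw [bind_steps]
  omega

theorem pure_steps_le (x : α) : (pure x : Timed α).steps ≤ b := Nat.zero_le _

theorem ite_steps_le {p : Prop} [Decidable p] {x y : Timed α} (hx : x.steps ≤ b)
    (hy : y.steps ≤ b) : (if p then x else y).steps ≤ b := by
  split <;> assumption

theorem ite_bind_steps_le {p : Prop} [Decidable p] {x y : Timed α} {f : α → Timed β}
    (hx : x.steps ≤ a) (hy : y.steps ≤ a) (h : ∀ s, (f s).steps ≤ b) :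
    (if p then x >>= f else y >>= f).steps ≤ b + a :=
  ite_steps_le (bind_steps_le hx h) (bind_steps_le hy h)

theorem newTable_steps_le {ι : Type} (m : ℕ) (x : α) :
    (newTable m x : Timed (ι → α)).steps ≤ m := le_rfl

theorem forRange_steps_le_of_le {body : ℕ → σ → Timed σ} {m m' : ℕ} {s : σ} (hm : m ≤ m')
    (h : ∀ i < m, ∀ s, (body i s).steps ≤ c) : (forRange m s body).steps ≤ m' * (c + 1) :=
  (forRange_steps_le h).trans (Nat.mul_le_mul_right _ hm)

theorem forList_bool_steps_le {body : Bool → σ → Timed σ} {s : σ}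
    (h : ∀ b s, (body b s).steps ≤ c) : (forList [false, true] s body).steps ≤ 2 * (c + 1) :=
  forList_steps_le_mul fun b _ s => h b s

theorem addEntry_steps {V : Type} (e e' : Entry V) : (addEntry e e').steps = 1 := by
  rcases e with _ | ⟨x, A⟩ <;> rcases e' with _ | ⟨y, B⟩ <;> rfl

theorem maxEntry_steps {V : Type} (e e' : Entry V) : (maxEntry e e').steps = 1 := by
  rcases e with _ | ⟨x, A⟩ <;> rcases e' with _ | ⟨y, B⟩ <;> rfl

theorem improve_steps_le {V ι : Type} [DecidableEq ι] (t : ι → Entry V) (i : ι) (e : Entry V) :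
    (improve t i e).steps ≤ 3 :=
  op_bind_steps_le (bind_steps_le (maxEntry_steps _ _).le fun _ => le_rfl)

theorem orProb_steps_le (x y : ℝ) : (orProb x y).steps ≤ 4 := le_rfl

theorem nodeBoost_steps_le (c f e ap : ℝ) : (nodeBoost c f e ap).steps ≤ 7 := le_rfl

theorem value_steps_le (γ : Grid) (i : ℕ) : (γ.value i).steps ≤ 3 := le_rfl

theorem round_steps_le (γ : Grid) (x : ℝ) : (γ.round x).steps ≤ 3 :=
  op_bind_steps_le (ite_steps_le (pure_steps_le _) le_rfl)

theorem mkGrid_steps_le (η : ℝ) : (mkGrid η).steps ≤ 2 := le_rfl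

theorem readParentProb_steps_le {V : Type} [DecidableEq V] (T : BidirectedTree V) (b : Bool)
    (u : Option V) (v : V) : (readParentProb T b u v).steps ≤ 1 := by
  cases u <;> exact le_rfl

end Costs

/-! ### Running time of the computation of the rounding parameter -/

section TreeCosts

open BidirectedTree

variable {V : Type} [Fintype V] [DecidableEq V] {T : BidirectedTree V} {S : Finset V}

/-- The steps of a loop over the neighbours of `v` that treats all of them but the parent. -/
theorem forList_adj_steps_le {σ : Type} {u : Option V} {v : V} (hu : T.IsDir u v) {s : σ}
    {f : V → σ → Timed σ} {t : V → ℕ} (h : ∀ w ∈ T.kids u v, ∀ s, (f w s).steps ≤ t w) :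
    (forList (T.adj v) s fun w s => do
      if ← isParent u w then
        pure s
      else
        f w s).steps ≤ ((T.kids u v).map fun w => t w + 2).sum + 2 := by
  have h₁ := forList_steps_le (l := T.adj v) (s := s) (body := fun w s => do
    if ← isParent u w then pure s else f w s) (c := fun w => 1 + if u = some w then 0 else t w)
    fun w hw s => by
      by_cases hw' : u = some w
      · simp [isParent, hw']
      · simpa [isParent, hw'] using h w (mem_kids.2 ⟨(T.mem_adj v w).1 hw, hw'⟩) s
  refine h₁.trans ?_
  have h₂ : ∀ l : List V, (l.map fun w => 1 + if u = some w then 0 else t w).sum + l.length =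
      (l.map fun w => 2 + if u = some w then 0 else t w).sum := by
    intro l
    induction l with
    | nil => rfl
    | cons w l ih =>
      simp only [List.map_cons, List.sum_cons, List.length_cons]
      omega
  rw [h₂, ((adj_perm hu).map _).sum_eq, List.map_append, List.sum_append]
  refine Nat.add_le_add (List.sum_le_sum fun w hw => ?_) ?_
  · rw [if_neg (mem_kids.1 hw).2, Nat.add_comm]
  · cases u <;> simp

/-- The costs of a recursion on the tree add up. -/
theorem add_sum_kids_le {u : Option V} {v : V} (hu : T.IsDir u v) {t : V → ℕ} {a : ℕ}
    (h : ∀ w ∈ T.kids u v, t w + a ≤ 2 * a * (T.comp (some v) w).card) :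
    a + ((T.kids u v).map fun w => t w + a).sum + a ≤ 2 * a * (T.comp u v).card := by
  rw [card_comp hu, Nat.mul_add, ← List.sum_map_mul_left]
  have := List.sum_le_sum h
  omega

/-- The additive constant on the left makes the bound inductive: it pays for the work of the parent
on this child, and each node receives twice that constant. -/
theorem activation_steps_le (β : V → Bool) {m : ℕ} {u : Option V} {v : V} (hu : T.IsDir u v) :
    (activation T S β m u v).steps + 6 ≤ 12 * (T.comp u v).card := by
  induction m generalizing u v with
  | zero =>
    have := Finset.card_pos.2 ⟨v, self_mem_comp hu⟩
    simp only [activation, pure_steps]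
    omega
  | succ m ih =>
    refine le_trans ?_ (add_sum_kids_le hu (a := 6) fun w hw => ih (isDir_kid hw))
    have h : (activation T S β (m + 1) u v).steps ≤ _ :=
      op_bind_steps_le (op_bind_steps_le (ite_steps_le (pure_steps_le _) (op_bind_steps_le
        (bind_steps_le (forList_adj_steps_le hu
          (t := fun w => (activation T S β m (some v) w).steps + 4) fun w hw s => ?_)
          fun _ => (le_rfl : _ ≤ 1)))))
    · have h' : ∀ l : List V, (l.map fun w => (activation T S β m (some v) w).steps + 4 + 2).sum =
        (l.map fun w => (activation T S β m (some v) w).steps + 6).sum := fun l => rfl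
      rw [h'] at h
      omega
    · simp only [bind_steps, readProb, rmul, rsub, op_steps]
      omega

theorem activation_none_steps_le (β : V → Bool) (m : ℕ) (v : V) :
    (activation T S β m none v).steps ≤ 12 * Fintype.card V := by
  have h := activation_steps_le (T := T) (S := S) β (m := m) (T.isDir_none v)
  rw [comp_none, Finset.card_univ] at h
  omega

theorem computeSpread_steps_le (n : ℕ) (β : V → Bool) : (computeSpread T S n β).steps ≤
    Fintype.card V * (12 * Fintype.card V + 2) := by
  have h := forList_steps_le_mul (l := T.nodes) (s := (0 : ℝ)) (c := 12 * Fintype.card V + 1)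
    (body := fun v s => do
      let a ← activation T S β n none v
      radd s a) fun v _ s => by
        have := activation_none_steps_le (T := T) (S := S) β n v
        simp only [bind_steps, radd, op_steps]
        omega
  rwa [length_nodes] at h

theorem greedyRound_steps_le (n : ℕ) (β : V → Bool) : (greedyRound T S n β).steps ≤
    Fintype.card V * (Fintype.card V * (12 * Fintype.card V + 2) + 5) + 1 := by
  rw [greedyRound, bind_steps]
  refine Nat.add_le_add ?_ ?_
  · rw [← length_nodes (T := T)]
    refine forList_steps_le_mul fun v _ st => ?_
    rw [length_nodes (T := T)]
    refine op_bind_steps_le (ite_steps_le (pure_steps_le _) ?_)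
    have h : ∀ β', (computeSpread T S n β').steps ≤
      Fintype.card V * (12 * Fintype.card V + 2) := computeSpread_steps_le n
    refine op_bind_steps_le (b := Fintype.card V * (12 * Fintype.card V + 2) + 2) ?_
    rw [Nat.add_comm]
    refine le_trans (bind_steps_le (h _) fun s => op_bind_steps_le (b := 1) ?_) (by omega)
    rcases st.2 with _ | ⟨w, t⟩
    · exact pure_steps_le _
    · exact op_bind_steps_le (ite_steps_le (pure_steps_le _) (pure_steps_le _))
  · generalize (Timed.val _) = st
    rcases st with ⟨st, _ | ⟨w, t⟩⟩
    · exact pure_steps_le _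
    · exact le_rfl

theorem greedyBoost_steps_le [Nonempty V] (k : ℕ) : (greedyBoost T S (Fintype.card V) k).steps ≤
    100 * ((k + 1) * Fintype.card V ^ 3) + 1 := by
  have h : (greedyBoost T S (Fintype.card V) k).steps ≤ _ :=
    bind_steps_le (newTable_steps_le _ _) fun _ => bind_steps_le (computeSpread_steps_le _ _)
      fun _ => bind_steps_le (forRange_steps_le fun _ _ _ => greedyRound_steps_le _ _) fun _ =>
        bind_steps_le (computeSpread_steps_le _ _) fun _ => le_rfl
  refine h.trans ?_
  obtain ⟨n, hn⟩ := Nat.exists_eq_add_one.2 (Fintype.card_pos (α := V))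
  rw [hn]
  ring_nf
  omega

theorem sumReach_steps_le {k m : ℕ} {u : Option V} {v : V} (hu : T.IsDir u v) (q : ℕ → ℝ) :
    (sumReach T k m u v q).steps + (9 * (k + 1) + 6) ≤
      2 * (9 * (k + 1) + 6) * (T.comp u v).card := by
  induction m generalizing u v q with
  | zero =>
    have := Finset.card_pos.2 ⟨v, self_mem_comp hu⟩
    simp only [sumReach, pure_steps]
    nlinarith
  | succ m ih =>
    have ha : ∀ w ∈ T.kids u v, 9 * (k + 1) + 6 ≤
        2 * (9 * (k + 1) + 6) * (T.comp (some v) w).card := fun w hw => by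
      have := Finset.card_pos.2 ⟨w, self_mem_comp (T.isDir_some (mem_kids.1 hw).1)⟩
      nlinarith
    -- A bound for the recursive call that does not depend on the table passed to it; by `ha` the
    -- subtraction is not truncated.
    set t := fun w => 2 * (9 * (k + 1) + 6) * (T.comp (some v) w).card - (9 * (k + 1) + 6)
      with ht
    refine le_trans ?_ (add_sum_kids_le hu (t := t)
      fun w hw => (Nat.sub_add_cancel (ha w hw)).le)
    have h : (sumReach T k (m + 1) u v q).steps ≤ _ :=
      op_bind_steps_le (op_bind_steps_le (forList_adj_steps_le hu
          (t := fun w => t w + (9 * (k + 1) + 4)) fun w hw s => ?_))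
    · have h' : ∀ l : List V, (l.map fun w => t w + (9 * (k + 1) + 4) + 2).sum =
        (l.map fun w => t w + (9 * (k + 1) + 6)).sum := fun l => rfl
      rw [h'] at h
      omega
    · refine le_trans (op_bind_steps_le (op_bind_steps_le (bind_steps_le (newTable_steps_le _ _)
        fun t₀ => bind_steps_le (forRange_steps_le (c := 6) fun j _ t' => op_bind_steps_le
          (op_bind_steps_le (ite_steps_le (?_ : _ ≤ 4) ?_))) fun q' => bind_steps_le
          (Nat.le_sub_of_add_le (ih (isDir_kid hw) q')) fun _ => (le_rfl : _ ≤ 1)))) ?_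
      · simp [writeAt]
      · simp [writeAt, readAt, rmul, rmax]
      · simp only [ht]
        omega

theorem roundingParameter_steps_le [Nonempty V] (k : ℕ) (ε : ℝ) :
    (roundingParameter T S (Fintype.card V) k ε).steps ≤
      200 * ((k + 1) * Fintype.card V ^ 3) := by
  have h : (roundingParameter T S (Fintype.card V) k ε).steps ≤ _ :=
    bind_steps_le (greedyBoost_steps_le k) fun _ => op_bind_steps_le <| op_bind_steps_le <|
      bind_steps_le (forList_steps_le_mul (c := (k + 1) + (2 * (9 * (k + 1) + 6) *
        Fintype.card V + 1)) fun x _ s => ?_) fun _ => op_bind_steps_le (le_rfl : _ ≤ 1)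
  · refine h.trans ?_
    rw [length_nodes]
    obtain ⟨n, hn⟩ := Nat.exists_eq_add_one.2 (Fintype.card_pos (α := V))
    rw [hn]
    ring_nf
    omega
  · rw [Nat.add_comm (k + 1)]
    refine bind_steps_le (newTable_steps_le _ _) fun q => ?_
    have := sumReach_steps_le (T := T) (k := k) (m := Fintype.card V) (T.isDir_none x) q
    rw [comp_none, Finset.card_univ] at this
    simp only [bind_steps, radd, op_steps]
    omega

end TreeCosts


/-! ### The running time of the dynamic program -/

section DPCosts

open BidirectedTree

variable {V : Type} [DecidableEq V] {T : BidirectedTree V} {S : Finset V} {k : ℕ} {γ : Grid}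

theorem leaf_steps_le (ap : ℝ) (u : Option V) (v : V) : (leaf T S k γ ap u v).steps ≤
    20 * ((k + 1) * (γ.top + 1) * (γ.top + 1)) := by
  have h : (leaf T S k γ ap u v).steps ≤ _ :=
    bind_steps_le (newTable_steps_le _ _) fun _ => op_bind_steps_le <|
      bind_steps_le (value_steps_le _ _) fun _ => forRange_steps_le fun _ _ _ =>
        forRange_steps_le fun _ _ _ => bind_steps_le (value_steps_le _ _) fun _ =>
          bind_steps_le (readParentProb_steps_le _ _ _ _) fun _ =>
            bind_steps_le (nodeBoost_steps_le _ _ _ _) fun _ => (le_rfl : _ ≤ 1)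
  refine h.trans ?_
  ring_nf
  omega

theorem internalSeed_steps_le (L : List (V × Table V)) : (internalSeed k γ L).steps ≤
    20 * (L.length + 1) * ((k + 1) * (k + 1) * (γ.top + 1) * (γ.top + 1)) := by
  have h : (internalSeed k γ L).steps ≤ _ :=
    bind_steps_le (newTable_steps_le _ _) fun _ => bind_steps_le (newTable_steps_le _ _) fun _ =>
      bind_steps_le (forList_steps_le_mul fun _ _ _ => bind_steps_le (newTable_steps_le _ _)
        fun _ => forRange_steps_le fun _ _ _ => bind_steps_le (forRange_steps_le fun _ _ _ =>
          op_bind_steps_le (maxEntry_steps _ _).le) fun _ =>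
            forRange_steps_le_of_le (Nat.sub_le _ _) fun _ _ _ => op_bind_steps_le <|
              bind_steps_le (addEntry_steps _ _).le fun _ => improve_steps_le _ _ _)
      fun _ => forRange_steps_le fun _ _ _ => forRange_steps_le fun _ _ _ =>
        op_bind_steps_le (le_rfl : _ ≤ 1)
  refine h.trans ?_
  ring_nf
  omega

theorem nonseedWithChild_steps_le (ap : ℝ) (u : Option V) (v w : V) (g : Table V) :
    (nonseedWithChild T k γ ap u v w g).steps ≤
      100 * ((k + 1) * (γ.top + 1) * (γ.top + 1)) := by
  have h : (nonseedWithChild T k γ ap u v w g).steps ≤ _ :=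
    bind_steps_le (newTable_steps_le _ _) fun _ => forList_bool_steps_le fun _ _ =>
      bind_steps_le (readParentProb_steps_le _ _ _ _) fun _ => op_bind_steps_le <|
        forRange_steps_le fun _ _ _ => forRange_steps_le fun _ _ _ =>
          bind_steps_le (value_steps_le _ _) fun _ => bind_steps_le (value_steps_le _ _) fun _ =>
          op_bind_steps_le <| bind_steps_le (round_steps_le _ _) fun _ => op_bind_steps_le <|
          bind_steps_le (round_steps_le _ _) fun _ => bind_steps_le (value_steps_le _ _) fun _ =>
          bind_steps_le (nodeBoost_steps_le _ _ _ _) fun _ =>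
          forRange_steps_le_of_le (Nat.sub_le _ _) fun _ _ _ => op_bind_steps_le <|
          bind_steps_le (addEntry_steps _ _).le fun _ => improve_steps_le _ _ _
  refine h.trans ?_
  ring_nf
  omega

theorem helperStart_steps_le (b last : Bool) (γ₂ : Grid) (u : Option V) (v w₁ w₂ : V)
    (g₁ g₂ : Table V) : (helperStart T k γ b last γ₂ u v w₁ w₂ g₁ g₂).steps ≤
      (k + 1) * (γ₂.top + 1) * (γ₂.top + 1) +
        100 * ((k + 1) * (k + 1) * (γ.top + 1) * (γ.top + 1) * (γ₂.top + 1)) := by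
  have h : (helperStart T k γ b last γ₂ u v w₁ w₂ g₁ g₂).steps ≤ _ :=
    bind_steps_le (newTable_steps_le _ _) fun _ =>
      bind_steps_le (readParentProb_steps_le _ _ _ _) fun _ => op_bind_steps_le <|
      op_bind_steps_le <| forRange_steps_le fun _ _ _ => forRange_steps_le fun _ _ _ =>
      forRange_steps_le fun _ _ _ => bind_steps_le (value_steps_le _ _) fun _ =>
      bind_steps_le (value_steps_le _ _) fun _ => bind_steps_le (value_steps_le _ _) fun _ =>
      op_bind_steps_le <| op_bind_steps_le <| bind_steps_le (orProb_steps_le _ _) fun _ =>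
      bind_steps_le (round_steps_le _ _) fun _ =>
      ite_bind_steps_le (le_rfl : _ ≤ 1) (pure_steps_le _) fun _ =>
      bind_steps_le (orProb_steps_le _ _) fun _ => bind_steps_le (round_steps_le _ _) fun _ =>
      bind_steps_le (orProb_steps_le _ _) fun _ => bind_steps_le (round_steps_le _ _) fun _ =>
      forRange_steps_le fun _ _ _ => forRange_steps_le_of_le
        ((Nat.sub_le _ _).trans (Nat.sub_le _ _)) fun _ _ _ => op_bind_steps_le <|
      op_bind_steps_le <| bind_steps_le (addEntry_steps _ _).le fun _ => improve_steps_le _ _ _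
  refine h.trans ?_
  ring_nf
  omega

theorem helperStep_steps_le (b last : Bool) (γf γi : Grid) (u : Option V) (v w : V)
    (h gi : Table V) : (helperStep T k γ b last γf γi u v w h gi).steps ≤
      (k + 1) * (γi.top + 1) * (γi.top + 1) +
        100 * ((k + 1) * (k + 1) * (γ.top + 1) * (γf.top + 1) * (γi.top + 1)) := by
  have h : (helperStep T k γ b last γf γi u v w h gi).steps ≤ _ :=
    bind_steps_le (newTable_steps_le _ _) fun _ =>
      bind_steps_le (readParentProb_steps_le _ _ _ _) fun _ => op_bind_steps_le <|
      forRange_steps_le fun _ _ _ => forRange_steps_le fun _ _ _ =>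
      forRange_steps_le fun _ _ _ => bind_steps_le (value_steps_le _ _) fun _ =>
      bind_steps_le (value_steps_le _ _) fun _ => bind_steps_le (value_steps_le _ _) fun _ =>
      op_bind_steps_le <| bind_steps_le (orProb_steps_le _ _) fun _ =>
      bind_steps_le (round_steps_le _ _) fun _ =>
      ite_bind_steps_le (le_rfl : _ ≤ 1) (pure_steps_le _) fun _ =>
      bind_steps_le (orProb_steps_le _ _) fun _ => bind_steps_le (round_steps_le _ _) fun _ =>
      bind_steps_le (orProb_steps_le _ _) fun _ => bind_steps_le (round_steps_le _ _) fun _ =>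
      forRange_steps_le fun _ hκ _ => forRange_steps_le_of_le hκ fun _ _ _ => op_bind_steps_le <|
      op_bind_steps_le <| bind_steps_le (addEntry_steps _ _).le fun _ => improve_steps_le _ _ _
  refine h.trans ?_
  ring_nf
  omega

/-- The unit in which the costs at a node are counted, for grids with at most `G` values. -/
def nodeUnit (k M G : ℕ) : ℕ := (k + 1) * (k + 1) * M * G * G

theorem nodeUnit_pos {G : ℕ} (hγ : γ.top + 1 ≤ G) : 1 ≤ nodeUnit k (γ.top + 1) G := by
  have : 0 < G := by omega
  exact Nat.succ_le_of_lt (by rw [nodeUnit]; positivity)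

theorem helperSteps_steps_le {G : ℕ} (b : Bool) {γf : Grid} (u : Option V) (v : V)
    (hγ : γ.top + 1 ≤ G) (hγf : γf.top + 1 ≤ G) (rest : List (V × Table V)) (h : Table V) :
    (helperSteps T k γ b γf u v rest h).steps ≤
      102 * rest.length * nodeUnit k (γ.top + 1) G := by
  induction rest generalizing h with
  | nil => exact Nat.zero_le _
  | cons kid rest ih =>
    have hg : ∀ γi : Grid, γi.top + 1 ≤ G → (k + 1) * (γi.top + 1) * (γi.top + 1) +
        100 * ((k + 1) * (k + 1) * (γ.top + 1) * (γf.top + 1) * (γi.top + 1)) ≤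
        101 * nodeUnit k (γ.top + 1) G := by
      intro γi hi
      have h₁ : (k + 1) * (γi.top + 1) * (γi.top + 1) ≤ nodeUnit k (γ.top + 1) G := by
        calc (k + 1) * (γi.top + 1) * (γi.top + 1) ≤ (k + 1) * G * G := by gcongr
          _ ≤ (k + 1) * ((k + 1) * (γ.top + 1)) * G * G := by
            gcongr
            exact Nat.le_mul_of_pos_right _ (by positivity)
          _ = nodeUnit k (γ.top + 1) G := by rw [nodeUnit]; ring
      have h₂ : (k + 1) * (k + 1) * (γ.top + 1) * (γf.top + 1) * (γi.top + 1) ≤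
          nodeUnit k (γ.top + 1) G := by
        rw [nodeUnit]
        gcongr
      omega
    have h₁ : (helperSteps T k γ b γf u v (kid :: rest) h).steps ≤ _ := op_bind_steps_le
      (bind_steps_le ((helperStep_steps_le _ _ _ _ _ _ _ _ _).trans (hg _ ?_)) fun _ => ih _)
    · have h₂ : 1 ≤ nodeUnit k (γ.top + 1) G := nodeUnit_pos hγ
      refine h₁.trans ?_
      rw [List.length_cons, Nat.mul_succ, Nat.add_mul]
      omega
    · split_ifs
      · exact hγ
      · exact hγf

/-- Dividing the mesh by `l` multiplies the number of values by about `l`. For `l = 0` both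
quotients are zero by convention and the top index is zero. -/
theorem mkGrid_div_top_le (hγ : γ.Proper) (l : ℕ) :
    (mkGrid (γ.mesh / l)).val.top + 1 ≤ (l + 1) * (γ.top + 1) := by
  have h₁ : (mkGrid (γ.mesh / l)).val.top = ⌈1 / (γ.mesh / l)⌉₊ := rfl
  have h₂ : ⌈1 / (γ.mesh / l)⌉₊ ≤ l * γ.top := by
    rw [Nat.ceil_le, hγ.top_eq, one_div_div, div_eq_mul_one_div, Nat.cast_mul]
    exact mul_le_mul_of_nonneg_left (Nat.le_ceil _) (Nat.cast_nonneg _)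
  rw [h₁]
  nlinarith

/-- Both grids in use have at most `(d + 1) * (γ.top + 1)` values. Every child costs a bounded
number of units, in which only one of the three factors for the grids stays coarse. -/
theorem nonseedWithChildren_steps_le (hγ : γ.Proper) {d : ℕ} (ap : ℝ) (u : Option V) (v : V)
    (kid₁ kid₂ : V × Table V) (rest : List (V × Table V)) (hd : rest.length ≤ d) :
    (nonseedWithChildren T k γ ap u v kid₁ kid₂ rest).steps ≤
      300 * (rest.length + 1) * nodeUnit k (γ.top + 1) ((d + 1) * (γ.top + 1)) := by
  set G := (d + 1) * (γ.top + 1) with hG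
  have hG₁ : γ.top + 1 ≤ G := Nat.le_mul_of_pos_left _ (Nat.succ_pos d)
  have hG₂ : (mkGrid (γ.mesh / rest.length)).val.top + 1 ≤ G :=
    (mkGrid_div_top_le hγ _).trans (Nat.mul_le_mul_right _ (by omega))
  have hU : 1 ≤ nodeUnit k (γ.top + 1) G := nodeUnit_pos hG₁
  have hU₁ : ∀ g ≤ G, (k + 1) * g * g ≤ nodeUnit k (γ.top + 1) G := fun g hg => by
    calc (k + 1) * g * g ≤ (k + 1) * G * G := by gcongr
      _ ≤ (k + 1) * ((k + 1) * (γ.top + 1)) * G * G := by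
        gcongr
        exact Nat.le_mul_of_pos_right _ (by positivity)
      _ = nodeUnit k (γ.top + 1) G := by rw [nodeUnit]; ring
  have hU₂ : ∀ g ≤ G, (k + 1) * (k + 1) * (γ.top + 1) * (γ.top + 1) * g ≤
      nodeUnit k (γ.top + 1) G := fun g hg => by
    rw [nodeUnit]
    gcongr
  have hstart : ∀ (b : Bool) (γ₂ : Grid), γ₂.top + 1 ≤ G →
      (helperStart T k γ b rest.isEmpty γ₂ u v kid₁.1 kid₂.1 kid₁.2 kid₂.2).steps ≤
        101 * nodeUnit k (γ.top + 1) G := fun b γ₂ h₂ => by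
    refine (helperStart_steps_le _ _ _ _ _ _ _ _ _).trans ?_
    have h₃ := hU₁ _ h₂
    have h₄ := hU₂ _ h₂
    omega
  have h : (nonseedWithChildren T k γ ap u v kid₁ kid₂ rest).steps ≤ _ :=
    bind_steps_le (newTable_steps_le _ _) fun _ => bind_steps_le_val (lengthOf_steps _) <|
      op_bind_steps_le <| op_bind_steps_le <| bind_steps_le_val (mkGrid_steps_le _) <|
      forList_bool_steps_le fun _ _ => bind_steps_le (hstart _ _ ?_) fun _ =>
      bind_steps_le (helperSteps_steps_le _ _ _ hG₁ ?_ _ _) fun _ =>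
      bind_steps_le (readParentProb_steps_le _ _ _ _) fun _ => forRange_steps_le fun _ _ _ =>
      forRange_steps_le fun _ _ _ => forRange_steps_le fun _ _ _ =>
      bind_steps_le (value_steps_le _ _) fun _ => bind_steps_le (value_steps_le _ _) fun _ =>
      bind_steps_le (nodeBoost_steps_le _ _ _ _) fun _ => op_bind_steps_le <|
      bind_steps_le (addEntry_steps _ _).le fun _ => improve_steps_le _ _ _
  · refine h.trans ?_
    have h₁ := hU₁ _ hG₁
    have h₂ : (k + 1) * ((γ.top + 1) * ((γ.top + 1) * (3 + 1 + 1 + 7 + 3 + 3 + 1) + 1) + 1) ≤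
        21 * ((k + 1) * (γ.top + 1) * (γ.top + 1)) := by
      ring_nf
      omega
    have h₃ : rest.length ≤ rest.length * nodeUnit k (γ.top + 1) G :=
      Nat.le_mul_of_pos_right _ hU
    have h₄ : 300 * (rest.length + 1) * nodeUnit k (γ.top + 1) G =
      300 * (rest.length * nodeUnit k (γ.top + 1) G) + 300 * nodeUnit k (γ.top + 1) G := by ring
    rw [Nat.mul_assoc 102, h₄]
    omega
  · rw [lengthOf_val]
    split_ifs
    · exact hG₁
    · exact hG₂
  · rw [lengthOf_val]
    exact hG₂

end DPCosts

/-! ### Total running time of the recursion and of the algorithm -/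

section Total

open BidirectedTree

variable {V : Type} [Fintype V] [DecidableEq V] {T : BidirectedTree V} {S : Finset V} {k : ℕ}
  {γ : Grid}

/-- The hereditary predicate `Q` allows two uses: all directions, with `d` the number of nodes, and
the directions away from the root, with `d` a bound on the number of children. -/
theorem solve_steps_le (hγ : γ.Proper) {d : ℕ} {Q : Option V → V → Prop}
    (hQ : ∀ u v, Q u v → T.IsDir u v ∧ (T.kids u v).length ≤ d ∧ ∀ w ∈ T.kids u v, Q (some v) w)
    (m : ℕ) {u : Option V} {v : V} (hv : Q u v) {a : ℕ}
    (ha : a = 300 * nodeUnit k (γ.top + 1) ((d + 1) * (γ.top + 1)) + 12 * Fintype.card V + 4) :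
    (solve T S k γ (Fintype.card V) (fun _ => false) m u v).steps + a ≤
      2 * a * (T.comp u v).card := by
  induction m generalizing u v with
  | zero =>
    have := Finset.card_pos.2 ⟨v, self_mem_comp (hQ u v hv).1⟩
    simp only [solve, pure_steps]
    nlinarith
  | succ m ih =>
    obtain ⟨hu, hd, hkid⟩ := hQ u v hv
    refine le_trans ?_ (add_sum_kids_le hu (a := a) fun w hw => ih (hkid w hw))
    set t := fun w => (solve T S k γ (Fintype.card V) (fun _ => false) m (some v) w).steps with ht
    set U := nodeUnit k (γ.top + 1) ((d + 1) * (γ.top + 1)) with hU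
    have hG₁ : γ.top + 1 ≤ (d + 1) * (γ.top + 1) := Nat.le_mul_of_pos_left _ (Nat.succ_pos d)
    have hU₂ : (k + 1) * (k + 1) * (γ.top + 1) * (γ.top + 1) ≤ U := by
      rw [hU, nodeUnit]
      calc (k + 1) * (k + 1) * (γ.top + 1) * (γ.top + 1)
          = (k + 1) * (k + 1) * (γ.top + 1) * (γ.top + 1) * 1 := (Nat.mul_one _).symm
        _ ≤ _ := by gcongr; omega
    have hU₁ : (k + 1) * (γ.top + 1) * (γ.top + 1) ≤ U := le_trans (by
      gcongr
      exact Nat.le_mul_of_pos_right _ (Nat.succ_pos k)) hU₂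
    have h : (solve T S k γ (Fintype.card V) (fun _ => false) (m + 1) u v).steps ≤ _ :=
      op_bind_steps_le <| bind_steps_le_val (forList_adj_steps_le hu (t := t)
        fun w _ s => le_rfl) <| bind_steps_le (activation_none_steps_le _ _ _) fun ap =>
        op_bind_steps_le (b := 300 * ((T.kids u v).length + 1) * U) ?_
    · change _ ≤ a + ((T.kids u v).map fun w => t w + a).sum + a
      refine (Nat.add_le_add_right h a).trans ?_
      rw [List.sum_map_add, List.sum_map_add, List.map_const', List.map_const', List.sum_replicate,
        List.sum_replicate, smul_eq_mul, smul_eq_mul]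
      have h₁ : (T.kids u v).length * (300 * U + 4) ≤ (T.kids u v).length * a :=
        Nat.mul_le_mul_left _ (by omega)
      have h₂ : 300 * ((T.kids u v).length + 1) * U =
        300 * ((T.kids u v).length * U) + 300 * U := by ring
      have h₃ : (T.kids u v).length * (300 * U + 4) =
        300 * ((T.kids u v).length * U) + 4 * (T.kids u v).length := by ring
      omega
    · generalize hl : (Timed.val _ : List (V × Table V)) = l
      have hlen : l.length = (T.kids u v).length := by
        rw [← hl]
        simp only [forList_val, bind_val, isParent, op_val, ite_val, pure_val, decide_eq_true_eq]
        rw [foldl_adj, foldl_cons_eq]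
        simp
      rw [← hlen] at hd ⊢
      match l with
      | [] => exact (leaf_steps_le _ _ _).trans (by simp; omega)
      | [kid] =>
        refine ite_steps_le ((internalSeed_steps_le _).trans ?_)
          ((nonseedWithChild_steps_le _ _ _ _ _).trans ?_)
        · simp only [List.length_cons, List.length_nil]
          omega
        · simp only [List.length_cons, List.length_nil]
          omega
      | kid₁ :: kid₂ :: rest =>
        refine ite_steps_le ((internalSeed_steps_le _).trans ?_)
          ((nonseedWithChildren_steps_le hγ (d := d) _ _ _ _ _ _ ?_).trans ?_)
        · gcongr
          norm_num
        · simp only [List.length_cons] at hd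
          omega
        · gcongr
          simp only [List.length_cons]
          omega

/-- The running time, if the number of children of the nodes is at most `d`. -/
theorem dpBoost_steps_le {r : V} {d : ℕ} {Q : Option V → V → Prop}
    (hQ : ∀ u v, Q u v → T.IsDir u v ∧ (T.kids u v).length ≤ d ∧ ∀ w ∈ T.kids u v, Q (some v) w)
    (hr : Q none r) {ε : ℝ} (hε : 0 < ε) {M : ℕ}
    (hM : (mkGrid (roundingParameter T S (Fintype.card V) k ε).val).val.top + 1 = M) :
    (dpBoost T r S k ε).steps ≤ 1000 * ((k + 1) * Fintype.card V ^ 3 +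
      Fintype.card V * nodeUnit k M ((d + 1) * M)) := by
  have : Nonempty V := ⟨r⟩
  have hγ := Grid.mkGrid_proper (roundingParameter_pos (T := T) (S := S) k hε)
  have hsolve := solve_steps_le (S := S) (k := k) hγ hQ (Fintype.card V) hr rfl
  have hsound := solve_entrySound (S := S) (k := k) hγ (hQ _ _ hr).1
    (Finset.card_le_univ (T.comp none r))
  have hlen := lengthOf_steps T.nodes
  have hround := roundingParameter_steps_le (T := T) (S := S) k ε
  have hU : M ≤ nodeUnit k M ((d + 1) * M) := by
    have hM₁ : 1 ≤ (d + 1) * M := Nat.mul_pos (Nat.succ_pos d) (by omega)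
    rw [nodeUnit]
    calc M = 1 * 1 * M * 1 * 1 := by ring
      _ ≤ _ := by gcongr <;> omega
  rw [comp_none, Finset.card_univ] at hsolve
  rw [hM] at hsolve
  rw [length_nodes] at hlen
  have h : (dpBoost T r S k ε).steps ≤ _ :=
    bind_steps_le_val hlen <| bind_steps_le_val (by rw [lengthOf_val, length_nodes]) <|
      bind_steps_le_val (mkGrid_steps_le _) <| bind_steps_le_val (newTable_steps_le _ _) <|
      -- Scanning the `M` root entries takes three steps each. Collecting the set takes at most
      -- twice its size, which `EntrySound` bounds by four times the number of nodes.
      bind_steps_le_val (b := 8 * Fintype.card V + M * 3) le_rfl ?_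
  · simp only [lengthOf_val, length_nodes] at h
    refine h.trans ?_
    have hn : 1 ≤ Fintype.card V := Fintype.card_pos
    rw [newTable_val]
    set n := Fintype.card V
    set U := nodeUnit k M ((d + 1) * M)
    have h₁ : n * n ≤ (k + 1) * n ^ 3 := by
      calc n * n = 1 * (n ^ 2) := by ring
        _ ≤ (k + 1) * n ^ 3 := by gcongr <;> omega
    have h₂ : n ≤ n * n := Nat.le_mul_self n
    have h₃ : U ≤ n * U := Nat.le_mul_of_pos_left _ hn
    have h₄ : 2 * (300 * U + 12 * n + 4) * n = 600 * (n * U) + 24 * (n * n) + 8 * n := by ring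
    omega
  · simp only [lengthOf_val, length_nodes, newTable_val]
    rw [hM]
    refine bind_steps_le_val (forRange_steps_le fun _ _ _ => op_bind_steps_le
      (maxEntry_steps _ _).le) ?_
    generalize hb : (forRange M _ _).val = best
    rcases best with _ | ⟨x, A⟩
    · exact pure_steps_le _
    · obtain ⟨c, -, hc⟩ := forRange_max_eq_some hb
      obtain ⟨-, -, hs, -⟩ := hsound _ _ _ hc
      rw [comp_none, Finset.card_univ] at hs
      have := A.collect_steps []
      change (A.collect []).steps ≤ _
      omega

end Total


/-! ### The bounds on the running time -/

section Bounds

open BidirectedTree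

variable {V : Type} [Fintype V] [DecidableEq V] {T : BidirectedTree V} {S : Finset V} {k : ℕ}

/-- The numerator of `δ` is at least `ε` and its denominator at most `2n²`. The last `2` accounts
for rounding up and for the index zero. -/
theorem top_mkGrid_le (k : ℕ) {ε : ℝ} (hε : 0 < ε) :
    (((mkGrid (roundingParameter T S (Fintype.card V) k ε).val).val.top + 1 : ℕ) : ℝ) ≤
      2 * (Fintype.card V : ℝ) ^ 2 / ε + 2 := by
  have h₁ : (mkGrid (roundingParameter T S (Fintype.card V) k ε).val).val.top =
      ⌈1 / (roundingParameter T S (Fintype.card V) k ε).val⌉₊ := rfl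
  have h₂ : 1 / (roundingParameter T S (Fintype.card V) k ε).val ≤
      2 * (Fintype.card V : ℝ) ^ 2 / ε := by
    rw [roundingParameter_val, one_div_div]
    refine div_le_div₀ (by positivity) ?_ hε (le_mul_of_one_le_right hε.le (le_max_right _ _))
    exact mul_le_mul_of_nonneg_left (sum_sumReach_le k) zero_le_two
  have h₃ : (⌈1 / (roundingParameter T S (Fintype.card V) k ε).val⌉₊ : ℝ) ≤
      2 * (Fintype.card V : ℝ) ^ 2 / ε + 1 :=
    (Nat.cast_le.2 (Nat.ceil_le_ceil h₂)).trans (Nat.ceil_lt_add_one (by positivity)).le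
  rw [h₁]
  push_cast
  linarith

theorem dpBoost_steps_le_real {r : V} {d : ℕ} {Q : Option V → V → Prop}
    (hQ : ∀ u v, Q u v → T.IsDir u v ∧ (T.kids u v).length ≤ d ∧ ∀ w ∈ T.kids u v, Q (some v) w)
    (hr : Q none r) {ε : ℝ} (hε : 0 < ε) :
    ((dpBoost T r S k ε).steps : ℝ) ≤ 1000 * (((k : ℝ) + 1) * (Fintype.card V : ℝ) ^ 3 +
      Fintype.card V * (((k : ℝ) + 1) ^ 2 * ((d : ℝ) + 1) ^ 2 *
        (2 * (Fintype.card V : ℝ) ^ 2 / ε + 2) ^ 3)) := by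
  have h₁ := dpBoost_steps_le (S := S) (k := k) hQ hr hε rfl
  have h₂ := top_mkGrid_le (T := T) (S := S) k hε
  generalize (mkGrid (roundingParameter T S (Fintype.card V) k ε).val).val.top + 1 = M at h₁ h₂
  have h₃ : ((dpBoost T r S k ε).steps : ℝ) ≤ 1000 * (((k : ℝ) + 1) * (Fintype.card V : ℝ) ^ 3 +
      Fintype.card V * (((k : ℝ) + 1) ^ 2 * ((d : ℝ) + 1) ^ 2 * (M : ℝ) ^ 3)) := by
    refine (Nat.cast_le.2 h₁).trans_eq ?_
    rw [nodeUnit]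
    push_cast
    ring
  refine h₃.trans ?_
  gcongr

theorem dpBoost_steps_le_of_le_one {r : V} {d : ℕ} {Q : Option V → V → Prop}
    (hQ : ∀ u v, Q u v → T.IsDir u v ∧ (T.kids u v).length ≤ d ∧ ∀ w ∈ T.kids u v, Q (some v) w)
    (hr : Q none r) {ε : ℝ} (hk : 1 ≤ k) (hε : 0 < ε) (hε₁ : ε ≤ 1) :
    ((dpBoost T r S k ε).steps : ℝ) ≤ 258000 * ((d : ℝ) + 1) ^ 2 *
      ((k : ℝ) ^ 2 * (Fintype.card V : ℝ) ^ 7 / ε ^ 3) := by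
  have hn : (1 : ℝ) ≤ Fintype.card V := Nat.one_le_cast.2 (Fintype.card_pos_iff.2 ⟨r⟩)
  have hk' : (1 : ℝ) ≤ k := Nat.one_le_cast.2 hk
  refine (dpBoost_steps_le_real hQ hr hε).trans ?_
  generalize (Fintype.card V : ℝ) = n at hn
  generalize (k : ℝ) = κ at hk'
  have hd : (1 : ℝ) ≤ (d : ℝ) + 1 := by simp
  generalize (d : ℝ) + 1 = e at hd
  -- This is where `ε ≤ 1` first enters. With `κ + 1 ≤ 2κ` the leading constant becomes `1000 · 2² ·
  -- 4³ = 256000`.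
  have hM : 2 * n ^ 2 / ε + 2 ≤ 4 * n ^ 2 / ε := by
    have h : 1 ≤ n ^ 2 / ε := (one_le_div hε).2 (hε₁.trans (one_le_pow₀ hn))
    have h₁ : 2 * n ^ 2 / ε = 2 * (n ^ 2 / ε) := by ring
    have h₂ : 4 * n ^ 2 / ε = 4 * (n ^ 2 / ε) := by ring
    linarith
  calc 1000 * ((κ + 1) * n ^ 3 + n * ((κ + 1) ^ 2 * e ^ 2 * (2 * n ^ 2 / ε + 2) ^ 3))
      ≤ 1000 * ((κ + κ) * n ^ 3 + n * ((κ + κ) ^ 2 * e ^ 2 * (4 * n ^ 2 / ε) ^ 3)) := by gcongr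
    _ = 2000 * (κ * n ^ 3) + 256000 * e ^ 2 * (κ ^ 2 * n ^ 7 / ε ^ 3) := by
      field_simp
      ring
    _ ≤ 2000 * (e ^ 2 * (κ ^ 2 * n ^ 7 / ε ^ 3)) +
        256000 * e ^ 2 * (κ ^ 2 * n ^ 7 / ε ^ 3) := by
      refine add_le_add_left (mul_le_mul_of_nonneg_left ?_ (by norm_num)) _
      calc κ * n ^ 3 = 1 * (κ ^ 1 * n ^ 3 / 1) := by ring
        _ ≤ e ^ 2 * (κ ^ 2 * n ^ 7 / ε ^ 3) := by
          gcongr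
          · exact one_le_pow₀ hd
          · norm_num
          · norm_num
          · exact pow_le_one₀ hε.le hε₁
    _ = 258000 * e ^ 2 * (κ ^ 2 * n ^ 7 / ε ^ 3) := by ring

theorem length_kids_le_card {u : Option V} {v : V} (hu : T.IsDir u v) :
    (T.kids u v).length ≤ Fintype.card V :=
  (length_kids_lt hu).le.trans (Finset.card_le_univ _)

theorem isDir_hereditary (u : Option V) (v : V) (hu : T.IsDir u v) : T.IsDir u v ∧
    (T.kids u v).length ≤ Fintype.card V ∧ ∀ w ∈ T.kids u v, T.IsDir (some v) w :=
  ⟨hu, length_kids_le_card hu, fun _ hw => isDir_kid hw⟩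

theorem dpBoost_steps_le_general {r : V} {ε : ℝ} (hk : 1 ≤ k) (hε : 0 < ε) (hε₁ : ε ≤ 1) :
    ((dpBoost T r S k ε).steps : ℝ) ≤
      1032000 * ((k : ℝ) ^ 2 * (Fintype.card V : ℝ) ^ 9 / ε ^ 3) := by
  refine (dpBoost_steps_le_of_le_one isDir_hereditary (T.isDir_none r) hk hε hε₁).trans ?_
  have hn : (1 : ℝ) ≤ Fintype.card V := Nat.one_le_cast.2 (Fintype.card_pos_iff.2 ⟨r⟩)
  generalize (Fintype.card V : ℝ) = n at hn
  calc 258000 * (n + 1) ^ 2 * ((k : ℝ) ^ 2 * n ^ 7 / ε ^ 3)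
      ≤ 258000 * (n + n) ^ 2 * ((k : ℝ) ^ 2 * n ^ 7 / ε ^ 3) := by gcongr
    _ = 1032000 * ((k : ℝ) ^ 2 * n ^ 9 / ε ^ 3) := by ring

/-- The exponent is `1 + 2 + 2 + 9`: one factor for the nodes, two for the budgets, two for the
children, and three grids of cubic size in `n + 1/ε`. -/
theorem dpBoost_steps_le_polynomial {r : V} {ε : ℝ} (hk : k ≤ Fintype.card V) (hε : 0 < ε) :
    ((dpBoost T r S k ε).steps : ℝ) ≤ 1026000 * ((Fintype.card V : ℝ) + 1 / ε) ^ 14 := by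
  refine (dpBoost_steps_le_real isDir_hereditary (T.isDir_none r) hε).trans ?_
  have hn : (1 : ℝ) ≤ Fintype.card V := Nat.one_le_cast.2 (Fintype.card_pos_iff.2 ⟨r⟩)
  have hk' : (k : ℝ) ≤ Fintype.card V := Nat.cast_le.2 hk
  have hk₀ : (0 : ℝ) ≤ k := Nat.cast_nonneg k
  generalize (Fintype.card V : ℝ) = n at hn hk'
  generalize (k : ℝ) = κ at hk' hk₀
  have hε' : 0 < 1 / ε := one_div_pos.2 hε
  set X := n + 1 / ε with hX
  have hnX : n ≤ X := by linarith
  have hX₁ : 1 ≤ X := hn.trans hnX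
  have hM : 2 * n ^ 2 / ε + 2 ≤ 4 * X ^ 3 := by
    have h₁ : n ^ 2 * (1 / ε) ≤ X ^ 2 * X := by
      gcongr
      linarith
    have h₂ : 1 ≤ X ^ 3 := one_le_pow₀ hX₁
    have h₃ : 2 * n ^ 2 / ε = 2 * (n ^ 2 * (1 / ε)) := by ring
    have h₄ : X ^ 3 = X ^ 2 * X := by ring
    linarith
  have hnX' : n + 1 ≤ 2 * X := by linarith
  have hκX : κ + 1 ≤ 2 * X := by linarith
  calc 1000 * ((κ + 1) * n ^ 3 + n * ((κ + 1) ^ 2 * (n + 1) ^ 2 * (2 * n ^ 2 / ε + 2) ^ 3))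
      ≤ 1000 * ((2 * X) * X ^ 3 + X * ((2 * X) ^ 2 * (2 * X) ^ 2 * (4 * X ^ 3) ^ 3)) := by gcongr
    _ = 2000 * X ^ 4 + 1024000 * X ^ 14 := by ring
    _ ≤ 2000 * X ^ 14 + 1024000 * X ^ 14 := by
      gcongr
      norm_num
    _ = 1026000 * X ^ 14 := by ring

/-! ### Rooted trees -/

/-- `u` is the parent of `v` in the tree rooted at `r`. -/
def IsRootedDir (T : BidirectedTree V) (r : V) : Option V → V → Prop
  | none, v => v = r
  | some u, v => T.G.Adj u v ∧ T.G.dist r v = T.G.dist r u + 1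

theorem not_mem_support_of_dist_lt {r v w : V} (h : T.G.dist r w < T.G.dist r v) :
    ∃ p : T.G.Walk r w, v ∉ p.support := by
  obtain ⟨p, hp⟩ := T.isTree.connected.exists_walk_length_eq_dist r w
  refine ⟨p, fun hv => ?_⟩
  have h₁ := T.G.dist_le (p.takeUntil v hv)
  have h₂ := p.length_takeUntil_le_length hv
  omega

/-- A neighbour of `v` closer to `r` is joined to the parent `u` by a walk through `r` that avoids
`v`, so it is `u`. If `v` is the root, no node is closer. -/
theorem dist_eq_of_mem_kids {r : V} {u : Option V} {v w : V} (hu : IsRootedDir T r u v)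
    (hw : w ∈ T.kids u v) : T.G.dist r w = T.G.dist r v + 1 := by
  obtain ⟨hvw, hne⟩ := mem_kids.1 hw
  rcases T.isTree.dist_eq_dist_add_one_of_adj r hvw with h | h
  · cases u with
    | none =>
      rw [IsRootedDir] at hu
      subst hu
      rw [SimpleGraph.dist_self] at h
      omega
    | some u =>
      obtain ⟨huv, hd⟩ := hu
      obtain ⟨p, hp⟩ := not_mem_support_of_dist_lt (T := T) (r := r) (v := v) (w := w) (by omega)
      obtain ⟨q, hq⟩ := not_mem_support_of_dist_lt (T := T) (r := r) (v := v) (w := u) (by omega)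
      refine absurd ?_ hne
      rw [eq_of_walk_avoiding huv.symm hvw (q.reverse.append p)]
      rw [SimpleGraph.Walk.mem_support_append_iff, SimpleGraph.Walk.support_reverse,
        List.mem_reverse]
      exact fun h => h.elim hq hp
  · exact h

theorem isRootedDir_hereditary {r : V} {d : ℕ} (hd : ∀ v, T.childCount r v ≤ d) (u : Option V)
    (v : V) (hu : IsRootedDir T r u v) : T.IsDir u v ∧ (T.kids u v).length ≤ d ∧
      ∀ w ∈ T.kids u v, IsRootedDir T r (some v) w := by
  have h := fun w hw => dist_eq_of_mem_kids (w := w) hu hw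
  refine ⟨?_, ?_, fun w hw => ⟨(mem_kids.1 hw).1, h w hw⟩⟩
  · cases u with
    | none => exact T.isDir_none v
    | some u => exact T.isDir_some hu.1
  · refine le_trans ?_ (hd v)
    rw [childCount, ← List.toFinset_card_of_nodup (kids_nodup u v), ← Set.ncard_coe_finset]
    refine Set.ncard_le_ncard (fun w hw => ?_) (Set.toFinite _)
    have hw : w ∈ T.kids u v := by simpa using hw
    exact ⟨(mem_kids.1 hw).1, h w hw⟩

theorem dpBoost_steps_le_of_childCount_le {r : V} {d : ℕ} (hd : ∀ v, T.childCount r v ≤ d)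
    {ε : ℝ} (hk : 1 ≤ k) (hε : 0 < ε) (hε₁ : ε ≤ 1) :
    ((dpBoost T r S k ε).steps : ℝ) ≤ 258000 * ((d : ℝ) + 1) ^ 2 *
      ((k : ℝ) ^ 2 * (Fintype.card V : ℝ) ^ 7 / ε ^ 3) :=
  dpBoost_steps_le_of_le_one (isRootedDir_hereditary hd) (rfl : IsRootedDir T r none r) hk hε hε₁

end Bounds

end Boosting

theorem mainTheorem1 :
    -- the returned set is feasible and (1 - ε)-approximate
    (∀ (V : Type) [Fintype V] [DecidableEq V] (T : Boosting.BidirectedTree V) (r : V)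
      (S : Finset V) (k : ℕ) (ε : ℝ) (Bopt : Finset V), 0 < ε →
      T.IsOptimalBoost S k Bopt → 1 ≤ T.boost S Bopt →
        (Boosting.dpBoost T r S k ε).val.toFinset.card ≤ k ∧
        (1 - ε) * T.boost S Bopt ≤ T.boost S (Boosting.dpBoost T r S k ε).val.toFinset) ∧
    -- the running time is O(k² n⁹ / ε³)
    (∃ C : ℝ, ∀ (V : Type) [Fintype V] [DecidableEq V] (T : Boosting.BidirectedTree V) (r : V)
      (S : Finset V) (k : ℕ) (ε : ℝ), 1 ≤ k → 0 < ε → ε ≤ 1 →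
        ((Boosting.dpBoost T r S k ε).steps : ℝ) ≤
          C * ((k : ℝ) ^ 2 * (Fintype.card V : ℝ) ^ 9 / ε ^ 3)) ∧
    -- the running time is O(k² n⁷ / ε³) if the number of children is bounded by a constant D
    (∀ D : ℕ, ∃ C : ℝ, ∀ (V : Type) [Fintype V] [DecidableEq V] (T : Boosting.BidirectedTree V)
      (r : V) (S : Finset V) (k : ℕ) (ε : ℝ), (∀ v, T.childCount r v ≤ D) →
      1 ≤ k → 0 < ε → ε ≤ 1 →
        ((Boosting.dpBoost T r S k ε).steps : ℝ) ≤
          C * ((k : ℝ) ^ 2 * (Fintype.card V : ℝ) ^ 7 / ε ^ 3)) ∧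
    -- for every ε > 0 the running time is polynomial in the number of nodes and 1 / ε
    (∃ (C : ℝ) (a : ℕ), ∀ (V : Type) [Fintype V] [DecidableEq V] (T : Boosting.BidirectedTree V)
      (r : V) (S : Finset V) (k : ℕ) (ε : ℝ), k ≤ Fintype.card V → 0 < ε →
        ((Boosting.dpBoost T r S k ε).steps : ℝ) ≤ C * ((Fintype.card V : ℝ) + 1 / ε) ^ a) := by
  refine ⟨fun V _ _ T r S k ε Bopt hε hB hB₁ => Boosting.dpBoost_guarantee r hε hB hB₁,
    ⟨1032000, fun V _ _ T r S k ε hk hε hε₁ => Boosting.dpBoost_steps_le_general hk hε hε₁⟩,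
    fun D => ⟨258000 * ((D : ℝ) + 1) ^ 2, fun V _ _ T r S k ε hD hk hε hε₁ =>
      Boosting.dpBoost_steps_le_of_childCount_le hD hk hε hε₁⟩,
    ⟨1026000, 14, fun V _ _ T r S k ε hk hε => Boosting.dpBoost_steps_le_polynomial hk hε⟩⟩
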